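/- **Model.** A network is a simple undirected graph $G$ on $n$ nodes with distinct identifiers in $\{0,\dots,n^{\kappa}-1\}$ and integer edge weights in $\{1,\dots,W\}$, where $W\le n^{\kappa}$ for a fixed constant $\kappa$; $\Delta$ is the maximum degree. In the $\mathsf{CONGEST}$ model the nodes work in synchronous rounds, and in each round every node may send one message of $O(\log n)$ bits over each incident edge (local computation is free). Initially a node knows only $n$, its own identifier, and the identifiers of its neighbours together with the weights of its incident edges; $\Delta$ and $W$ are not known. In a randomized algorithm each node draws, in every round, a private uniformly random element of a finite set whose size depends on $n$ only. A node that halts outputs its mate or "unmatched", and is silent afterwards. An algorithm is a *2-approximation for maximum weight matching* if, whenever all nodes have halted, the outputs form a matching $M$ with $w(M')\le 2\,w(M)$ for every matching $M'$ of $G$. It *finishes within $t$ rounds* if all nodes have halted after $t$ rounds. The line graph $L(G)$ has the edges of $G$ as its nodes, two of them being adjacent if they share an endpoint. MIS stands for maximal independent set. A *local aggregation algorithm* on a graph $H$ with $N$ nodes (with identifiers below $N^{\kappa}$) is an algorithm in which each node $v$ holds $O(\log N)$ bits of data, initially a function of $N$ and its identifier, and in each round until it halts computes new data from its old data $d_v$,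 its random draw, and a value $f(\{d_u : u\in N(v)\})$ of $O(\log N)$ bits. Here $f$ (which may depend on $N$ and on $d_v$) is an aggregate function: it is order invariant, and there is a joining function $\phi$ with $f(X_1\uplus X_2)=\phi(f(X_1),f(X_2))$ for all multisets $X_1,X_2$. **Theorem.** Let $T(n,d)$ be a natural-number-valued function that is nondecreasing in $d$, and let $p(n)\ge 0$. 1. (Randomized, running an MIS algorithm on the line graph.) There is an absolute constant $C$ such that the following holds for every $\kappa$. Suppose a local aggregation algorithm computes an MIS: on every graph $H$ with $N$ nodes and maximum degree $d$, the output is an MIS of $H$ whenever all nodes have halted, and with probability at least $1-p(N)$ it finishes within $\mathrm{MIS}(H)=T(N,d)$ rounds. Then there is a randomized 2-approximation algorithm for maximum weight matching in $\mathsf{CONGEST}$ that finishes, with probability at least $1-p(n^2)\,(\lfloor\log_2 W\rfloor+1)$, within $$C\,\bigl(T(n^2,\max(2\Delta-2,0))+1\bigr)\bigl(\lfloor\log_2 W\rfloor+1\bigr)=O(\mathrm{MIS}\cdot\log W)$$ rounds. (The line graph of $G$ has at most $n^2$ nodes and maximum degree at most $2\Delta-2$.) 2. (Randomized, with an MIS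 of the line graph computed on $G$.) The same holds with any $\mathsf{CONGEST}$ algorithm as black box which, executed on $G$, computes an MIS of $L(G)$ (that is, a maximal matching of $G$): if on every $n$-node graph of maximum degree $d$ its output is such an MIS whenever all nodes have halted, and it finishes within $T(n,d)$ rounds with probability at least $1-p(n)$, then there is a randomized 2-approximation algorithm for maximum weight matching in $\mathsf{CONGEST}$ that finishes, with probability at least $1-p(n)(\lfloor\log_2 W\rfloor+1)$, within $C\,(T(n,\Delta)+1)(\lfloor\log_2 W\rfloor+1)$ rounds, where $C$ is an absolute constant. 3. (Deterministic.) For every $\kappa$ there is a deterministic 2-approximation algorithm for maximum weight matching in $\mathsf{CONGEST}$ that always finishes within $O(\Delta+\log^* n)$ rounds, where the constant depends only on $\kappa$. -/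

import Mathlib

noncomputable section

open Finset

/-! ## Networks -/

/-- A network with `n` nodes: an undirected graph on the nodes, pairwise distinct identifiers,
and an edge weighting (only the weights of edges of the graph matter). -/
structure Network (n : ℕ) where
  graph : SimpleGraph (Fin n)
  id : Fin n → ℕ
  id_injective : Function.Injective id
  weight : Sym2 (Fin n) → ℕ

/-- What a node knows before the first round: the number of nodes, its own identifier, the
identifiers of its neighbours, and the weights of its incident edges (indexed by the identifier of
the other endpoint). Neither the maximum degree nor the maximum weight is known. -/
structure LocalInput where
  n : ℕ
  id : ℕ
  nbrs : Finset ℕ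
  weight : ℕ → ℕ

namespace Network

variable {n : ℕ} (N : Network n)

/-- Identifiers are polynomially bounded: `O(log n)` bits each. -/
def IdBound (κ : ℕ) : Prop := ∀ v, N.id v < n ^ κ

/-- The edge weights are integers in `{1, …, W}`. -/
def WeightBound (W : ℕ) : Prop := ∀ e ∈ N.graph.edgeSet, 1 ≤ N.weight e ∧ N.weight e ≤ W

/-- The maximum degree `Δ` of the network. -/
def maxDegree : ℕ := by
  classical exact N.graph.maxDegree

open Classical in
def localInput (v : Fin n) : LocalInput where
  n := n
  id := N.id v
  nbrs := {u | N.graph.Adj v u}.toFinset.image N.id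
  weight i := if h : ∃ u, N.graph.Adj v u ∧ N.id u = i then N.weight s(v, h.choose) else 0

open Classical in
/-- The inbox of `v`, indexed by the identifiers of its neighbours, if `msg u j` is what node `u`
sends to its neighbour with identifier `j`. The empty string stands for no message. -/
def inbox (msg : Fin n → ℕ → List Bool) (v : Fin n) : ℕ → List Bool :=
  fun i => if h : ∃ u, N.graph.Adj v u ∧ N.id u = i then msg h.choose (N.id v) else []

end Network

/-! ## Private randomness

In every round every node draws a fresh uniformly random number from `{0, …, m}`,
all draws being independent. -/

/-- The numbers drawn: `ω t v` is drawn by node `v` in round `t`. -/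
abbrev Coins (n m : ℕ) : Type := ℕ → Fin n → Fin (m + 1)

/-- Draws for the first `T` rounds, extended arbitrarily (by `0`) to the later rounds. -/
def extendCoins {n m T : ℕ} (ω : Fin T → Fin n → Fin (m + 1)) : Coins n m :=
  fun t v => if h : t < T then ω ⟨t, h⟩ v else 0

open Classical in
/-- The probability, over the uniformly random draws of the first `T` rounds, of an event `E`
that is determined by these draws. -/
def coinProb (n m T : ℕ) (E : Coins n m → Prop) : ℝ :=
  (#{ω : Fin T → Fin n → Fin (m + 1) | E (extendCoins ω)} : ℝ) /
    (Fintype.card (Fin T → Fin n → Fin (m + 1)) : ℝ)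

/-! ## Synchronous message passing algorithms -/

/-- A (uniform) synchronous message passing algorithm. In each round, every node that has not
halted draws a random number in `{0, …, maxCoin n}`, sends to each neighbour a bit string
(`send state coin j` goes to the neighbour with identifier `j`), and computes its new state from
its old state, the number drawn, and the strings received. A node halts as soon as `output` of its
state is not `none`; its output is `some i` (its mate has identifier `i`) or `none` (no mate).
The algorithm is deterministic if `maxCoin n = 0` for all `n`. -/
structure MsgAlg where
  State : Type
  maxCoin : ℕ → ℕ
  init : LocalInput → State
  send : State → ℕ → ℕ → List Bool
  step : State → ℕ → (ℕ → List Bool) → State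
  output : State → Option (Option ℕ)

namespace MsgAlg

variable (A : MsgAlg) {n : ℕ} (N : Network n)

/-- The message that a node in state `s` with random number `c` sends to its neighbour with
identifier `j`; halted nodes are silent. -/
def msgOf (s : A.State) (c j : ℕ) : List Bool :=
  if (A.output s).isSome then [] else A.send s c j

/-- The states of all nodes after `t` rounds; the state of a halted node no longer changes. -/
def run (ω : Coins n (A.maxCoin n)) : ℕ → Fin n → A.State
  | 0 => fun v => A.init (N.localInput v)
  | t + 1 => fun v =>
      let s := run ω t
      if (A.output (s v)).isSome then s v
      else A.step (s v) (ω t v) (N.inbox (fun u j => A.msgOf (s u) (ω t u) j) v)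

/-- All messages ever sent along edges have at most `b` bits. -/
def MessageBound (b : ℕ) : Prop :=
  ∀ (ω : Coins n (A.maxCoin n)) (t : ℕ) (v u : Fin n), N.graph.Adj v u →
    (A.msgOf (A.run N ω t v) (ω t v) (N.id u)).length ≤ b

def HaltedWith (ω : Coins n (A.maxCoin n)) (t : ℕ) (out : Fin n → Option ℕ) : Prop :=
  ∀ v, A.output (A.run N ω t v) = some (out v)

/-- On `N`, whenever all nodes have halted the output satisfies `P`; and with probability at least
`1 - p` all nodes have halted after `T` rounds. -/
def Computes (P : (Fin n → Option ℕ) → Prop) (T : ℕ) (p : ℝ) : Prop :=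
  (∀ ω t out, A.HaltedWith N ω t out → P out) ∧
    1 - p ≤ coinProb n (A.maxCoin n) T (fun ω => ∃ out, A.HaltedWith N ω T out)

end MsgAlg

/-! ## Matchings as outputs -/

namespace Network

variable {n : ℕ} (N : Network n)

/-- The outputs encode the set of edges of `M`: each node outputs its mate in `M`, if any. -/
def Encodes (out : Fin n → Option ℕ) (M : N.graph.Subgraph) : Prop :=
  ∀ v i, out v = some i ↔ ∃ u, M.Adj v u ∧ N.id u = i

open Classical in
def matchingWeight (M : N.graph.Subgraph) : ℕ := ∑ e with e ∈ M.edgeSet, N.weight e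

/-- The outputs form a matching whose weight is at least half the weight of any matching. -/
def IsTwoApproxMatching (out : Fin n → Option ℕ) : Prop :=
  ∃ M : N.graph.Subgraph, M.IsMatching ∧ N.Encodes out M ∧
    ∀ M' : N.graph.Subgraph, M'.IsMatching → N.matchingWeight M' ≤ 2 * N.matchingWeight M

/-- The outputs form a matching whose edges are a maximal independent set of the line graph
(equivalently, a maximal matching). -/
def IsLineGraphMIS (out : Fin n → Option ℕ) : Prop :=
  ∃ M : N.graph.Subgraph, M.IsMatching ∧ N.Encodes out M ∧
    Maximal N.graph.lineGraph.IsIndepSet {e : N.graph.edgeSet | (e : Sym2 (Fin n)) ∈ M.edgeSet}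

end Network

/-! ## Local aggregation algorithms -/

/-- A local aggregation algorithm for selecting a set of nodes. Every node keeps a string of data.
In each round, every node that has not halted draws a random number in `{0, …, maxCoin n}` and
computes its new data from its old data, the number drawn, and the value of an aggregate function
of the data of its neighbours. The function `agg n d` (which may depend on `n` and on the node's own
data `d`) is order invariant, being defined on multisets, and `join n d` is its joining function.
A node halts as soon as `output` of its data is not `none`, with output `true` (selected) or
`false`. -/
structure AggAlg where
  maxCoin : ℕ → ℕ
  /-- the initial data, from the number of nodes and the node's own identifier -/
  init : ℕ → ℕ → List Bool
  agg : ℕ → List Bool → Multiset (List Bool) → List Bool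
  join : ℕ → List Bool → List Bool → List Bool → List Bool
  agg_add : ∀ n d X Y, agg n d (X + Y) = join n d (agg n d X) (agg n d Y)
  /-- the new data, from the number of nodes, the old data, the random number and the aggregate -/
  step : ℕ → List Bool → ℕ → List Bool → List Bool
  output : ℕ → List Bool → Option Bool

namespace AggAlg

variable (A : AggAlg) {n : ℕ} (N : Network n)

open Classical in
/-- The data of the neighbours of `v`, if `d` is the data of all nodes. -/
def nbrData (d : Fin n → List Bool) (v : Fin n) : Multiset (List Bool) :=
  (univ.filter fun u => N.graph.Adj v u).val.map d

/-- The data of all nodes after `t` rounds; the data of a halted node no longer changes. -/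
def run (ω : Coins n (A.maxCoin n)) : ℕ → Fin n → List Bool
  | 0 => fun v => A.init n (N.id v)
  | t + 1 => fun v =>
      let d := run ω t
      if (A.output n (d v)).isSome then d v
      else A.step n (d v) (ω t v) (A.agg n (d v) (nbrData N d v))

/-- The data of a node, and the aggregate of the data of any set of its neighbours, always have at
most `b` bits. -/
def SizeBound (b : ℕ) : Prop :=
  ∀ (ω : Coins n (A.maxCoin n)) (t : ℕ) (v : Fin n),
    (A.run N ω t v).length ≤ b ∧
      ∀ X ≤ nbrData N (A.run N ω t) v, (A.agg n (A.run N ω t v) X).length ≤ b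

def HaltedWith (ω : Coins n (A.maxCoin n)) (t : ℕ) (out : Fin n → Bool) : Prop :=
  ∀ v, A.output n (A.run N ω t v) = some (out v)

/-- On the graph of `N`, whenever all nodes have halted the selected nodes form a maximal
independent set; and with probability at least `1 - p` all nodes have halted after `T` rounds. -/
def ComputesMIS (T : ℕ) (p : ℝ) : Prop :=
  (∀ ω t out, A.HaltedWith N ω t out → Maximal N.graph.IsIndepSet {v | out v = true}) ∧
    1 - p ≤ coinProb n (A.maxCoin n) T (fun ω => ∃ out, A.HaltedWith N ω T out)

end AggAlg

/-- `log* n`: the least `k` such that `k`-fold application of `x ↦ ⌈log₂ x⌉` to `n` gives a value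
at most `1`, i.e. the least `k` such that `n` is at most a tower of `k` twos. Rounding up does not
change this number. -/
def logStar (n : ℕ) : ℕ := sInf {k | (Nat.clog 2)^[k] n ≤ 1}

/-- A bound of `B` times the length of the binary representation of `n`, i.e. `O(log n)` bits. -/
def logBits (B n : ℕ) : ℕ := B * (Nat.log 2 n + 1)

end

/-! The argument is a distributed form of the local-ratio method. Every node keeps a potential `Y
v`, initially zero. To push an edge `vu` of positive residual weight `r = w(vu) - Y v - Y u` is to
add `r` to both potentials and to put the edge on top of the stacks of both endpoints. Once no
residual weight is positive, the potentials form a weighted vertex cover, so every matching has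
weight at most `∑ Y v`, which is twice the sum of all amounts pushed. The stacks are then unwound
from the top, selecting edges greedily. Every pushed edge is selected or lies below a selected edge
in the stack of one of its endpoints, and a selected edge weighs at least its own amount plus all
amounts below it in its two stacks. So the selected edges weigh at least the sum of all amounts,
which is half of the bound. `isTwoApproxMatching_of_certificate` is this accounting.

Vertex-disjoint stars can be pushed in one step, the centre treating its edges one by one
(`StarStacks.push`). Unwinding is correct whatever the timing (`unwind_sound`), and it takes three
rounds per step (`unwind_halts`). It remains to build the stacks in few steps.

Randomized: the steps are the levels `k = ⌊log₂ W⌋, …, 0`. Level `k` consists of the edges with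
residual weight in `[2 ^ k, 2 ^ (k + 1))`, and a maximal matching of it is pushed. Every edge of the
level has an endpoint whose potential grows by at least `2 ^ k`, so all residual weights fall below
`2 ^ k` (`residual_lt`). Nodes know neither `W` nor when the black box has finished elsewhere; they
proceed at their own pace, wait only for neighbours, and replay the black box from recorded messages
(`levelInv`, `level_progress`). All random numbers are drawn in the first round. The graph of level
`k` depends only on the draws for higher levels (`levelGraph_congr`), so the guarantee of the black
box applies level by level and a union bound finishes (`card_not_halted_le`). For an aggregation
algorithm the black box is a simulation on the line graph: the neighbourhood of an edge splits into
the other edges at either endpoint, and the joining function combines the two partial aggregates, at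
two rounds per simulated round (`lineRun_spec`).

Deterministic: linking every node to its `i`-th neighbour of larger identifier, for each `i`, splits
the graph into at most `Δ` forests. Cole–Vishkin colour reduction colours all of them in parallel,
in `log* n` rounds, with a number `D` of colours that depends only on `κ`
(`paletteBound_logStar_le`). The edges of one forest whose parents have one fixed colour form
disjoint stars, so there are `Δ * D` steps of two rounds each (`starInv_succ`). -/

noncomputable section

open Finset

/-! ### Data of neighbours, indexed by identifiers. -/

namespace Network

variable {n : ℕ} (N : Network n)

open Classical in
/-- The values `f u` at the neighbours `u` of `v`, indexed by identifiers; `d` elsewhere. -/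
def pull {α : Type*} (f : Fin n → α) (d : α) (v : Fin n) : ℕ → α :=
  fun i => if h : ∃ u, N.graph.Adj v u ∧ N.id u = i then f h.choose else d

variable {N}

theorem pull_id {α : Type*} {f : Fin n → α} {d : α} {v u : Fin n} (h : N.graph.Adj v u) :
    N.pull f d v (N.id u) = f u := by
  have h' : ∃ x, N.graph.Adj v x ∧ N.id x = N.id u := ⟨u, h, rfl⟩
  rw [pull, dif_pos h', N.id_injective h'.choose_spec.2]

theorem pull_of_not {α : Type*} {f : Fin n → α} {d : α} {v : Fin n} {i : ℕ}
    (h : ¬ ∃ u, N.graph.Adj v u ∧ N.id u = i) : N.pull f d v i = d := dif_neg h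

theorem inbox_eq_pull (msg : Fin n → ℕ → List Bool) (v : Fin n) :
    N.inbox msg v = N.pull (fun u => msg u (N.id v)) [] v := rfl

theorem inbox_id {msg : Fin n → ℕ → List Bool} {v u : Fin n} (h : N.graph.Adj v u) :
    N.inbox msg v (N.id u) = msg u (N.id v) := by
  rw [inbox_eq_pull, pull_id h]

theorem mem_nbrs {v : Fin n} {i : ℕ} :
    i ∈ (N.localInput v).nbrs ↔ ∃ u, N.graph.Adj v u ∧ N.id u = i := by
  simp [localInput]

theorem id_mem_nbrs {v u : Fin n} : N.id u ∈ (N.localInput v).nbrs ↔ N.graph.Adj v u := by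
  rw [mem_nbrs]
  exact ⟨fun ⟨x, hx, e⟩ => N.id_injective e ▸ hx, fun h => ⟨u, h, rfl⟩⟩

theorem localInput_weight {v u : Fin n} (h : N.graph.Adj v u) :
    (N.localInput v).weight (N.id u) = N.weight s(v, u) := by
  have h' : ∃ x, N.graph.Adj v x ∧ N.id x = N.id u := ⟨u, h, rfl⟩
  simp only [localInput]
  rw [dif_pos h', N.id_injective h'.choose_spec.2]

/-! ### Matchings given by mates -/

/-- The mate relation encoded by the outputs is symmetric and consists of edges. -/
def MatesConsistent (N : Network n) (out : Fin n → Option ℕ) : Prop :=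
  ∀ v i, out v = some i → ∃ u, N.graph.Adj v u ∧ N.id u = i ∧ out u = some (N.id v)

/-- The subgraph of the edges encoded by the outputs. -/
def mateGraph (N : Network n) (out : Fin n → Option ℕ) (h : N.MatesConsistent out) :
    N.graph.Subgraph where
  verts := {v | out v ≠ none}
  Adj v u := out v = some (N.id u)
  adj_sub {v u} e := by
    obtain ⟨x, hx, e', -⟩ := h v _ e
    exact N.id_injective e' ▸ hx
  edge_vert {v u} e := by simp [e]
  symm.symm v u e := by
    obtain ⟨x, hx, e', e''⟩ := h v _ e
    exact N.id_injective e' ▸ e''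

theorem mateGraph_isMatching {out : Fin n → Option ℕ} (h : N.MatesConsistent out) :
    (N.mateGraph out h).IsMatching := by
  intro v hv
  obtain ⟨i, hi⟩ := Option.ne_none_iff_exists'.1 hv
  obtain ⟨u, hu, rfl, -⟩ := h v i hi
  refine ⟨u, hi, fun y hy => ?_⟩
  have : some (N.id u) = some (N.id y) := hi.symm.trans hy
  exact (N.id_injective (Option.some_injective _ this)).symm

theorem mateGraph_encodes {out : Fin n → Option ℕ} (h : N.MatesConsistent out) :
    N.Encodes out (N.mateGraph out h) := by
  intro v i
  constructor
  · intro e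
    obtain ⟨u, hu, rfl, -⟩ := h v i e
    exact ⟨u, e, rfl⟩
  · rintro ⟨u, hu, rfl⟩
    exact hu

theorem matesConsistent_of_encodes {out : Fin n → Option ℕ} {M : N.graph.Subgraph}
    (he : N.Encodes out M) : N.MatesConsistent out := by
  intro v i e
  obtain ⟨u, hu, rfl⟩ := (he v i).1 e
  exact ⟨u, hu.adj_sub, rfl, (he u _).2 ⟨v, hu.symm, rfl⟩⟩

/-- Adjacency in the line graph is a shared endpoint, so an edge can be added to the independent set
exactly if both its endpoints are unmatched. The right-hand side is local, and it replaces
maximality in the line graph in all later arguments. -/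
theorem isLineGraphMIS_iff {out : Fin n → Option ℕ} :
    N.IsLineGraphMIS out ↔ N.MatesConsistent out ∧
      ∀ v u, N.graph.Adj v u → out v ≠ none ∨ out u ≠ none := by
  constructor
  · rintro ⟨M, hM, he, hmax⟩
    refine ⟨matesConsistent_of_encodes he, fun v u hvu => ?_⟩
    by_contra! hcon
    have hv : ∀ x, ¬ M.Adj v x := fun x hx => by
      have := (he v _).2 ⟨x, hx, rfl⟩; simp [hcon.1] at this
    have hu : ∀ x, ¬ M.Adj u x := fun x hx => by
      have := (he u _).2 ⟨x, hx, rfl⟩; simp [hcon.2] at this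
    let e : N.graph.edgeSet := ⟨s(v, u), hvu⟩
    have key : ∀ f : N.graph.edgeSet, (f : Sym2 (Fin n)) ∈ M.edgeSet →
        ¬ N.graph.lineGraph.Adj e f := by
      rintro ⟨f, hf⟩ hfM hadj
      rw [SimpleGraph.lineGraph_adj_iff_exists] at hadj
      obtain ⟨-, x, hx, hxf⟩ := hadj
      obtain ⟨y, rfl⟩ := hxf
      have hMxy : M.Adj x y := hfM
      rcases Sym2.mem_iff.1 hx with rfl | rfl
      · exact hv _ hMxy
      · exact hu _ hMxy
    have hins : N.graph.lineGraph.IsIndepSet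
        (insert e {e : N.graph.edgeSet | (e : Sym2 (Fin n)) ∈ M.edgeSet}) := by
      intro a ha b hb hab hadj
      rcases ha with rfl | ha <;> rcases hb with rfl | hb
      · exact hab rfl
      · exact key _ hb hadj
      · exact key _ ha hadj.symm
      · exact hmax.1 ha hb hab hadj
    have : e ∈ {e : N.graph.edgeSet | (e : Sym2 (Fin n)) ∈ M.edgeSet} :=
      hmax.2 hins (Set.subset_insert _ _) (Set.mem_insert _ _)
    exact hv u this
  · rintro ⟨hc, hm⟩
    refine ⟨N.mateGraph out hc, mateGraph_isMatching hc, mateGraph_encodes hc, ?_, ?_⟩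
    · rintro ⟨a, ha'⟩ ha ⟨b, hb'⟩ hb hab hadj
      rw [SimpleGraph.lineGraph_adj_iff_exists] at hadj
      obtain ⟨-, x, ⟨y, rfl⟩, ⟨z, rfl⟩⟩ := hadj
      have h1 : (N.mateGraph out hc).Adj x y := ha
      have h2 : (N.mateGraph out hc).Adj x z := hb
      have := (mateGraph_isMatching hc).eq_of_adj_left h1 h2
      subst this
      exact hab rfl
    · rintro S hS hle ⟨e, he⟩ heS
      by_contra hne
      induction e with | _ v u =>
      have hvu : N.graph.Adj v u := he
      -- If `v` is matched, its matching edge lies in the larger independent set `S` as well, so any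
      -- edge of `S` at `v` must be that one.
      have step : ∀ v u (he : s(v, u) ∈ N.graph.edgeSet), (⟨s(v, u), he⟩ : N.graph.edgeSet) ∈ S →
          out v ≠ none → out v = some (N.id u) := by
        intro v u he heS h
        obtain ⟨i, hi⟩ := Option.ne_none_iff_exists'.1 h
        obtain ⟨x, hx, rfl, -⟩ := hc v i hi
        by_cases hxu : x = u
        · rw [← hxu]; exact hi
        exfalso
        have hf : (⟨s(v, x), hx⟩ : N.graph.edgeSet) ∈ S := hle (by
          show (N.mateGraph out hc).Adj v x; exact hi)
        have hne : (⟨s(v, u), he⟩ : N.graph.edgeSet) ≠ ⟨s(v, x), hx⟩ := by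
          intro h; apply hxu
          have := congrArg Subtype.val h
          exact ((Sym2.congr_right).1 this).symm
        refine hS heS hf hne ?_
        rw [SimpleGraph.lineGraph_adj_iff_exists]
        exact ⟨hne, v, by simp, by simp⟩
      apply hne
      show (N.mateGraph out hc).Adj v u
      rcases hm v u hvu with h | h
      · exact step v u he heS h
      · have he' : s(u, v) ∈ N.graph.edgeSet := by rw [Sym2.eq_swap]; exact he
        have : (⟨s(u, v), he'⟩ : N.graph.edgeSet) = ⟨s(v, u), he⟩ := Subtype.ext Sym2.eq_swap
        exact ((N.mateGraph out hc).adj_comm _ _).1 (step u v he' (this ▸ heS) h)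

/-! ### Weights -/

-- Each edge is met once in each direction. Sums over ordered pairs make the double counting below a
-- matter of exchanging sums.
open Classical in
theorem two_mul_matchingWeight (M : N.graph.Subgraph) :
    2 * N.matchingWeight M = ∑ v, ∑ u, if M.Adj v u then N.weight s(v, u) else 0 := by
  have h1 : N.matchingWeight M =
      ∑ p ∈ (univ : Finset (Fin n)).offDiag with p.1 < p.2,
        if s(p.1, p.2) ∈ M.edgeSet then N.weight s(p.1, p.2) else 0 := by
    rw [← Finset.sum_sym2_filter_not_isDiag univ
      (fun e => if e ∈ M.edgeSet then N.weight e else 0), matchingWeight, ← Finset.sum_filter]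
    apply Finset.sum_congr
    · ext e
      simp only [mem_filter, mem_univ, true_and, sym2_univ]
      refine ⟨fun h => ⟨?_, h⟩, fun h => h.2⟩
      intro hd
      exact N.graph.not_isDiag_of_mem_edgeSet (M.edgeSet_subset h) hd
    · intros; rfl
  have h2 : N.matchingWeight M =
      ∑ v, ∑ u, if v < u then (if M.Adj v u then N.weight s(v, u) else 0) else 0 := by
    rw [h1, ← Finset.sum_product', univ_product_univ,
      ← Finset.sum_filter (fun p : Fin n × Fin n => p.1 < p.2)]
    apply Finset.sum_congr
    · ext ⟨a, b⟩
      simp only [mem_filter, mem_offDiag, mem_univ, true_and]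
      exact ⟨fun h => h.2, fun h => ⟨h.ne, h⟩⟩
    · intros; rfl
  have h3 : N.matchingWeight M =
      ∑ v, ∑ u, if u < v then (if M.Adj v u then N.weight s(v, u) else 0) else 0 := by
    rw [h2, Finset.sum_comm]
    refine Finset.sum_congr rfl fun v _ => Finset.sum_congr rfl fun u _ => ?_
    rw [Sym2.eq_swap, M.adj_comm]
  rw [two_mul]
  nth_rw 1 [h2]
  rw [h3, ← Finset.sum_add_distrib]
  refine Finset.sum_congr rfl fun v _ => ?_
  rw [← Finset.sum_add_distrib]
  refine Finset.sum_congr rfl fun u _ => ?_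
  rcases lt_trichotomy v u with h | rfl | h
  · simp [h, h.not_gt]
  · simp [show ¬ M.Adj v v from fun h => h.adj_sub.ne rfl]
  · simp [h, h.not_gt]

/-- Stacks of pushed edges. The stack `st v` lists the mates of `v` in the edges pushed at `v`, the
last one first, and `R v u` is the amount with which the edge `vu` was pushed. -/
structure Certificate (N : Network n) (st : Fin n → List (Fin n)) (R : Fin n → Fin n → ℕ) :
    Prop where
  nodup : ∀ v, (st v).Nodup
  adj : ∀ {v u}, u ∈ st v → N.graph.Adj v u
  symm : ∀ {v u}, u ∈ st v → v ∈ st u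
  amount_symm : ∀ v u, R v u = R u v
  below : ∀ v u a b a' b', st v = a ++ u :: b → st u = a' ++ v :: b' →
    R v u + (b.map (R v)).sum + (b'.map (R u)).sum ≤ N.weight s(v, u)
  cover : ∀ v u, N.graph.Adj v u →
    N.weight s(v, u) ≤ ((st v).map (R v)).sum + ((st u).map (R u)).sum

/-- Weak duality: `y` is a vertex cover with respect to the weights, and every `y v` is charged by
at most one edge of the matching. -/
theorem matchingWeight_le_sum {M : N.graph.Subgraph} (hM : M.IsMatching) {y : Fin n → ℕ}
    (hy : ∀ v u, N.graph.Adj v u → N.weight s(v, u) ≤ y v + y u) :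
    N.matchingWeight M ≤ ∑ v, y v := by
  classical
  have hone : ∀ v c, (∑ u, if M.Adj v u then c else 0) ≤ c := by
    intro v c
    by_cases hv : v ∈ M.verts
    · obtain ⟨u, hu, hu'⟩ := hM hv
      rw [Finset.sum_eq_single u]
      · rw [if_pos hu]
      · intro x _ hx
        rw [if_neg fun h => hx (hu' x h)]
      · simp
    · rw [Finset.sum_eq_zero]
      · exact Nat.zero_le _
      · intro x _
        rw [if_neg fun h => hv h.fst_mem]
  have : 2 * N.matchingWeight M ≤ 2 * ∑ v, y v := by
    rw [two_mul_matchingWeight]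
    calc _ ≤ ∑ v, ∑ u, ((if M.Adj v u then y v else 0) + (if M.Adj v u then y u else 0)) := by
          refine Finset.sum_le_sum fun v _ => Finset.sum_le_sum fun u _ => ?_
          split_ifs with h
          · exact hy v u h.adj_sub
          · simp
      _ = (∑ v, ∑ u, if M.Adj v u then y v else 0) + ∑ u, ∑ v, if M.Adj v u then y u else 0 := by
          simp_rw [Finset.sum_add_distrib]
          rw [Finset.sum_comm (f := fun v u => if M.Adj v u then y u else 0)]
      _ ≤ (∑ v, y v) + ∑ u, y u := by
          refine add_le_add (Finset.sum_le_sum fun v _ => hone v _)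
            (Finset.sum_le_sum fun v _ => ?_)
          simp_rw [M.adj_comm _ v]
          exact hone v _
      _ = _ := by ring
  omega

/-- The weight of any matching is at most the sum of `R v u` over all ordered pairs in stacks, by
`cover`. Each amount is charged to a selected edge: to the edge itself, or to a selected edge above
it in one of its two stacks (`hcov`). By `below`, a selected edge is charged no more than its weight
per direction, hence no more than twice its weight in total. -/
theorem isTwoApproxMatching_of_certificate {st : Fin n → List (Fin n)} {R : Fin n → Fin n → ℕ}
    (hC : N.Certificate st R) {out : Fin n → Option ℕ} (hc : N.MatesConsistent out)
    (hmem : ∀ v u, out v = some (N.id u) → u ∈ st v)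
    (hcov : ∀ v u, u ∈ st v → out v = some (N.id u) ∨
      (∃ x, out v = some (N.id x) ∧ [x, u].Sublist (st v)) ∨
      (∃ x, out u = some (N.id x) ∧ [x, v].Sublist (st u))) :
    N.IsTwoApproxMatching out := by
  classical
  refine ⟨N.mateGraph out hc, mateGraph_isMatching hc, mateGraph_encodes hc, fun M' hM' => ?_⟩
  let P : Fin n → Fin n → Prop := fun v u => out v = some (N.id u)
  let B : Fin n → Fin n → Prop := fun v u => ∃ x, out v = some (N.id x) ∧ [x, u].Sublist (st v)
  have hPs : ∀ v u, P v u ↔ P u v := fun v u => (N.mateGraph out hc).adj_comm v u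
  have htot : ∀ v, ((st v).map (R v)).sum = ∑ u, if u ∈ st v then R v u else 0 := by
    intro v
    rw [← List.sum_toFinset _ (hC.nodup v), ← Finset.sum_filter]
    apply Finset.sum_congr _ fun _ _ => rfl
    ext; simp
  -- `β v` is the total amount of the edges that are blocked at `v`, that is, of the part of the
  -- stack below the mate of `v`.
  let β : Fin n → ℕ := fun v => ∑ u, if B v u then R v u else 0
  have hβ : ∀ v u a b, P v u → st v = a ++ u :: b → β v = (b.map (R v)).sum := by
    intro v u a b hP hst
    have hnd := hC.nodup v
    rw [hst] at hnd
    have hB : ∀ x, B v x ↔ x ∈ b := by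
      intro x
      constructor
      · rintro ⟨y, hy, hs⟩
        have : y = u := N.id_injective (Option.some_injective _ (hy.symm.trans hP))
        subst this
        rw [hst] at hs
        have hya : y ∉ a := fun h => (List.nodup_append.1 hnd).2.2 y h y (by simp) rfl
        have : [y, x].Sublist (y :: b) := by
          clear hst hnd
          induction a with
          | nil => exact hs
          | cons c a ih =>
            refine ih ?_ fun h => hya (List.mem_cons_of_mem _ h)
            rw [List.cons_append] at hs
            rcases hs with _ | hs | _
            · assumption
            · exact absurd (List.mem_cons_self) hya
        have := this.tail
        simpa using this
      · intro hx
        refine ⟨u, hP, ?_⟩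
        rw [hst]
        exact (List.Sublist.cons_cons u (List.singleton_sublist.2 hx)).trans
          (List.sublist_append_right _ _)
    have hndb : b.Nodup := ((List.nodup_append.1 hnd).2.1).of_cons
    rw [← List.sum_toFinset _ hndb]
    show ∑ u, _ = _
    rw [← Finset.sum_filter]
    apply Finset.sum_congr _ fun _ _ => rfl
    ext x; simp [hB]
  have hw : ∀ v u, P v u → R v u + β v + β u ≤ N.weight s(v, u) := by
    intro v u hP
    obtain ⟨a, b, hab⟩ := List.append_of_mem (hmem v u hP)
    obtain ⟨a', b', hab'⟩ := List.append_of_mem (hmem u v ((hPs v u).1 hP))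
    rw [hβ v u a b hP hab, hβ u v a' b' ((hPs v u).1 hP) hab']
    exact hC.below v u a b a' b' hab hab'
  have hsum : ∀ v, (∑ u, if P v u then β v else 0) = β v := by
    intro v
    by_cases h : ∃ u, P v u
    · obtain ⟨u, hu⟩ := h
      rw [Finset.sum_eq_single u]
      · simp [hu]
      · intro x _ hx
        rw [if_neg]
        intro hPx
        exact hx (N.id_injective (Option.some_injective _ (hPx.symm.trans hu)))
      · simp
    · push Not at h
      have : β v = 0 := by
        refine Finset.sum_eq_zero fun u _ => if_neg ?_
        rintro ⟨x, hx, -⟩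
        exact h x hx
      simp [this]
  calc N.matchingWeight M' ≤ ∑ v, ((st v).map (R v)).sum := matchingWeight_le_sum hM' hC.cover
    -- The ordered pair `(v, u)` is selected, blocked at `v`, or blocked at `u`.
    _ ≤ ∑ v, ∑ u, ((if P v u then R v u else 0) + (if B v u then R v u else 0) +
          (if B u v then R u v else 0)) := by
        refine Finset.sum_le_sum fun v _ => ?_
        rw [htot]
        refine Finset.sum_le_sum fun u _ => ?_
        by_cases hu : u ∈ st v
        · rw [if_pos hu]
          rcases hcov v u hu with h | h | h
          · rw [if_pos (show P v u from h)]; omega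
          · rw [if_pos (show B v u from h)]; omega
          · rw [if_pos (show B u v from h), hC.amount_symm v u]; omega
        · simp [hu]
    _ = (∑ v, ∑ u, if P v u then R v u else 0) + ∑ v, β v + ∑ v, β v := by
        simp_rw [Finset.sum_add_distrib]
        rw [Finset.sum_comm (f := fun v u => if B u v then R u v else 0)]
    -- The blocked amounts can be moved to the selected edges because `β` vanishes at unmatched
    -- nodes.
    _ = ∑ v, ∑ u, if P v u then R v u + β v + β u else 0 := by
        have e1 : ∑ v, β v = ∑ v, ∑ u, if P v u then β v else 0 := by simp_rw [hsum]
        have e2 : ∑ v, β v = ∑ v, ∑ u, if P v u then β u else 0 := by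
          rw [Finset.sum_comm (f := fun v u => if P v u then β u else 0)]
          refine Finset.sum_congr rfl fun u _ => (hsum u).symm.trans ?_
          exact Finset.sum_congr rfl fun v _ => if_congr (hPs u v) rfl rfl
        nth_rw 1 [e1]
        rw [e2, ← Finset.sum_add_distrib, ← Finset.sum_add_distrib]
        refine Finset.sum_congr rfl fun v _ => ?_
        rw [← Finset.sum_add_distrib, ← Finset.sum_add_distrib]
        refine Finset.sum_congr rfl fun u _ => ?_
        split_ifs <;> rfl
    _ ≤ ∑ v, ∑ u, if P v u then N.weight s(v, u) else 0 := by
        refine Finset.sum_le_sum fun v _ => Finset.sum_le_sum fun u _ => ?_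
        split_ifs with h
        · exact hw v u h
        · exact le_rfl
    _ = 2 * N.matchingWeight (N.mateGraph out hc) := by
        rw [two_mul_matchingWeight]
        exact Finset.sum_congr rfl fun v _ => Finset.sum_congr rfl fun u _ =>
          if_congr Iff.rfl rfl rfl

end Network

/-! ### The order of the entries of a stack: `[x, y].Sublist l` says that `x` lies above `y`. -/

theorem List.Nodup.not_pair_swap {α : Type*} {l : List α} (h : l.Nodup) {x y : α}
    (h1 : [x, y].Sublist l) (h2 : [y, x].Sublist l) : False := by
  induction l with
  | nil => simp at h1
  | cons c l ih =>
    have hc := (List.nodup_cons.1 h).1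
    rcases h1 with _ | h1 | h1
    · rename_i h1
      rcases h2 with _ | h2 | h2
      · rename_i h2
        exact ih h.of_cons h1 h2
      · exact hc (h1.subset (by simp))
    · rename_i h1
      rcases h2 with _ | h2 | h2
      · rename_i h2
        exact hc (h2.subset (by simp))
      · rename_i h2
        exact hc (h1.subset (by simp))

theorem List.pair_sublist_or {α : Type*} {l : List α} {x y : α} (hx : x ∈ l) (hy : y ∈ l)
    (hxy : x ≠ y) : [x, y].Sublist l ∨ [y, x].Sublist l := by
  induction l with
  | nil => simp at hx
  | cons c l ih =>
    rcases List.mem_cons.1 hx with rfl | hx' <;> rcases List.mem_cons.1 hy with rfl | hy'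
    · exact absurd rfl hxy
    · exact Or.inl (List.Sublist.cons_cons _ (List.singleton_sublist.2 hy'))
    · exact Or.inr (List.Sublist.cons_cons _ (List.singleton_sublist.2 hx'))
    · exact (ih hx' hy').imp (fun h => h.cons _) (fun h => h.cons _)

/-- In the application `u :: l'` is what remains of the stack `l`: everything above the present top
has been removed. -/
theorem List.Nodup.notMem_of_pair {α : Type*} {l l' : List α} (h : l.Nodup) {x u : α}
    (hs : (u :: l').Sublist l) (h1 : [x, u].Sublist l) : x ∉ u :: l' := by
  intro hx
  rcases List.mem_cons.1 hx with rfl | hx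
  · have := h.sublist h1
    simp at this
  · exact h.not_pair_swap h1
      ((List.Sublist.cons_cons u (List.singleton_sublist.2 hx)).trans hs)

/-! ### Unwinding the stacks by message passing. -/

namespace MsgAlg

variable (A : MsgAlg) {n : ℕ} (N : Network n)

theorem run_succ (ω : Coins n (A.maxCoin n)) (t : ℕ) (v : Fin n) :
    A.run N ω (t + 1) v = if (A.output (A.run N ω t v)).isSome then A.run N ω t v
      else A.step (A.run N ω t v) (ω t v)
        (N.inbox (fun u j => A.msgOf (A.run N ω t u) (ω t u) j) v) := rfl

variable {A N}

theorem run_of_halted {ω : Coins n (A.maxCoin n)} {t : ℕ} {v : Fin n}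
    (h : (A.output (A.run N ω t v)).isSome) {t' : ℕ} (ht : t ≤ t') :
    A.run N ω t' v = A.run N ω t v := by
  induction t', ht using Nat.le_induction with
  | base => rfl
  | succ m _ ih => rw [run_succ, ih, if_pos h]

variable (F : MsgAlg) (stack : F.State → List ℕ)

/-- The state of the unwinding algorithm that corresponds to the state `s` of `F`. -/
def unwindNorm (s : F.State) : F.State ⊕ (List ℕ ⊕ ℕ) :=
  if (F.output s).isSome then .inr (.inl (stack s)) else .inl s

/-- The messages of the unwinding algorithm; see `unwind`. -/
def unwindSend : F.State ⊕ (List ℕ ⊕ ℕ) → ℕ → ℕ → List Bool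
  | .inl s, c, j => false :: F.send s c j
  | .inr (.inl (i :: _)), _, j => [decide (j = i)]
  | _, _, _ => []

/-- The state transitions of the unwinding algorithm; see `unwind`. -/
def unwindStep : F.State ⊕ (List ℕ ⊕ ℕ) → ℕ → (ℕ → List Bool) → F.State ⊕ (List ℕ ⊕ ℕ)
  | .inl s, c, inb => unwindNorm F stack (F.step s c fun i => (inb i).tail)
  | .inr (.inl (i :: l)), _, inb =>
      if inb i = [true] then .inr (.inr i) else .inr (.inl ((i :: l).filter fun j => inb j ≠ []))
  | s, _, _ => s

/-- The outputs of the unwinding algorithm; see `unwind`. -/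
def unwindOutput : F.State ⊕ (List ℕ ⊕ ℕ) → Option (Option ℕ)
  | .inl _ => none
  | .inr (.inl []) => some none
  | .inr (.inl (_ :: _)) => none
  | .inr (.inr i) => some (some i)

/-- Runs `F`; a node that halts in `F` then unwinds its stack (of identifiers of neighbours, the top
first): it offers itself to the top of its stack, removes the neighbours that have fallen silent,
and halts as soon as it offers itself to a neighbour from which it receives an offer. Nodes that
have not halted are never silent. -/
def unwind : MsgAlg where
  State := F.State ⊕ (List ℕ ⊕ ℕ)
  maxCoin := F.maxCoin
  init li := unwindNorm F stack (F.init li)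
  send := unwindSend F
  step := unwindStep F stack
  output := unwindOutput F

/-- The message sent in state `s`. -/
def unwindMsg (s : F.State ⊕ (List ℕ ⊕ ℕ)) (c j : ℕ) : List Bool :=
  if (unwindOutput F s).isSome then [] else unwindSend F s c j

/-- The run of the unwinding algorithm. -/
def unwindRun (N : Network n) (ω : Coins n (F.maxCoin n)) (t : ℕ) (v : Fin n) :
    F.State ⊕ (List ℕ ⊕ ℕ) :=
  (unwind F stack).run N ω t v

/-- All messages received by `v` in round `t`. -/
def unwindInbox (N : Network n) (ω : Coins n (F.maxCoin n)) (t : ℕ) (v : Fin n) : ℕ → List Bool :=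
  N.inbox (fun u j => unwindMsg F (unwindRun F stack N ω t u) (ω t u) j) v

variable {F stack}
variable {ω : Coins n (F.maxCoin n)}

local notation "U" => unwindRun F stack N ω

theorem unwindRun_succ (t : ℕ) (v : Fin n) : U (t + 1) v =
    if (unwindOutput F (U t v)).isSome then U t v
    else unwindStep F stack (U t v) (ω t v) (unwindInbox F stack N ω t v) := rfl

theorem unwindRun_of_halted {t : ℕ} {v : Fin n} (h : (unwindOutput F (U t v)).isSome) {t' : ℕ}
    (ht : t ≤ t') : U t' v = U t v :=
  run_of_halted (A := unwind F stack) h ht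

/-- Messages of `F` carry a leading tag bit, which the receiver strips. A node that unwinds sends at
most one bit, so its stripped message is empty, exactly as the message of a node that has halted in
`F`. Hence nodes that still run `F` do not notice the unwinding around them. -/
theorem unwind_sim (t : ℕ) (v : Fin n) : U t v = .inl (F.run N ω t v) ∧
      F.output (F.run N ω t v) = none ∧
      U (t + 1) v = unwindNorm F stack (F.run N ω (t + 1) v) ∨
    (∃ x, U t v = .inr x) ∧ (F.output (F.run N ω t v)).isSome := by
  have aux : ∀ t, (∀ v, U t v = .inl (F.run N ω t v) ∧ F.output (F.run N ω t v) = none ∨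
      (∃ x, U t v = .inr x) ∧ (F.output (F.run N ω t v)).isSome) →
      ∀ v, U t v = .inl (F.run N ω t v) → F.output (F.run N ω t v) = none →
      U (t + 1) v = unwindNorm F stack (F.run N ω (t + 1) v) := by
    intro t ht v h1 h2
    have hin : (fun i => (unwindInbox F stack N ω t v i).tail) =
        N.inbox (fun u j => F.msgOf (F.run N ω t u) (ω t u) j) v := by
      funext i
      by_cases hi : ∃ u, N.graph.Adj v u ∧ N.id u = i
      · obtain ⟨u, hu, rfl⟩ := hi
        rw [unwindInbox, Network.inbox_id hu, Network.inbox_id hu]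
        rcases ht u with ⟨h3, h4⟩ | ⟨⟨x, h3⟩, h4⟩
        · rw [h3, unwindMsg, msgOf, h4]
          rfl
        · rw [h3, unwindMsg, msgOf, if_pos h4]
          rcases x with (_ | _) | _ <;> rfl
      · rw [unwindInbox, Network.inbox_eq_pull, Network.inbox_eq_pull,
          Network.pull_of_not hi, Network.pull_of_not hi]
        rfl
    rw [unwindRun_succ, run_succ, h1, h2]
    simp only [unwindOutput, Option.isSome_none, Bool.false_eq_true, if_false, unwindStep, ← hin]
  have main : ∀ t v, U t v = .inl (F.run N ω t v) ∧ F.output (F.run N ω t v) = none ∨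
      (∃ x, U t v = .inr x) ∧ (F.output (F.run N ω t v)).isSome := by
    intro t
    have hnorm : ∀ s, unwindNorm F stack s = .inl s ∧ F.output s = none ∨
        (∃ x, unwindNorm F stack s = .inr x) ∧ (F.output s).isSome := by
      intro s
      by_cases h : (F.output s).isSome
      · exact Or.inr ⟨⟨_, if_pos h⟩, h⟩
      · exact Or.inl ⟨if_neg h, by simpa using h⟩
    induction t with
    | zero => intro v; exact hnorm _
    | succ t ih =>
      intro v
      rcases ih v with ⟨h1, h2⟩ | ⟨⟨x, h1⟩, h2⟩
      · rw [aux t ih v h1 h2]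
        exact hnorm _
      · right
        rw [run_of_halted h2 (Nat.le_succ t)]
        refine ⟨?_, h2⟩
        rw [unwindRun_succ, h1]
        rcases x with (_ | ⟨i, l⟩) | j
        · exact ⟨_, rfl⟩
        · simp only [unwindOutput, Option.isSome_none, Bool.false_eq_true, if_false, unwindStep]
          split_ifs
          · exact ⟨_, rfl⟩
          · exact ⟨_, rfl⟩
        · exact ⟨_, rfl⟩
  rcases main t v with h | h
  · exact Or.inl ⟨h.1, h.2, aux t (main t) v h.1 h.2⟩
  · exact Or.inr h

theorem unwind_step_active {t : ℕ} {v : Fin n} {i : ℕ} {l : List ℕ}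
    (h : U t v = .inr (.inl (i :: l))) : U (t + 1) v =
      if unwindInbox F stack N ω t v i = [true] then .inr (.inr i)
      else .inr (.inl ((i :: l).filter fun j => unwindInbox F stack N ω t v j ≠ [])) := by
  rw [unwindRun_succ, h]
  rfl

theorem unwind_matched {t : ℕ} {v : Fin n} {j : ℕ} (h : U t v = .inr (.inr j)) {t' : ℕ}
    (ht : t ≤ t') : U t' v = .inr (.inr j) := by
  rw [unwindRun_of_halted (by rw [h]; rfl) ht, h]

/-- Silence characterizes halting: the tag bit and the offer bit make every message of an active
node nonempty. -/
theorem unwindInbox_eq_nil {t : ℕ} {v u : Fin n} (hvu : N.graph.Adj v u) :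
    unwindInbox F stack N ω t v (N.id u) = [] ↔
      U t u = .inr (.inl []) ∨ ∃ j, U t u = .inr (.inr j) := by
  rw [unwindInbox, Network.inbox_id hvu, unwindMsg]
  rcases U t u with s | (_ | ⟨i, l⟩) | j <;> simp [unwindOutput, unwindSend]

theorem unwindInbox_eq_true {t : ℕ} {v u : Fin n} (hvu : N.graph.Adj v u) :
    unwindInbox F stack N ω t v (N.id u) = [true] ↔
      ∃ l, U t u = .inr (.inl (N.id v :: l)) := by
  rw [unwindInbox, Network.inbox_id hvu, unwindMsg]
  rcases U t u with s | (_ | ⟨i, l⟩) | j <;> simp [unwindOutput, unwindSend]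
  exact eq_comm

/-- The node `u` has been matched along an edge that lies above `uv` in its stack. -/
def MatchedAbove {F : MsgAlg} (stack : F.State → List ℕ) (N : Network n)
    (ω : Coins n (F.maxCoin n)) (st : Fin n → List (Fin n)) (t : ℕ) (u v : Fin n) : Prop :=
  ∃ y, unwindRun F stack N ω t u = .inr (.inr (N.id y)) ∧ [y, v].Sublist (st u)

theorem MatchedAbove.mono {st : Fin n → List (Fin n)} {t t' : ℕ} {u v : Fin n}
    (h : MatchedAbove stack N ω st t u v) (ht : t ≤ t') :
    MatchedAbove stack N ω st t' u v := by
  obtain ⟨y, h1, h2⟩ := h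
  exact ⟨y, unwind_matched h1 ht, h2⟩

/-- An edge leaves the stack of `v` without being selected only if it is blocked at its other end.
For a matched node the same holds for all edges that lay above its mate; this is what determines,
when a neighbour falls silent, on which side of the edge its mate lies. -/
theorem unwind_invariant {st : Fin n → List (Fin n)} (hnd : ∀ v, (st v).Nodup)
    (hadj : ∀ {v u}, u ∈ st v → N.graph.Adj v u) (hsymm : ∀ {v u}, u ∈ st v → v ∈ st u)
    (hst : ∀ t v, (F.output (F.run N ω t v)).isSome →
      stack (F.run N ω t v) = (st v).map N.id) (t : ℕ) (v : Fin n) :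
    (∀ l, U t v = .inr (.inl l) → ∃ l₀ : List (Fin n), l = l₀.map N.id ∧ l₀.Sublist (st v) ∧
      ∀ u ∈ st v, u ∉ l₀ → MatchedAbove stack N ω st t u v) ∧
    (∀ j, U t v = .inr (.inr j) → ∃ u, j = N.id u ∧ u ∈ st v ∧
      U t u = .inr (.inr (N.id v)) ∧
      ∀ x, [x, u].Sublist (st v) → MatchedAbove stack N ω st t x v) := by
  have hnorm : ∀ t v, (F.output (F.run N ω t v)).isSome →
      unwindNorm F stack (F.run N ω t v) = .inr (.inl ((st v).map N.id)) := by
    intro t v h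
    rw [unwindNorm, if_pos h, hst t v h]
  have hentry : ∀ t v, U t v = unwindNorm F stack (F.run N ω t v) →
      (∀ l, U t v = .inr (.inl l) → ∃ l₀ : List (Fin n), l = l₀.map N.id ∧ l₀.Sublist (st v) ∧
      ∀ u ∈ st v, u ∉ l₀ → MatchedAbove stack N ω st t u v) ∧
      (∀ j, U t v = .inr (.inr j) → ∃ u, j = N.id u ∧ u ∈ st v ∧
      U t u = .inr (.inr (N.id v)) ∧
      ∀ x, [x, u].Sublist (st v) → MatchedAbove stack N ω st t x v) := by
    intro t v h
    rcases unwind_sim (stack := stack) (N := N) (ω := ω) t v with ⟨h1, -⟩ | ⟨-, h1⟩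
    · rw [h1]; simp
    · rw [h, hnorm t v h1]
      refine ⟨fun l hl => ⟨st v, ?_, List.Sublist.refl _, fun u hu hu' => absurd hu hu'⟩, ?_⟩
      · simpa using hl.symm
      · simp
  induction t generalizing v with
  | zero => exact hentry 0 v rfl
  | succ t ih =>
    rcases unwind_sim (stack := stack) (N := N) (ω := ω) t v with ⟨h1, h2, h3⟩ | ⟨⟨x, h1⟩, h2⟩
    · exact hentry _ v h3
    rcases x with (_ | ⟨i, l⟩) | j
    · have h3 : U (t + 1) v = .inr (.inl []) := by
        rw [unwindRun_of_halted (by rw [h1]; rfl) (Nat.le_succ t), h1]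
      rw [h3]
      refine ⟨fun l hl => ?_, by simp⟩
      obtain ⟨l₀, e1, e2, e3⟩ := (ih v).1 l (h1.trans (by simpa using hl))
      exact ⟨l₀, e1, e2, fun u hu hu' => (e3 u hu hu').mono (Nat.le_succ t)⟩
    · obtain ⟨l₀, e1, e2, e3⟩ := (ih v).1 _ h1
      rcases l₀ with _ | ⟨u, l₁⟩
      · simp at e1
      simp only [List.map_cons, List.cons.injEq] at e1
      obtain ⟨rfl, rfl⟩ := e1
      have huv : u ∈ st v := e2.subset (by simp)
      have hstep := unwind_step_active h1
      by_cases hin : unwindInbox F stack N ω t v (N.id u) = [true]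
      · rw [if_pos hin] at hstep
        rw [hstep]
        refine ⟨by simp, fun j hj => ⟨u, by simpa using hj.symm, huv, ?_, fun x hx => ?_⟩⟩
        · obtain ⟨l', hl'⟩ := (unwindInbox_eq_true (hadj huv)).1 hin
          rw [unwind_step_active hl', if_pos]
          exact (unwindInbox_eq_true (hadj huv).symm).2 ⟨_, h1⟩
        · exact (e3 x (hx.subset (by simp)) ((hnd v).notMem_of_pair e2 hx)).mono (Nat.le_succ t)
      · rw [if_neg hin] at hstep
        rw [hstep]
        refine ⟨fun l hl => ?_, by simp⟩
        refine ⟨(u :: l₁).filter fun x => unwindInbox F stack N ω t v (N.id x) ≠ [], ?_,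
          (List.filter_sublist).trans e2, fun y hy hy' => ?_⟩
        · have : (List.filter (fun j => unwindInbox F stack N ω t v j ≠ [])
              ((u :: l₁).map N.id)) = l := by simpa using hl
          rw [← this, List.filter_map]
          rfl
        by_cases hyl : y ∈ u :: l₁
        · have hnil : unwindInbox F stack N ω t v (N.id y) = [] := by
            by_contra hne
            exact hy' (List.mem_filter.2 ⟨hyl, by simpa using hne⟩)
          have hv : ∀ j, U t v ≠ .inr (.inr j) := by rw [h1]; simp
          -- The neighbour `y` has fallen silent while `v` is active. It cannot have emptied its
          -- stack, since it drops `v` only when `v` is matched. So it has a mate `z ≠ v`; if `v`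
          -- lay above `z` in its stack, then `v` would be matched by the second part of the
          -- invariant, so `z` lies above `v`.
          rcases (unwindInbox_eq_nil (hadj hy)).1 hnil with h4 | ⟨j, h4⟩
          · obtain ⟨l₂, f1, f2, f3⟩ := (ih y).1 _ h4
            have : l₂ = [] := by simpa using f1.symm
            subst this
            obtain ⟨z, hz, -⟩ := f3 v (hsymm hy) (by simp)
            exact absurd hz (hv _)
          · obtain ⟨z, rfl, f2, f3, f4⟩ := (ih y).2 _ h4
            refine ⟨z, unwind_matched h4 (Nat.le_succ t), ?_⟩
            have hzv : z ≠ v := fun h => hv _ (h ▸ f3)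
            rcases List.pair_sublist_or f2 (hsymm hy) hzv with h5 | h5
            · exact h5
            · obtain ⟨w, hw, -⟩ := f4 v h5
              exact absurd hw (hv _)
        · exact (e3 y hy hyl).mono (Nat.le_succ t)
    · rw [unwind_matched h1 (Nat.le_succ t)]
      refine ⟨by simp, fun j' hj' => ?_⟩
      obtain ⟨u, f1, f2, f3, f4⟩ := (ih v).2 j' (h1.trans (by simpa using hj'))
      exact ⟨u, f1, f2, unwind_matched f3 (Nat.le_succ t), fun x hx => (f4 x hx).mono (Nat.le_succ t)⟩

/-- When all nodes have halted, an unmatched node has an empty stack, so all its edges are blocked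
at the other ends. At a matched node, edges below the mate are blocked there and edges above it at
the other ends. Nothing is assumed about the order in which nodes began to unwind. -/
theorem unwind_sound {st : Fin n → List (Fin n)} {R : Fin n → Fin n → ℕ}
    (hC : N.Certificate st R) (hst : ∀ t v, (F.output (F.run N ω t v)).isSome →
      stack (F.run N ω t v) = (st v).map N.id)
    {t : ℕ} {out : Fin n → Option ℕ} (hout : (unwind F stack).HaltedWith N ω t out) :
    N.IsTwoApproxMatching out := by
  have inv := unwind_invariant hC.nodup hC.adj hC.symm hst t
  have hnone : ∀ v, out v = none → U t v = .inr (.inl []) := by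
    intro v hv
    have : unwindOutput F (U t v) = some (out v) := hout v
    rw [hv] at this
    rcases h : U t v with s | (_ | ⟨i, l⟩) | j <;> rw [h] at this <;> simp_all [unwindOutput]
  have hsome : ∀ v i, out v = some i ↔ U t v = .inr (.inr i) := by
    intro v i
    have : unwindOutput F (U t v) = some (out v) := hout v
    rcases h : U t v with s | (_ | ⟨i, l⟩) | j <;> rw [h] at this <;>
      simp [unwindOutput] at this <;> simp [← this]
  refine Network.isTwoApproxMatching_of_certificate hC ?_ ?_ ?_
  · intro v i hi
    obtain ⟨u, rfl, f2, f3, -⟩ := (inv v).2 i ((hsome v i).1 hi)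
    exact ⟨u, hC.adj f2, rfl, (hsome _ _).2 f3⟩
  · intro v u hu
    obtain ⟨x, f1, f2, -⟩ := (inv v).2 _ ((hsome v _).1 hu)
    rwa [N.id_injective f1]
  · intro v u hu
    have conv : ∀ x y, MatchedAbove stack N ω st t x y →
        ∃ z, out x = some (N.id z) ∧ [z, y].Sublist (st x) :=
      fun x y ⟨z, h1, h2⟩ => ⟨z, (hsome _ _).2 h1, h2⟩
    rcases hv : out v with _ | i
    · obtain ⟨l₀, e1, -, e3⟩ := (inv v).1 _ (hnone v hv)
      have : l₀ = [] := by simpa using e1.symm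
      subst this
      exact Or.inr (Or.inr (conv u v (e3 u hu (by simp))))
    · obtain ⟨x, rfl, f2, f3, f4⟩ := (inv v).2 i ((hsome v i).1 hv)
      by_cases hxu : x = u
      · left; rw [hxu]
      · rcases List.pair_sublist_or f2 hu hxu with h | h
        · exact Or.inr (Or.inl ⟨x, rfl, h⟩)
        · exact Or.inr (Or.inr (conv u v (f4 u h)))

theorem unwindMsg_length_le {b t c j : ℕ} {v : Fin n}
    (hF : (F.msgOf (F.run N ω t v) c j).length ≤ b) : (unwindMsg F (U t v) c j).length ≤ b + 1 := by
  rcases unwind_sim (stack := stack) (N := N) (ω := ω) t v with ⟨h1, h2, -⟩ | ⟨⟨x, h1⟩, -⟩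
  · rw [msgOf, h2] at hF
    rw [h1]
    simpa [unwindMsg, unwindOutput, unwindSend] using hF
  · rw [h1]
    rcases x with (_ | ⟨i, l⟩) | j <;> simp [unwindMsg, unwindOutput, unwindSend]

theorem unwind_messageBound {b : ℕ} (h : F.MessageBound N b) :
    (unwind F stack).MessageBound N (b + 1) :=
  fun ω t v u hvu => unwindMsg_length_le (h ω t v u hvu)

/-- If the edges in the stacks have step numbers below `K` that do not increase along the stacks,
and every edge is the only one of its step in one of the two stacks that contain it, then unwinding
takes at most `3 * K` rounds. -/
theorem unwind_halts {st : Fin n → List (Fin n)} (hnd : ∀ v, (st v).Nodup)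
    (hadj : ∀ {v u}, u ∈ st v → N.graph.Adj v u) (hsymm : ∀ {v u}, u ∈ st v → v ∈ st u)
    (hst : ∀ t v, (F.output (F.run N ω t v)).isSome →
      stack (F.run N ω t v) = (st v).map N.id)
    (σ : Fin n → Fin n → ℕ) (K : ℕ) (hσ : ∀ v u, σ v u = σ u v)
    (hK : ∀ v, ∀ u ∈ st v, σ v u < K)
    (hsort : ∀ v x u, [x, u].Sublist (st v) → σ v u ≤ σ v x)
    (huniq : ∀ v, ∀ u ∈ st v, (∀ x ∈ st v, σ v x = σ v u → x = u) ∨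
      (∀ x ∈ st u, σ u x = σ v u → x = v))
    {t₀ : ℕ} (hF : ∀ v, (F.output (F.run N ω t₀ v)).isSome) :
    ∃ out, (unwind F stack).HaltedWith N ω (t₀ + 3 * K) out := by
  have inv := unwind_invariant hnd hadj hsymm hst
  -- `Has t v u`: the node `v` is still unwinding and `u` is in what remains of its stack.
  let Has : ℕ → Fin n → Fin n → Prop := fun t v u => ∃ l, U t v = .inr (.inl l) ∧ N.id u ∈ l
  have hmem : ∀ t v u, Has t v u → u ∈ st v := by
    rintro t v u ⟨l, h1, h2⟩
    obtain ⟨l₀, rfl, e2, -⟩ := (inv t v).1 l h1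
    obtain ⟨x, hx, e⟩ := List.mem_map.1 h2
    exact e2.subset (N.id_injective e ▸ hx)
  -- An active node has dropped only matched neighbours, so two active endpoints of a pushed edge
  -- both still hold it.
  have hswap : ∀ t v u u', Has t v u' → u ∈ st v → (∃ x, Has t u x) → Has t u v := by
    rintro t v u u' ⟨l, h1, -⟩ hu ⟨x, l', h2, hl'⟩
    obtain ⟨l₀, rfl, e2, e3⟩ := (inv t u).1 l' h2
    by_cases hv : v ∈ l₀
    · exact ⟨_, h2, List.mem_map_of_mem hv⟩
    · obtain ⟨y, hy, -⟩ := e3 v (hsymm hu) hv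
      rw [h1] at hy
      simp at hy
  -- An entry survives a round only if the neighbour was active at its beginning; this costs one
  -- round of delay.
  have hback : ∀ t, t₀ ≤ t → ∀ v u, Has (t + 1) v u → Has t v u ∧ ∃ x, Has t u x := by
    rintro t ht v u ⟨l, h1, h2⟩
    have huv := hmem _ _ _ ⟨l, h1, h2⟩
    have hFt : ∀ v, (F.output (F.run N ω t v)).isSome := fun v => by
      rw [run_of_halted (hF v) ht]; exact hF v
    have hinr : ∀ v, ∃ x, U t v = .inr x := by
      intro v
      rcases unwind_sim (stack := stack) (N := N) (ω := ω) t v with ⟨-, h, -⟩ | ⟨h, -⟩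
      · have := hFt v; simp [h] at this
      · exact h
    obtain ⟨x, hx⟩ := hinr v
    rcases x with (_ | ⟨i, l'⟩) | j
    · rw [unwindRun_of_halted (by rw [hx]; rfl) (Nat.le_succ t), hx] at h1
      simp only [Sum.inr.injEq, Sum.inl.injEq] at h1
      simp [← h1] at h2
    · rw [unwind_step_active hx] at h1
      split_ifs at h1 with hin
      · simp at h1
      · simp only [Sum.inr.injEq, Sum.inl.injEq] at h1
        rw [← h1, List.mem_filter] at h2
        refine ⟨⟨_, hx, h2.1⟩, ?_⟩
        have hne : ¬ unwindInbox F stack N ω t v (N.id u) = [] := by simpa using h2.2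
        rw [unwindInbox_eq_nil (hadj huv)] at hne
        obtain ⟨y, hy⟩ := hinr u
        rcases y with (_ | ⟨k, l''⟩) | j
        · exact absurd (Or.inl hy) hne
        · obtain ⟨l₀, e1, -, -⟩ := (inv t u).1 _ hy
          rcases l₀ with _ | ⟨z, l₁⟩
          · simp at e1
          · exact ⟨z, _, hy, by rw [e1]; simp⟩
        · exact absurd (Or.inr ⟨j, hy⟩) hne
    · rw [unwind_matched hx (Nat.le_succ t)] at h1
      simp at h1
  -- the top of a stack has the largest step
  have htop : ∀ t v u, Has t v u → ∃ x l, U t v = .inr (.inl (N.id x :: l)) ∧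
      Has t v x ∧ σ v u ≤ σ v x := by
    rintro t v u ⟨l, h1, h2⟩
    obtain ⟨l₀, rfl, e2, -⟩ := (inv t v).1 l h1
    rcases l₀ with _ | ⟨x, l₁⟩
    · simp at h2
    refine ⟨x, _, h1, ⟨_, h1, by simp⟩, ?_⟩
    obtain ⟨y, hy, e⟩ := List.mem_map.1 h2
    rw [N.id_injective e] at hy
    rcases List.mem_cons.1 hy with rfl | hy
    · exact le_rfl
    · exact hsort v x u ((List.Sublist.cons_cons x (List.singleton_sublist.2 hy)).trans e2)
  -- If `s` is the largest step left, three rounds remove it. A leaf that its centre still holds at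
  -- time `t + 1` had the centre on top already at time `t`, and has it on top at time `t + 1`. In
  -- the next round the topmost edge of the centre leads to such a leaf, so the two are matched, and
  -- at time `t + 2` no centre holds an edge of step `s`. The third round removes the entries that
  -- leaves still hold.
  have key : ∀ s t, t₀ ≤ t → (∀ v u, Has t v u → σ v u < s + 1) →
      ∀ v u, Has (t + 3) v u → σ v u < s := by
    intro s t ht hP
    -- a leaf of a star points to the centre
    have hleaf : ∀ p c, Has (t + 1) p c → σ p c = s → (∀ x ∈ st c, σ c x = s → x = p) →
        ∃ l, U (t + 1) c = .inr (.inl (N.id p :: l)) := by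
      intro p c hpc hs hu
      obtain ⟨h1, hc⟩ := hback t ht p c hpc
      have hcp : Has t c p := hswap t p c c h1 (hmem _ _ _ h1) hc
      obtain ⟨x, l, hx, hx', hle⟩ := htop t c p hcp
      have hxp : x = p := by
        refine hu x (hmem _ _ _ hx') ?_
        have := hP c x hx'
        rw [hσ c p, hs] at hle
        omega
      subst hxp
      have hst := unwind_step_active hx
      have hadj' : N.graph.Adj c x := hadj (hmem _ _ _ hcp)
      have hnm : ∀ j, U (t + 1) x ≠ .inr (.inr j) := by
        obtain ⟨l, h, -⟩ := hpc
        rw [h]; simp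
      have h2 : unwindInbox F stack N ω t c (N.id x) ≠ [true] := by
        intro h
        rw [if_pos h] at hst
        obtain ⟨y, e, -, e', -⟩ := (inv (t + 1) c).2 _ hst
        rw [← N.id_injective e] at e'
        exact hnm _ e'
      have h3 : unwindInbox F stack N ω t c (N.id x) ≠ [] := by
        intro h
        rw [unwindInbox_eq_nil hadj'] at h
        obtain ⟨l, h1, h1'⟩ := h1
        rw [h1] at h
        rcases h with h | ⟨j, h⟩
        · simp only [Sum.inr.injEq, Sum.inl.injEq] at h
          simp [h] at h1'
        · simp at h
      rw [if_neg h2, List.filter_cons_of_pos (by simpa using h3)] at hst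
      exact ⟨_, hst⟩
    have hcentre : ∀ v u, Has (t + 2) v u → σ v u = s → (∀ x ∈ st u, σ u x = s → x = v) →
        False := by
      intro v u h hs hu
      obtain ⟨h1, -⟩ := hback (t + 1) (by omega) v u h
      obtain ⟨h0, -⟩ := hback t ht v u h1
      obtain ⟨c, l, hc, hc', hle⟩ := htop (t + 1) v u h1
      have hcs : σ v c = s := by
        have := hP v c (hback t ht v c hc').1
        omega
      have hcl : ∀ x ∈ st c, σ c x = s → x = v := by
        rcases huniq v c (hmem _ _ _ hc') with h' | h'
        · have := h' u (hmem _ _ _ h1) (by rw [hs, hcs])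
          subst this
          exact hu
        · rw [hcs] at h'
          exact h'
      have hin := (unwindInbox_eq_true (hadj (hmem _ _ _ hc'))).2 (hleaf v c hc' hcs hcl)
      obtain ⟨l', h, -⟩ := h
      rw [unwind_step_active hc, if_pos hin] at h
      simp at h
    intro v u h
    have h2 := (hback (t + 2) (by omega) v u h)
    have h1 := (hback (t + 1) (by omega) v u h2.1)
    have h0 := (hback t (by omega) v u h1.1)
    by_contra hcon
    have hs : σ v u = s := by
      have := hP v u h0.1
      omega
    rcases huniq v u (hmem _ _ _ h) with h' | h'
    · exact hcentre u v (hswap (t + 2) v u u h2.1 (hmem _ _ _ h) h2.2)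
        (by rw [hσ, hs]) (by rw [hs] at h'; exact h')
    · exact hcentre v u h2.1 hs (by rw [hs] at h'; exact h')
  have hall : ∀ k, k ≤ K → ∀ v u, Has (t₀ + 3 * k) v u → σ v u < K - k := by
    intro k
    induction k with
    | zero => intro _ v u h; exact hK v u (hmem _ _ _ h)
    | succ k ih =>
      intro hk v u h
      refine key (K - (k + 1)) (t₀ + 3 * k) (by omega) ?_ v u h
      have : K - (k + 1) + 1 = K - k := by omega
      rw [this]
      exact ih (by omega)
  have hall' := hall K le_rfl
  have hhalt : ∀ v, (unwindOutput F (U (t₀ + 3 * K) v)).isSome := by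
    intro v
    rcases unwind_sim (stack := stack) (N := N) (ω := ω) (t₀ + 3 * K) v with ⟨-, h, -⟩ | ⟨⟨x, h⟩, -⟩
    · have h' := hF v
      rw [run_of_halted (hF v) (by omega)] at h
      simp [h] at h'
    · rcases x with (_ | ⟨i, l⟩) | j
      · rw [h]; rfl
      · exfalso
        obtain ⟨l₀, e1, -, -⟩ := (inv _ v).1 _ h
        rcases l₀ with _ | ⟨z, l₁⟩
        · simp at e1
        · have := hall' v z ⟨_, h, by rw [e1]; simp⟩
          omega
      · rw [h]; rfl
  exact ⟨fun v => (unwindOutput F (U (t₀ + 3 * K) v)).get (hhalt v),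
    fun v => (Option.some_get _).symm⟩

end MsgAlg

/-! ### Algorithms that publish logs, and their implementation by message passing. -/

/-- Algorithms in which every node maintains a log, to which it can append at most one entry per
round, and sees the logs of its neighbours. An entry may depend on the recipient (given by an
identifier). All random numbers are drawn before the first entry is written. -/
structure LogAlg where
  Entry : Type
  State : Type
  enc : Entry → List Bool
  dec : List Bool → Entry
  dec_enc : ∀ e, dec (enc e) = e
  maxCoin : ℕ → ℕ
  /-- the initial state and the first entry, from the local input and the random number -/
  init : LocalInput → ℕ → State × (ℕ → Entry)
  /-- the new state and the next entry, from the logs of the neighbours; `none` for waiting -/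
  next : State → (ℕ → List Entry) → Option (State × (ℕ → Entry))
  done : State → Prop

namespace LogAlg

variable (A : LogAlg) {n : ℕ} (N : Network n)

/-- The logs of the neighbours of `v`, as seen by `v`. -/
def view (L : Fin n → A.State × List (ℕ → A.Entry)) (v : Fin n) : ℕ → List A.Entry :=
  N.pull (fun u => (L u).2.map fun e => e (N.id v)) [] v

open Classical in
/-- One step of a node. -/
def advance (x : A.State × List (ℕ → A.Entry)) (w : ℕ → List A.Entry) :
    A.State × List (ℕ → A.Entry) :=
  if A.done x.1 then x else
    match A.next x.1 w with
    | none => x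
    | some (s, e) => (s, x.2 ++ [e])

/-- States and logs after `t` rounds, if `c` are the random numbers. -/
def run (c : Fin n → ℕ) : ℕ → Fin n → A.State × List (ℕ → A.Entry)
  | 0 => fun v => ((A.init (N.localInput v) (c v)).1, [(A.init (N.localInput v) (c v)).2])
  | t + 1 => fun v => A.advance (run c t v) (A.view N (run c t) v)

/-- The states of the implementation by message passing: the state of the node, the entries
received, and the entry to be sent. -/
abbrev ImplState : Type := A.State × (ℕ → List A.Entry) × Option (ℕ → A.Entry)

/-- Messages of the implementation by message passing. -/
def implSend : LocalInput ⊕ A.ImplState → ℕ → ℕ → List Bool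
  | .inr (_, _, some e), _, j => true :: A.enc (e j)
  | _, _, _ => []

/-- The entries received so far. -/
def receive (r : ℕ → List A.Entry) (inb : ℕ → List Bool) : ℕ → List A.Entry :=
  fun i => r i ++ match inb i with
    | [] => []
    | _ :: l => [A.dec l]

open Classical in
/-- Transitions of the implementation by message passing. -/
def implStep : LocalInput ⊕ A.ImplState → ℕ → (ℕ → List Bool) → LocalInput ⊕ A.ImplState
  | .inl li, c, _ => .inr ((A.init li c).1, fun _ => [], some (A.init li c).2)
  | .inr (s, r, _), _, inb => .inr <|
      if A.done s then (s, A.receive r inb, none) else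
        match A.next s (A.receive r inb) with
        | none => (s, A.receive r inb, none)
        | some (s', e) => (s', A.receive r inb, some e)

open Classical in
/-- Outputs of the implementation by message passing. -/
def implOutput : LocalInput ⊕ A.ImplState → Option (Option ℕ)
  | .inr (s, _, none) => if A.done s then some none else none
  | _ => none

/-- The implementation by message passing. The outputs only indicate that nodes have halted. -/
def toMsgAlg : MsgAlg where
  State := LocalInput ⊕ A.ImplState
  maxCoin := A.maxCoin
  init := .inl
  send := A.implSend
  step := A.implStep
  output := A.implOutput

variable {A N}
variable {ω : Coins n (A.maxCoin n)}

theorem run_succ (c : Fin n → ℕ) (t : ℕ) (v : Fin n) :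
    A.run N c (t + 1) v = A.advance (A.run N c t v) (A.view N (A.run N c t) v) := rfl

theorem run_succ_of_done {c : Fin n → ℕ} {t : ℕ} {v : Fin n} (h : A.done (A.run N c t v).1) :
    A.run N c (t + 1) v = A.run N c t v := by
  rw [run_succ, advance, if_pos h]

theorem run_succ_of_not_done {c : Fin n → ℕ} {t : ℕ} {v : Fin n}
    (h : ¬ A.done (A.run N c t v).1) : A.run N c (t + 1) v =
      match A.next (A.run N c t v).1 (A.view N (A.run N c t) v) with
      | none => A.run N c t v
      | some (s, e) => (s, (A.run N c t v).2 ++ [e]) := by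
  rw [run_succ, advance, if_neg h]

theorem run_of_done {c : Fin n → ℕ} {t : ℕ} {v : Fin n} (h : A.done (A.run N c t v).1) {t' : ℕ}
    (ht : t ≤ t') : A.run N c t' v = A.run N c t v := by
  induction t', ht using Nat.le_induction with
  | base => rfl
  | succ m _ ih => rw [run_succ_of_done (by rwa [ih]), ih]

/-- The run of the implementation. -/
def implRun (A : LogAlg) (N : Network n) (ω : Coins n (A.maxCoin n)) (t : ℕ) (v : Fin n) :
    LocalInput ⊕ A.ImplState := A.toMsgAlg.run N ω t v

/-- The message sent in a state of the implementation. -/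
def implMsg (A : LogAlg) (s : LocalInput ⊕ A.ImplState) (c j : ℕ) : List Bool :=
  if (A.implOutput s).isSome then [] else A.implSend s c j

theorem implRun_succ (t : ℕ) (v : Fin n) : A.implRun N ω (t + 1) v =
    if (A.implOutput (A.implRun N ω t v)).isSome then A.implRun N ω t v
    else A.implStep (A.implRun N ω t v) (ω t v)
      (N.inbox (fun u j => A.implMsg (A.implRun N ω t u) (ω t u) j) v) := rfl

theorem implMsg_inr (s : A.State) (r : ℕ → List A.Entry) (p : Option (ℕ → A.Entry)) (c j : ℕ) :
    A.implMsg (.inr (s, r, p)) c j = match p with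
      | none => []
      | some e => true :: A.enc (e j) := by
  rcases p with _ | e
  · rw [implMsg]; split_ifs <;> rfl
  · rfl

/-- The implementation lags one round behind, since its first round only draws the random number.
The entry `p v` is in the log but not yet sent, so neighbours have received `sent`. A node that is
done with nothing to send may have halted and stopped recording, which is why `r v` is described
only in the other case. -/
theorem implRun_spec (t : ℕ) : ∃ (r : Fin n → ℕ → List A.Entry) (p : Fin n → Option (ℕ → A.Entry))
    (sent : Fin n → List (ℕ → A.Entry)), ∀ v,
      A.implRun N ω (t + 1) v = .inr ((A.run N (fun v => ω 0 v) t v).1, r v, p v) ∧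
      (A.run N (fun v => ω 0 v) t v).2 = sent v ++ (p v).toList ∧
      (A.done (A.run N (fun v => ω 0 v) t v).1 ∧ p v = none ∨
        r v = N.pull (fun u => (sent u).map fun e => e (N.id v)) [] v) := by
  classical
  induction t with
  | zero =>
    refine ⟨fun _ _ => [], fun v => some (A.init (N.localInput v) (ω 0 v)).2, fun _ => [],
      fun v => ⟨rfl, rfl, Or.inr ?_⟩⟩
    funext i
    unfold Network.pull
    split_ifs <;> rfl
  | succ t ih =>
    obtain ⟨r, p, sent, h⟩ := ih
    set c : Fin n → ℕ := fun v => ω 0 v with hc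
    have hview : ∀ v, r v = N.pull (fun u => (sent u).map fun e => e (N.id v)) [] v →
        A.receive (r v) (N.inbox (fun u j => A.implMsg (A.implRun N ω (t + 1) u)
          (ω (t + 1) u) j) v) = A.view N (A.run N c t) v := by
      intro v hv
      funext i
      rw [receive, hv, view]
      by_cases hi : ∃ u, N.graph.Adj v u ∧ N.id u = i
      · obtain ⟨u, hu, rfl⟩ := hi
        rw [Network.inbox_id hu, Network.pull_id hu, Network.pull_id hu, (h u).1, (h u).2.1,
          implMsg_inr]
        rcases p u with _ | e
        · simp
        · simp [A.dec_enc]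
      · rw [Network.inbox_eq_pull, Network.pull_of_not hi, Network.pull_of_not hi,
          Network.pull_of_not hi]
        simp
    have hstep : ∀ v, ∃ r' p', A.implRun N ω (t + 1 + 1) v =
          .inr ((A.run N c (t + 1) v).1, r', p') ∧
        (A.run N c (t + 1) v).2 = (A.run N c t v).2 ++ p'.toList ∧
        (A.done (A.run N c (t + 1) v).1 ∧ p' = none ∨ r' = A.view N (A.run N c t) v) := by
      intro v
      by_cases hh : (A.implOutput (A.implRun N ω (t + 1) v)).isSome
      · rw [implRun_succ, if_pos hh]
        have hd : A.done (A.run N c t v).1 ∧ p v = none := by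
          rw [(h v).1] at hh
          rcases hp : p v with _ | e
          · rw [hp, implOutput] at hh
            refine ⟨?_, rfl⟩
            by_contra hd
            simp [hd] at hh
          · rw [hp] at hh; simp [implOutput] at hh
        have hrun : A.run N c (t + 1) v = A.run N c t v := run_succ_of_done hd.1
        rw [hrun]
        exact ⟨r v, none, by rw [(h v).1, hd.2], by simp, Or.inl ⟨hd.1, rfl⟩⟩
      · rw [implRun_succ, if_neg hh]
        have hr : r v = N.pull (fun u => (sent u).map fun e => e (N.id v)) [] v := by
          rcases (h v).2.2 with ⟨h1, h2⟩ | h1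
          · refine absurd ?_ hh
            rw [(h v).1, h2, implOutput, if_pos h1]
            rfl
          · exact h1
        have hv := hview v hr
        rw [(h v).1] at hh ⊢
        simp only [implStep, hv]
        by_cases hd : A.done (A.run N c t v).1
        · rw [if_pos hd]
          have hrun : A.run N c (t + 1) v = A.run N c t v := run_succ_of_done hd
          rw [hrun]
          exact ⟨_, none, rfl, by simp, Or.inl ⟨hd, rfl⟩⟩
        · rw [if_neg hd]
          rw [run_succ_of_not_done hd]
          rcases A.next (A.run N c t v).1 (A.view N (A.run N c t) v) with _ | ⟨s, e⟩
          · exact ⟨_, none, rfl, by simp, Or.inr rfl⟩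
          · exact ⟨_, some e, rfl, by simp, Or.inr rfl⟩
    choose r' p' h1 h2 h3 using hstep
    exact ⟨r', p', fun v => (A.run N c t v).2, fun v => ⟨h1 v, h2 v, h3 v⟩⟩

/-- The stack of identifiers kept in a state of the implementation. -/
def implStack (stk : A.State → List ℕ) : LocalInput ⊕ A.ImplState → List ℕ
  | .inr (s, _, _) => stk s
  | .inl _ => []

theorem halted_imp {t : ℕ} {v : Fin n} (h : (A.implOutput (A.implRun N ω t v)).isSome) :
    ∃ t', A.done (A.run N (fun v => ω 0 v) t' v).1 ∧ ∀ stk : A.State → List ℕ,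
      implStack stk (A.implRun N ω t v) = stk (A.run N (fun v => ω 0 v) t' v).1 := by
  rcases t with _ | t
  · simp [implRun, MsgAlg.run, toMsgAlg, implOutput] at h
  · obtain ⟨r, p, sent, hs⟩ := implRun_spec (A := A) (N := N) (ω := ω) t
    refine ⟨t, ?_, fun stk => by rw [(hs v).1]; rfl⟩
    rw [(hs v).1] at h
    rcases hp : p v with _ | e
    · rw [hp, implOutput] at h
      by_contra hd
      simp [hd] at h
    · rw [hp] at h; simp [implOutput] at h

/-- One of the two extra rounds is the delay by the random draw, the other one delivers the last
entry. -/
theorem halted_of_done {t : ℕ} {v : Fin n} (h : A.done (A.run N (fun v => ω 0 v) t v).1) :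
    (A.implOutput (A.implRun N ω (t + 2) v)).isSome := by
  obtain ⟨r, p, sent, hs⟩ := implRun_spec (A := A) (N := N) (ω := ω) (t + 1)
  obtain ⟨r', p', sent', hs'⟩ := implRun_spec (A := A) (N := N) (ω := ω) t
  have hd : A.done (A.run N (fun v => ω 0 v) (t + 1) v).1 := by
    rwa [run_of_done h (Nat.le_succ t)]
  suffices hp : p v = none by
    rw [(hs v).1, hp, implOutput, if_pos hd]
    rfl
  have h1 := (hs v).1
  rw [implRun_succ, (hs' v).1] at h1
  split_ifs at h1 with hh
  · simp only [Sum.inr.injEq, Prod.mk.injEq] at h1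
    rw [← h1.2.2]
    rcases hp : p' v with _ | e
    · rfl
    · rw [hp] at hh; simp [implOutput] at hh
  · rw [implStep, if_pos h] at h1
    simp only [Sum.inr.injEq, Prod.mk.injEq] at h1
    exact h1.2.2.symm

theorem implMsg_length_le {b : ℕ} {v u : Fin n}
    (h : ∀ t, ∀ e ∈ (A.run N (fun v => ω 0 v) t v).2, (A.enc (e (N.id u))).length ≤ b)
    (t c : ℕ) : (A.implMsg (A.implRun N ω t v) c (N.id u)).length ≤ b + 1 := by
  rcases t with _ | t
  · rw [implMsg]; split_ifs <;> exact Nat.zero_le _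
  · obtain ⟨r, p, sent, hs⟩ := implRun_spec (A := A) (N := N) (ω := ω) t
    rw [(hs v).1, implMsg_inr]
    rcases hp : p v with _ | e
    · simp
    · have := h t e (by rw [(hs v).2.1, hp]; simp)
      simpa using this

theorem toMsgAlg_messageBound {b : ℕ}
    (h : ∀ (ω : Coins n (A.maxCoin n)) v u, N.graph.Adj v u → ∀ t,
      ∀ e ∈ (A.run N (fun v => ω 0 v) t v).2, (A.enc (e (N.id u))).length ≤ b) :
    A.toMsgAlg.MessageBound N (b + 1) :=
  fun ω t v u hvu => implMsg_length_le (h ω v u hvu) t _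

end LogAlg

/-! ### Stacks built by pushing vertex-disjoint stars. -/

namespace Network

variable {n : ℕ} {N : Network n}

/-- Stacks that arise after `s` steps of pushing edges, in each of which the edges pushed form
vertex-disjoint stars. The amounts pushed at `v` add up to `Y v`, and `σ v u` is the step in which
`vu` was pushed. -/
structure StarStacks (N : Network n) (st : Fin n → List (Fin n)) (R σ : Fin n → Fin n → ℕ)
    (Y : Fin n → ℕ) (s : ℕ) : Prop where
  nodup : ∀ v, (st v).Nodup
  adj : ∀ {v u}, u ∈ st v → N.graph.Adj v u
  symm : ∀ {v u}, u ∈ st v → v ∈ st u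
  amount_symm : ∀ v u, R v u = R u v
  below : ∀ v u a b a' b', st v = a ++ u :: b → st u = a' ++ v :: b' →
    R v u + (b.map (R v)).sum + (b'.map (R u)).sum ≤ N.weight s(v, u)
  total : ∀ v, ((st v).map (R v)).sum = Y v
  pushed : ∀ v, ∀ u ∈ st v, N.weight s(v, u) ≤ Y v + Y u
  step_symm : ∀ v u, σ v u = σ u v
  step_lt : ∀ v, ∀ u ∈ st v, σ v u < s
  sorted : ∀ v x u, [x, u].Sublist (st v) → σ v u ≤ σ v x
  leaf : ∀ v, ∀ u ∈ st v, (∀ x ∈ st v, σ v x = σ v u → x = u) ∨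
    (∀ x ∈ st u, σ u x = σ v u → x = v)

theorem StarStacks.certificate {st : Fin n → List (Fin n)} {R σ : Fin n → Fin n → ℕ}
    {Y : Fin n → ℕ} {s : ℕ} (h : N.StarStacks st R σ Y s)
    (hcov : ∀ v u, N.graph.Adj v u → N.weight s(v, u) ≤ Y v + Y u) : N.Certificate st R where
  nodup := h.nodup
  adj := h.adj
  symm := h.symm
  amount_symm := h.amount_symm
  below := h.below
  cover v u hvu := by rw [h.total, h.total]; exact hcov v u hvu

theorem starStacks_empty (N : Network n) :
    N.StarStacks (fun _ => []) (fun _ _ => 0) (fun _ _ => 0) (fun _ => 0) 0 := by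
  constructor <;> simp

/-- Pushing vertex-disjoint stars: `a v` lists the new mates of `v`, the last one first. -/
theorem StarStacks.push {st : Fin n → List (Fin n)} {R σ : Fin n → Fin n → ℕ}
    {Y Y' : Fin n → ℕ} {s : ℕ} (h : N.StarStacks st R σ Y s)
    (a : Fin n → List (Fin n)) (r : Fin n → Fin n → ℕ)
    (hnd : ∀ v, (a v).Nodup) (hadj : ∀ {v u}, u ∈ a v → N.graph.Adj v u)
    (hsymm : ∀ {v u}, u ∈ a v → v ∈ a u) (hr : ∀ v u, r v u = r u v)
    (hlt : ∀ v, ∀ u ∈ a v, Y v + Y u < N.weight s(v, u))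
    (hbelow : ∀ v u p q p' q', a v = p ++ u :: q → a u = p' ++ v :: q' →
      r v u + (q.map (r v)).sum + (q'.map (r u)).sum + Y v + Y u ≤ N.weight s(v, u))
    (hY : ∀ v, Y' v = Y v + ((a v).map (r v)).sum)
    (hpushed : ∀ v, ∀ u ∈ a v, N.weight s(v, u) ≤ Y' v + Y' u)
    (hstar : ∀ v, ∀ u ∈ a v, a v = [u] ∨ a u = [v]) :
    ∃ R' σ', N.StarStacks (fun v => a v ++ st v) R' σ' Y' (s + 1) := by
  classical
  -- New edges have positive residual weight and old ones have none, so no edge is pushed twice.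
  have hdisj : ∀ v, ∀ u ∈ a v, u ∉ st v := fun v u hu hu' =>
    absurd (hlt v u hu) (not_lt.2 (h.pushed v u hu'))
  have hmemsymm : ∀ v u, u ∈ a v ↔ v ∈ a u := fun v u => ⟨hsymm, hsymm⟩
  let R' : Fin n → Fin n → ℕ := fun v u => if u ∈ a v then r v u else R v u
  let σ' : Fin n → Fin n → ℕ := fun v u => if u ∈ a v then s else σ v u
  have hRnew : ∀ v (l : List (Fin n)), (∀ u ∈ l, u ∈ a v) → l.map (R' v) = l.map (r v) :=
    fun v l hl => List.map_congr_left fun u hu => if_pos (hl u hu)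
  have hRold : ∀ v (l : List (Fin n)), (∀ u ∈ l, u ∈ st v) → l.map (R' v) = l.map (R v) :=
    fun v l hl => List.map_congr_left fun u hu => if_neg fun hu' => hdisj v u hu' (hl u hu)
  have hσold : ∀ v, ∀ u ∈ st v, σ' v u = σ v u := fun v u hu =>
    if_neg fun hu' => hdisj v u hu' hu
  have hσnew : ∀ v, ∀ u ∈ a v, σ' v u = s := fun v u hu => if_pos hu
  have hnodup : ∀ v, (a v ++ st v).Nodup := fun v =>
    List.nodup_append.2 ⟨hnd v, h.nodup v, fun x hx y hy e => hdisj v x hx (e ▸ hy)⟩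
  -- Below a new edge lie the remaining new edges and the whole old stack, whose amounts add up to
  -- `Y v`. Below an old edge nothing changes.
  have split_new : ∀ v u A B, u ∈ a v → a v ++ st v = A ++ u :: B →
      ∃ q, a v = A ++ u :: q ∧ B = q ++ st v := by
    intro v u A B hu e
    rcases List.append_eq_append_iff.1 e with ⟨A', e1, e2⟩ | ⟨C, e1, e2⟩
    · exact absurd (e2 ▸ by simp) (hdisj v u hu)
    · rcases C with _ | ⟨c, C⟩
      · exact absurd (by rw [← show u :: B = st v by simpa using e2]; simp) (hdisj v u hu)
      · simp only [List.cons_append, List.cons.injEq] at e2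
        obtain ⟨rfl, rfl⟩ := e2
        exact ⟨C, e1, rfl⟩
  have split_old : ∀ v u A B, u ∉ a v → a v ++ st v = A ++ u :: B →
      ∃ A', st v = A' ++ u :: B := by
    intro v u A B hu e
    rcases List.append_eq_append_iff.1 e with ⟨A', e1, e2⟩ | ⟨C, e1, e2⟩
    · exact ⟨A', e2⟩
    · rcases C with _ | ⟨c, C⟩
      · exact ⟨[], by simpa using e2.symm⟩
      · simp only [List.cons_append, List.cons.injEq] at e2
        obtain ⟨rfl, rfl⟩ := e2
        exact absurd (e1 ▸ by simp) hu
  refine ⟨R', σ', ⟨hnodup, ?_, ?_, ?_, ?_, ?_, ?_, ?_, ?_, ?_, ?_⟩⟩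
  · intro v u hu
    exact (List.mem_append.1 hu).elim hadj h.adj
  · intro v u hu
    exact List.mem_append.2 ((List.mem_append.1 hu).imp hsymm h.symm)
  · intro v u
    show (if _ then _ else _) = (if _ then _ else _)
    rw [hr v u, h.amount_symm v u]
    exact if_congr (hmemsymm v u) rfl rfl
  · intro v u A B A' B' e e'
    by_cases hu : u ∈ a v
    · obtain ⟨q, e1, rfl⟩ := split_new v u A B hu e
      obtain ⟨q', e2, rfl⟩ := split_new u v A' B' (hsymm hu) e'
      have := hbelow v u A q A' q' e1 e2
      rw [List.map_append, List.map_append, List.sum_append, List.sum_append,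
        hRnew v q (fun x hx => e1 ▸ by simp [hx]), hRnew u q' (fun x hx => e2 ▸ by simp [hx]),
        hRold v _ (fun x hx => hx), hRold u _ (fun x hx => hx), h.total, h.total,
        show R' v u = r v u from if_pos hu]
      omega
    · obtain ⟨p, e1⟩ := split_old v u A B hu e
      obtain ⟨p', e2⟩ := split_old u v A' B' (fun h => hu (hsymm h)) e'
      rw [hRold v B (fun x hx => e1 ▸ by simp [hx]), hRold u B' (fun x hx => e2 ▸ by simp [hx]),
        show R' v u = R v u from if_neg hu]
      exact h.below v u p B p' B' e1 e2
  · intro v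
    rw [List.map_append, List.sum_append, hRnew v _ (fun x hx => hx), hRold v _ (fun x hx => hx),
      h.total, hY, add_comm]
  · intro v u hu
    rcases List.mem_append.1 hu with hu | hu
    · exact hpushed v u hu
    · have := h.pushed v u hu
      rw [hY, hY]; omega
  · intro v u
    show (if _ then _ else _) = (if _ then _ else _)
    rw [h.step_symm v u]
    exact if_congr (hmemsymm v u) rfl rfl
  · intro v u hu
    rcases List.mem_append.1 hu with hu | hu
    · rw [hσnew v u hu]; omega
    · rw [hσold v u hu]; have := h.step_lt v u hu; omega
  · intro v x u hs
    have hx : x ∈ a v ++ st v := hs.subset (by simp)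
    have hu : u ∈ a v ++ st v := hs.subset (by simp)
    rcases List.mem_append.1 hu with hu' | hu'
    · rcases List.mem_append.1 hx with hx' | hx'
      · rw [hσnew v u hu', hσnew v x hx']
      · have hux : [u, x].Sublist (a v ++ st v) :=
          List.Sublist.append (List.singleton_sublist.2 hu') (List.singleton_sublist.2 hx')
        exact absurd hs fun hs => (hnodup v).not_pair_swap hs hux
    · rw [hσold v u hu']
      rcases List.mem_append.1 hx with hx' | hx'
      · rw [hσnew v x hx']; exact (h.step_lt v u hu').le
      · rw [hσold v x hx']
        have hne : x ≠ u := by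
          rintro rfl
          have := (hnodup v).sublist hs
          simp at this
        rcases List.pair_sublist_or hx' hu' hne with h' | h'
        · exact h.sorted v x u h'
        · exact absurd hs fun hs =>
            (hnodup v).not_pair_swap hs (h'.trans (List.sublist_append_right _ _))
  · have hlast : ∀ v u, u ∈ a v → a v = [u] → ∀ x ∈ a v ++ st v, σ' v x = σ' v u → x = u := by
      intro v u hu e x hx hxs
      rw [hσnew v u hu] at hxs
      rcases List.mem_append.1 hx with hx | hx
      · rw [e] at hx; simpa using hx
      · rw [hσold v x hx] at hxs
        have := h.step_lt v x hx
        omega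
    have hsσ : ∀ v u, σ' v u = σ' u v := fun v u => by
      show (if _ then _ else _) = (if _ then _ else _)
      rw [h.step_symm v u]
      exact if_congr (hmemsymm v u) rfl rfl
    have hold : ∀ v u, u ∈ st v → (∀ x ∈ st v, σ v x = σ v u → x = u) →
        ∀ x ∈ a v ++ st v, σ' v x = σ' v u → x = u := by
      intro v u hu hl x hx hxs
      rw [hσold v u hu] at hxs
      rcases List.mem_append.1 hx with hx | hx
      · rw [hσnew v x hx] at hxs
        have := h.step_lt v u hu
        omega
      · rw [hσold v x hx] at hxs
        exact hl x hx hxs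
    intro v u hu
    rcases List.mem_append.1 hu with hu | hu
    · rcases hstar v u hu with e | e
      · exact Or.inl (hlast v u hu e)
      · right; rw [hsσ v u]; exact hlast u v (hsymm hu) e
    · rcases h.leaf v u hu with e | e
      · exact Or.inl (hold v u hu e)
      · right; rw [hsσ v u]; exact hold u v (h.symm hu) (by rw [h.step_symm u v]; exact e)

end Network

/-! ### Levels: edges with residual weight in a dyadic range. -/

namespace Network

variable {n : ℕ} (N : Network n)

/-- The edges whose residual weight `w(e) - Y v - Y u` is positive and has binary logarithm `k`,
with unit weights. -/
def levelNet (Y : Fin n → ℕ) (k : ℕ) : Network n where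
  graph :=
    { Adj := fun v u => N.graph.Adj v u ∧ 0 < N.weight s(v, u) - (Y v + Y u) ∧
        Nat.log 2 (N.weight s(v, u) - (Y v + Y u)) = k
      symm := ⟨fun v u h => by
        rw [Sym2.eq_swap, add_comm (Y u)]
        exact ⟨h.1.symm, h.2⟩⟩
      loopless := ⟨fun v h => h.1.ne rfl⟩ }
  id := N.id
  id_injective := N.id_injective
  weight _ := 1

variable {N}

theorem levelNet_le (Y : Fin n → ℕ) (k : ℕ) : (N.levelNet Y k).graph ≤ N.graph := fun _ _ h => h.1

theorem levelNet_idBound {κ : ℕ} (h : N.IdBound κ) (Y : Fin n → ℕ) (k : ℕ) :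
    (N.levelNet Y k).IdBound κ := h

theorem levelNet_weightBound (Y : Fin n → ℕ) (k : ℕ) : (N.levelNet Y k).WeightBound 1 :=
  fun _ _ => ⟨le_rfl, le_rfl⟩

theorem maxDegree_mono {N N' : Network n} (h : N.graph ≤ N'.graph) :
    N.maxDegree ≤ N'.maxDegree := by
  classical
  refine SimpleGraph.maxDegree_le_of_forall_degree_le _ _ fun v => ?_
  refine le_trans (Finset.card_le_card fun u hu => ?_) (SimpleGraph.degree_le_maxDegree _ v)
  rw [SimpleGraph.mem_neighborFinset] at hu ⊢
  exact h hu

variable (N)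

/-- The residual weight of the edge from `v` to its mate. -/
def gain (Y : Fin n → ℕ) (v : Fin n) : Option ℕ → ℕ
  | none => 0
  | some j => (N.localInput v).weight j - (Y v + N.pull Y 0 v j)

end Network

namespace MsgAlg

variable (A : MsgAlg) {n : ℕ} (N : Network n)

open Classical in
/-- The output of a node if it ever halts. -/
def finalOutput (ω : Coins n (A.maxCoin n)) (v : Fin n) : Option ℕ :=
  if h : ∃ o t, A.output (A.run N ω t v) = some o then h.choose else none

variable {A N}

theorem finalOutput_eq {ω : Coins n (A.maxCoin n)} {v : Fin n} {t : ℕ} {o : Option ℕ}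
    (h : A.output (A.run N ω t v) = some o) : A.finalOutput N ω v = o := by
  have h' : ∃ o t, A.output (A.run N ω t v) = some o := ⟨o, t, h⟩
  obtain ⟨t', ht'⟩ := h'.choose_spec
  rw [finalOutput, dif_pos h']
  rcases le_total t t' with hle | hle
  · rw [run_of_halted (by rw [h]; rfl) hle, h] at ht'
    exact (Option.some_injective _ ht').symm
  · rw [run_of_halted (by rw [ht']; rfl) hle, ht'] at h
    exact Option.some_injective _ h

end MsgAlg

section Levels

variable (mis : MsgAlg) {n : ℕ} (N : Network n)

open Classical in
/-- The mates in the matching computed by `mis` in the network of level `k`, where nodes without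
neighbours do not take part. -/
def levelMate (Y : Fin n → ℕ) (k : ℕ) (ω : Coins n (mis.maxCoin n)) (v : Fin n) : Option ℕ :=
  if ∃ u, (N.levelNet Y k).graph.Adj v u then mis.finalOutput (N.levelNet Y k) ω v else none

variable (L : ℕ) (w : ℕ → Coins n (mis.maxCoin n))

/-- Potentials and stacks after processing the first `d` of the levels `L - 1, L - 2, …, 0`. -/
def levelData : ℕ → Fin n → ℕ × List ℕ
  | 0 => fun _ => (0, [])
  | d + 1 => fun v =>
      let Y := fun u => (levelData d u).1
      let m := levelMate mis N Y (L - (d + 1)) (w (L - (d + 1))) v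
      (Y v + N.gain Y v m, m.toList ++ (levelData d v).2)

/-- The potentials after processing the levels `L - 1, …, k`. -/
def levelPot (k : ℕ) (v : Fin n) : ℕ := (levelData mis N L w (L - k) v).1

/-- The stacks after processing the levels `L - 1, …, k`. -/
def levelStack (k : ℕ) (v : Fin n) : List ℕ := (levelData mis N L w (L - k) v).2

/-- The network on which the matching of level `k` is computed. -/
def levelGraph (k : ℕ) : Network n := N.levelNet (levelPot mis N L w (k + 1)) k

/-- The mates in level `k`. -/
def levelMates (k : ℕ) (v : Fin n) : Option ℕ :=
  levelMate mis N (levelPot mis N L w (k + 1)) k (w k) v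

variable {mis N L w}

theorem levelData_succ (d : ℕ) (v : Fin n) : levelData mis N L w (d + 1) v =
    ((levelData mis N L w d v).1 + N.gain (fun u => (levelData mis N L w d u).1) v
        (levelMate mis N (fun u => (levelData mis N L w d u).1) (L - (d + 1)) (w (L - (d + 1))) v),
      (levelMate mis N (fun u => (levelData mis N L w d u).1) (L - (d + 1))
        (w (L - (d + 1))) v).toList ++ (levelData mis N L w d v).2) := rfl

theorem levelData_of_lt {k : ℕ} (hk : k < L) (v : Fin n) : levelData mis N L w (L - k) v =
    (levelPot mis N L w (k + 1) v +
      N.gain (levelPot mis N L w (k + 1)) v (levelMates mis N L w k v),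
      (levelMates mis N L w k v).toList ++ levelStack mis N L w (k + 1) v) := by
  have e : L - k = L - (k + 1) + 1 := by omega
  have e' : L - (L - (k + 1) + 1) = k := by omega
  rw [e, levelData_succ, e']
  rfl

theorem levelPot_of_lt {k : ℕ} (hk : k < L) (v : Fin n) : levelPot mis N L w k v =
    levelPot mis N L w (k + 1) v +
      N.gain (levelPot mis N L w (k + 1)) v (levelMates mis N L w k v) := by
  rw [levelPot, levelData_of_lt hk]

theorem levelStack_of_lt {k : ℕ} (hk : k < L) (v : Fin n) : levelStack mis N L w k v =
    (levelMates mis N L w k v).toList ++ levelStack mis N L w (k + 1) v := by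
  rw [levelStack, levelData_of_lt hk]

theorem levelPot_of_le {k : ℕ} (hk : L ≤ k) (v : Fin n) : levelPot mis N L w k v = 0 := by
  rw [levelPot, Nat.sub_eq_zero_of_le hk]; rfl

theorem levelStack_of_le {k : ℕ} (hk : L ≤ k) (v : Fin n) : levelStack mis N L w k v = [] := by
  rw [levelStack, Nat.sub_eq_zero_of_le hk]; rfl

theorem levelMates_of_isolated {k : ℕ} {v : Fin n}
    (h : ¬ ∃ u, (levelGraph mis N L w k).graph.Adj v u) : levelMates mis N L w k v = none :=
  if_neg h

theorem levelMates_of_output {k t : ℕ} {v : Fin n} {o : Option ℕ}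
    (h : ∃ u, (levelGraph mis N L w k).graph.Adj v u)
    (ho : mis.output (mis.run (levelGraph mis N L w k) (w k) t v) = some o) :
    levelMates mis N L w k v = o :=
  (if_pos h).trans (MsgAlg.finalOutput_eq ho)

/-- A node takes part only in levels up to the logarithm of its largest weight. -/
theorem levelGraph_isolated {k : ℕ} {v : Fin n}
    (hv : ∀ u, N.graph.Adj v u → Nat.log 2 (N.weight s(v, u)) < k) :
    ¬ ∃ u, (levelGraph mis N L w k).graph.Adj v u := by
  rintro ⟨u, h1, h2, h3⟩
  have := Nat.log_mono_right (b := 2) (Nat.sub_le (N.weight s(v, u))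
    (levelPot mis N L w (k + 1) v + levelPot mis N L w (k + 1) u))
  have := hv u h1
  omega

/-- Above the logarithms of the weights at `v` the node is isolated in every level, so it may start
at its own top level with zero potential and empty stack, without knowing the number `L` of levels.
-/
theorem levelPot_eq_zero {k : ℕ} {v : Fin n}
    (hv : ∀ u, N.graph.Adj v u → Nat.log 2 (N.weight s(v, u)) < k) :
    levelPot mis N L w k v = 0 ∧ levelStack mis N L w k v = [] := by
  by_cases hk : L ≤ k
  · exact ⟨levelPot_of_le hk v, levelStack_of_le hk v⟩
  · have := levelPot_eq_zero (k := k + 1) fun u hu => (hv u hu).trans (Nat.lt_succ_self k)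
    rw [levelPot_of_lt (by omega), levelStack_of_lt (by omega),
      levelMates_of_isolated (levelGraph_isolated hv), this.1, this.2]
    exact ⟨rfl, rfl⟩
termination_by L - k

theorem levelPot_anti (k : ℕ) (v : Fin n) :
    levelPot mis N L w (k + 1) v ≤ levelPot mis N L w k v := by
  by_cases hk : k < L
  · rw [levelPot_of_lt hk]; omega
  · rw [levelPot_of_le (by omega)]; omega

/-- The outputs on the levels are matchings that are maximal. -/
def LevelsCorrect (mis : MsgAlg) (N : Network n) (L : ℕ) (w : ℕ → Coins n (mis.maxCoin n)) : Prop :=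
  ∀ k < L, (levelGraph mis N L w k).MatesConsistent (levelMates mis N L w k) ∧
    ∀ v u, (levelGraph mis N L w k).graph.Adj v u →
      levelMates mis N L w k v ≠ none ∨ levelMates mis N L w k u ≠ none

theorem gain_id {Y : Fin n → ℕ} {v u : Fin n} (h : N.graph.Adj v u) :
    N.gain Y v (some (N.id u)) = N.weight s(v, u) - (Y v + Y u) := by
  rw [Network.gain, Network.localInput_weight h, Network.pull_id h]

/-- Before level `k` residual weights are below `2 ^ (k + 1)`. Those of at least `2 ^ k` are the
edges of the level; by maximality one endpoint of each is matched, and its potential rises by at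
least `2 ^ k`. After level `0` the bound is `1`, so every edge is covered. -/
theorem residual_lt (hL : ∀ v u, N.graph.Adj v u → Nat.log 2 (N.weight s(v, u)) < L)
    (hmis : LevelsCorrect mis N L w) {d : ℕ} (hd : d ≤ L) {v u : Fin n} (hvu : N.graph.Adj v u) :
    N.weight s(v, u) <
      levelPot mis N L w (L - d) v + levelPot mis N L w (L - d) u + 2 ^ (L - d) := by
  induction d generalizing v u with
  | zero =>
    have := Nat.lt_pow_of_log_lt Nat.one_lt_two (hL v u hvu)
    simp only [Nat.sub_zero]
    omega
  | succ d ih =>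
    obtain ⟨k, rfl⟩ : ∃ k, L = k + (d + 1) := ⟨L - (d + 1), by omega⟩
    have e1 : k + (d + 1) - (d + 1) = k := by omega
    have e2 : k + (d + 1) - d = k + 1 := by omega
    rw [e1]
    simp only [e2] at ih
    have hk : k < k + (d + 1) := by omega
    by_contra! hcon
    have h0 := ih (by omega) hvu
    have hv0 := levelPot_anti (mis := mis) (N := N) (L := k + (d + 1)) (w := w) k v
    have hu0 := levelPot_anti (mis := mis) (N := N) (L := k + (d + 1)) (w := w) k u
    have hp : 0 < 2 ^ k := Nat.two_pow_pos k
    have hpow : 2 ^ (k + 1) = 2 * 2 ^ k := pow_succ' 2 k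
    have hadj : (levelGraph mis N (k + (d + 1)) w k).graph.Adj v u := by
      refine ⟨hvu, by omega, ?_⟩
      exact Nat.log_eq_of_pow_le_of_lt_pow (by omega) (by omega)
    -- The edge to the mate belongs to level `k` itself, so the amount pushed on it is at least `2 ^
    -- k`.
    have key : ∀ v, levelMates mis N (k + (d + 1)) w k v ≠ none →
        levelPot mis N (k + (d + 1)) w (k + 1) v + 2 ^ k ≤
          levelPot mis N (k + (d + 1)) w k v := by
      intro v h
      obtain ⟨i, hi⟩ := Option.ne_none_iff_exists'.1 h
      obtain ⟨x, hx, rfl, -⟩ := (hmis k hk).1 v i hi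
      rw [levelPot_of_lt hk, hi]
      have : N.gain (levelPot mis N (k + (d + 1)) w (k + 1)) v
          (some ((levelGraph mis N (k + (d + 1)) w k).id x)) = _ := gain_id hx.1
      rw [this]
      obtain ⟨-, h1, h2⟩ := hx
      have := Nat.pow_log_le_self 2 h1.ne'
      rw [h2] at this
      omega
    rcases (hmis k hk).2 v u hadj with h | h
    · have := key v h; omega
    · have := key u h; omega

/-- A matching consists of stars with a single leaf, so each level is one application of
`StarStacks.push`. Only consistency of the mates is used here; maximality enters through
`residual_lt`. -/
theorem exists_starStacks (hmis : LevelsCorrect mis N L w) {d : ℕ} (hd : d ≤ L) :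
    ∃ st R σ, N.StarStacks st R σ (levelPot mis N L w (L - d)) d ∧
      ∀ v, levelStack mis N L w (L - d) v = (st v).map N.id := by
  classical
  induction d with
  | zero =>
    refine ⟨fun _ => [], fun _ _ => 0, fun _ _ => 0, ?_, ?_⟩
    · have : levelPot mis N L w (L - 0) = fun _ => 0 := by
        funext v; exact levelPot_of_le (by omega) v
      rw [this]
      exact Network.starStacks_empty N
    · intro v; exact levelStack_of_le (by omega) v
  | succ d ih =>
    obtain ⟨k, rfl⟩ : ∃ k, L = k + (d + 1) := ⟨L - (d + 1), by omega⟩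
    have e1 : k + (d + 1) - (d + 1) = k := by omega
    have e2 : k + (d + 1) - d = k + 1 := by omega
    obtain ⟨st, R, σ, hS, hst⟩ := ih (by omega)
    rw [e2] at hS hst
    rw [e1]
    have hk : k < k + (d + 1) := by omega
    obtain ⟨hc, -⟩ := hmis k hk
    set m := levelMates mis N (k + (d + 1)) w k with hm
    set Y := levelPot mis N (k + (d + 1)) w (k + 1) with hY
    let a : Fin n → List (Fin n) := fun v =>
      if h : ∃ u, m v = some (N.id u) then [h.choose] else []
    have ha : ∀ v u, m v = some (N.id u) → a v = [u] := by
      intro v u h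
      have h' : ∃ u, m v = some (N.id u) := ⟨u, h⟩
      show dite _ _ _ = _
      rw [dif_pos h', N.id_injective (Option.some_injective _ (h'.choose_spec.symm.trans h))]
    have ha' : ∀ v u, u ∈ a v → m v = some (N.id u) := by
      intro v u h
      by_cases h' : ∃ u, m v = some (N.id u)
      · have : a v = [h'.choose] := dif_pos h'
        rw [this, List.mem_singleton] at h
        rw [h]; exact h'.choose_spec
      · have : a v = [] := dif_neg h'
        simp [this] at h
    have hedge : ∀ v u, m v = some (N.id u) →
        (levelGraph mis N (k + (d + 1)) w k).graph.Adj v u ∧ m u = some (N.id v) := by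
      intro v u h
      obtain ⟨x, hx, e, hx'⟩ := hc v _ h
      rw [N.id_injective e] at hx hx'
      exact ⟨hx, hx'⟩
    have hgain : ∀ v u, m v = some (N.id u) →
        N.gain Y v (m v) = N.weight s(v, u) - (Y v + Y u) := by
      intro v u h
      rw [h]; exact gain_id (hedge v u h).1.1
    have hpot : ∀ v, levelPot mis N (k + (d + 1)) w k v = Y v + N.gain Y v (m v) :=
      fun v => levelPot_of_lt hk v
    have hnone : ∀ v, (¬ ∃ u, m v = some (N.id u)) → m v = none := by
      intro v h
      by_contra hne
      obtain ⟨i, hi⟩ := Option.ne_none_iff_exists'.1 hne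
      obtain ⟨x, -, e, -⟩ := hc v i hi
      exact h ⟨x, hi.trans (congrArg some e.symm)⟩
    have main := hS.push (Y' := levelPot mis N (k + (d + 1)) w k) a
      (fun v u => N.weight s(v, u) - (Y v + Y u)) ?_ ?_ ?_ ?_ ?_ ?_ ?_ ?_ ?_
    · obtain ⟨R', σ', hS'⟩ := main
      refine ⟨_, R', σ', hS', fun v => ?_⟩
      rw [levelStack_of_lt hk, hst, List.map_append]
      congr 1
      show (m v).toList = _
      by_cases h : ∃ u, m v = some (N.id u)
      · obtain ⟨u, hu⟩ := h
        rw [ha v u hu, hu]; rfl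
      · rw [hnone v h, show a v = [] from dif_neg h]; rfl
    · intro v
      by_cases h : ∃ u, m v = some (N.id u)
      · obtain ⟨u, hu⟩ := h
        rw [ha v u hu]; simp
      · rw [show a v = [] from dif_neg h]; simp
    · intro v u h
      exact (hedge v u (ha' v u h)).1.1
    · intro v u h
      rw [ha u v (hedge v u (ha' v u h)).2]; simp
    · intro v u
      simp only [Sym2.eq_swap, add_comm]
    · intro v u h
      have := (hedge v u (ha' v u h)).1.2.1
      show Y v + Y u < _
      change 0 < _ - (Y v + Y u) at this
      omega
    · intro v u p q p' q' h1 h2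
      have hu : u ∈ a v := h1 ▸ by simp
      have h3 := ha v u (ha' v u hu)
      have h4 := ha u v (hedge v u (ha' v u hu)).2
      have hq : q = [] := by
        rw [h3] at h1
        have := congrArg List.length h1
        simp at this
        exact List.eq_nil_of_length_eq_zero (by omega)
      have hq' : q' = [] := by
        rw [h4] at h2
        have := congrArg List.length h2
        simp at this
        exact List.eq_nil_of_length_eq_zero (by omega)
      have := (hedge v u (ha' v u hu)).1.2.1
      change 0 < _ - (Y v + Y u) at this
      subst hq hq'
      simp only [List.map_nil, List.sum_nil]
      omega
    · intro v
      rw [hpot]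
      by_cases h : ∃ u, m v = some (N.id u)
      · obtain ⟨u, hu⟩ := h
        rw [ha v u hu, hgain v u hu]; simp
      · rw [hnone v h, show a v = [] from dif_neg h]; rfl
    · intro v u h
      have hu := ha' v u h
      rw [hpot, hgain v u hu]
      have : Y u ≤ levelPot mis N (k + (d + 1)) w k u := levelPot_anti k u
      omega
    · intro v u h
      exact Or.inl (ha v u (ha' v u h))

end Levels

/-! ### Encodings of numbers -/

/-- The number with the given binary digits. -/
def ofBits (l : List Bool) : ℕ := l.foldr Nat.bit 0

theorem ofBits_bits (m : ℕ) : ofBits m.bits = m := by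
  induction m using Nat.binaryRec' with
  | zero => simp [ofBits]
  | bit b m h ih =>
    rw [Nat.bits_append_bit m b h, ofBits, List.foldr_cons]
    exact congrArg _ ih

theorem length_bits_le {m b : ℕ} (h : m < 2 ^ b) : m.bits.length ≤ b := by
  rw [Nat.size_eq_bits_len]
  exact Nat.size_le.2 h

/-- Log entries: `(k, inl y)` announces the potential `y` after processing the levels from `k` on;
`(k, inr m)` is a message sent in the computation of a matching on level `k`. -/
abbrev LevelEntry : Type := ℕ × (ℕ ⊕ List Bool)

namespace LevelEntry

/-- Encoding of entries. -/
def enc : LevelEntry → List Bool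
  | (k, x) => List.replicate k true ++ false :: match x with
    | .inl y => false :: y.bits
    | .inr m => true :: m

/-- Decoding of entries. -/
def dec (l : List Bool) : LevelEntry :=
  ((l.takeWhile id).length, match (l.dropWhile id).tail with
    | [] => .inl 0
    | false :: b => .inl (ofBits b)
    | true :: m => .inr m)

theorem dec_enc (e : LevelEntry) : dec (enc e) = e := by
  obtain ⟨k, x⟩ := e
  have h1 : ∀ l : List Bool, (List.replicate k true ++ false :: l).takeWhile id =
      List.replicate k true := by
    intro l
    induction k with
    | zero => rfl
    | succ k ih => rw [List.replicate_succ, List.cons_append, List.takeWhile_cons, ih]; rfl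
  have h2 : ∀ l : List Bool, (List.replicate k true ++ false :: l).dropWhile id = false :: l := by
    intro l
    clear h1
    induction k with
    | zero => rfl
    | succ k ih => rw [List.replicate_succ, List.cons_append, List.dropWhile_cons, ih]; rfl
  show dec (List.replicate k true ++ false :: _) = _
  rw [dec, h1, h2]
  rcases x with y | m
  · simp [ofBits_bits]
  · simp

/-- The level is written in unary. This is affordable because levels are bounded by logarithms of
weights. -/
theorem length_enc_inl {k y b : ℕ} (h : y < 2 ^ b) : (enc (k, .inl y)).length ≤ k + 2 + b := by
  have := length_bits_le h
  simp only [enc, List.length_append, List.length_replicate, List.length_cons]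
  omega

theorem length_enc_inr (k : ℕ) (m : List Bool) : (enc (k, .inr m)).length = k + 2 + m.length := by
  simp only [enc, List.length_append, List.length_replicate, List.length_cons]
  omega

end LevelEntry

/-- The potential announced for the levels from `k` on. -/
def readyAt (l : List LevelEntry) (k : ℕ) : Option ℕ :=
  l.findSome? fun e => match e.2 with
    | .inl y => if e.1 ≤ k then some y else none
    | .inr _ => none

/-- The messages of level `k`. -/
def msgsAt (l : List LevelEntry) (k : ℕ) : List (List Bool) :=
  l.filterMap fun e => match e.2 with
    | .inl _ => none
    | .inr m => if e.1 = k then some m else none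

theorem readyAt_append (l : List LevelEntry) (e : LevelEntry) (k : ℕ) :
    readyAt (l ++ [e]) k = (readyAt l k).or (readyAt [e] k) := List.findSome?_append

theorem readyAt_inl (j y k : ℕ) : readyAt [(j, .inl y)] k = if j ≤ k then some y else none := by
  simp only [readyAt, List.findSome?_cons, List.findSome?_nil]
  split_ifs <;> rfl

theorem readyAt_inr (j : ℕ) (m : List Bool) (k : ℕ) : readyAt [(j, .inr m)] k = none := rfl

theorem msgsAt_append (l : List LevelEntry) (e : LevelEntry) (k : ℕ) :
    msgsAt (l ++ [e]) k = msgsAt l k ++ msgsAt [e] k := List.filterMap_append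

theorem msgsAt_inl (j y k : ℕ) : msgsAt [(j, .inl y)] k = [] := rfl

theorem msgsAt_inr (j : ℕ) (m : List Bool) (k : ℕ) :
    msgsAt [(j, .inr m)] k = if j = k then [m] else [] := by
  simp only [msgsAt, List.filterMap_cons, List.filterMap_nil]
  split_ifs <;> rfl

/-! ### The algorithm of a node -/

/-- The state of a node that has processed the levels from `level` on: its potential and stack, and
the number of messages sent in the current level `level - 1`. -/
structure LevelState where
  li : LocalInput
  coins : ℕ → ℕ → ℕ
  level : ℕ
  pot : ℕ
  sent : ℕ
  stk : List ℕ

/-- The states of a node in an execution of `A` with given input, random numbers and messages. -/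
def MsgAlg.replay (A : MsgAlg) (li : LocalInput) (c : ℕ → ℕ) (inb : ℕ → ℕ → List Bool) : ℕ → A.State
  | 0 => A.init li
  | r + 1 => if (A.output (A.replay li c inb r)).isSome then A.replay li c inb r
      else A.step (A.replay li c inb r) (c r) (inb r)

/-- A node need not store its state in the black box: the input, the draws and the recorded messages
determine it. -/
theorem MsgAlg.replay_eq_run {A : MsgAlg} {n : ℕ} {N : Network n} {ω : Coins n (A.maxCoin n)}
    {v : Fin n} {inb : ℕ → ℕ → List Bool} {R : ℕ}
    (h : ∀ r < R, inb r = N.inbox (fun u j => A.msgOf (A.run N ω r u) (ω r u) j) v) :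
    A.replay (N.localInput v) (fun r => ω r v) inb R = A.run N ω R v := by
  induction R with
  | zero => rfl
  | succ R ih =>
    rw [MsgAlg.replay, ih fun r hr => h r (by omega), MsgAlg.run_succ, h R (by omega)]

namespace LevelState

variable (s : LevelState) (mis : MsgAlg) (f : ℕ → List LevelEntry) (k : ℕ)

/-- The neighbours in the network of level `k`. -/
def levelNbrs : Finset ℕ := s.li.nbrs.filter fun i =>
  0 < s.li.weight i - (s.pot + (readyAt (f i) (k + 1)).getD 0) ∧
    Nat.log 2 (s.li.weight i - (s.pot + (readyAt (f i) (k + 1)).getD 0)) = k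

/-- The state in the computation of the matching of level `k`. -/
def levelSim : mis.State :=
  mis.replay
    { n := s.li.n, id := s.li.id, nbrs := s.levelNbrs f k,
      weight := fun i => if i ∈ s.levelNbrs f k then 1 else 0 }
    (s.coins k)
    (fun r i => if i ∈ s.levelNbrs f k then (msgsAt (f i) k)[r]?.getD [] else []) s.sent

/-- The potential after the edge to the mate `m` has been pushed. -/
def newPot : Option ℕ → ℕ
  | none => s.pot
  | some j => s.pot + (s.li.weight j - (s.pot + (readyAt (f j) (k + 1)).getD 0))

/-- Finish level `k` with mate `m`. -/
def finish (m : Option ℕ) : LevelState × (ℕ → LevelEntry) :=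
  ({ s with level := k, pot := s.newPot f k m, sent := 0, stk := m.toList ++ s.stk },
    fun _ => (k, .inl (s.newPot f k m)))

/-- Send the next message of level `k`. -/
def sendMsg : LevelState × (ℕ → LevelEntry) :=
  ({ s with sent := s.sent + 1 }, fun j => (k, .inr (if j ∈ s.levelNbrs f k then
    mis.send (s.levelSim mis f k) (s.coins k s.sent) j else [])))

/-- The next step of a node. -/
def next : Option (LevelState × (ℕ → LevelEntry)) :=
  match s.level with
  | 0 => none
  | k + 1 =>
    if ∀ i ∈ s.li.nbrs, (readyAt (f i) (k + 1)).isSome then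
      if s.levelNbrs f k = ∅ then some (s.finish f k none)
      else if ∀ i ∈ s.levelNbrs f k,
          s.sent ≤ (msgsAt (f i) k).length ∨ (readyAt (f i) k).isSome then
        match mis.output (s.levelSim mis f k) with
        | some m => some (s.finish f k m)
        | none => some (s.sendMsg mis f k)
      else none
    else none

end LevelState

/-- Processes the levels from the top, with `mis` as a black box for the matchings. The function
`decode` extracts the random numbers for every level and round; nodes halt only if `go` holds. -/
def levelAlg (mis : MsgAlg) (maxCoin : ℕ → ℕ) (decode : ℕ → ℕ → ℕ → ℕ → ℕ) (go : ℕ → Prop) :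
    LogAlg where
  Entry := LevelEntry
  State := LevelState
  enc := LevelEntry.enc
  dec := LevelEntry.dec
  dec_enc := LevelEntry.dec_enc
  maxCoin := maxCoin
  init li c :=
    ({ li := li, coins := decode li.n c,
       level := li.nbrs.sup fun i => Nat.log 2 (li.weight i) + 1, pot := 0, sent := 0, stk := [] },
      fun _ => (li.nbrs.sup fun i => Nat.log 2 (li.weight i) + 1, .inl 0))
  next s f := s.next mis f
  done s := s.level = 0 ∧ go s.li.n

/-! ### Agreement of the local states with the matchings of the levels. -/

section LevelInvariant

variable (mis : MsgAlg) {n : ℕ} (N : Network n) (L : ℕ) (w : ℕ → Coins n (mis.maxCoin n))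

/-- The state of `v` after `r` rounds of the computation of the matching of level `k`. -/
def levelRun (k r : ℕ) (v : Fin n) : mis.State := mis.run (levelGraph mis N L w k) (w k) r v

/-- The log of `v`, as seen by `u`. -/
def logTo {E : Type} (l : List (ℕ → E)) (i : ℕ) : List E := l.map fun e => e i

/-- The possible log entries of `v` for its neighbour `u`. -/
def LevelEntryOK (v u : Fin n) (e : LevelEntry) : Prop :=
  e.1 ≤ L ∧ (e.2 = .inl (levelPot mis N L w e.1 v) ∨ e.2 = .inr [] ∨
    ∃ r, (levelGraph mis N L w e.1).graph.Adj v u ∧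
      e.2 = .inr (mis.msgOf (levelRun mis N L w e.1 r v) (w e.1 r v) (N.id u)))

/-- The state and the log of a node agree with the matchings of the levels. -/
structure LevelInv (v : Fin n) (x : LevelState × List (ℕ → LevelEntry)) : Prop where
  li : x.1.li = N.localInput v
  coins : x.1.coins = fun k r => (w k r v : ℕ)
  level_le : x.1.level ≤ L
  pot : x.1.pot = levelPot mis N L w x.1.level v
  stk : x.1.stk = levelStack mis N L w x.1.level v
  ready : ∀ u, N.graph.Adj v u → ∀ k, readyAt (logTo x.2 (N.id u)) k =
    if x.1.level ≤ k then some (levelPot mis N L w k v) else none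
  msg : ∀ u k, (levelGraph mis N L w k).graph.Adj v u → ∀ r m,
    (msgsAt (logTo x.2 (N.id u)) k)[r]? = some m →
      m = mis.msgOf (levelRun mis N L w k r v) (w k r v) (N.id u)
  halted : ∀ u k, (levelGraph mis N L w k).graph.Adj v u → x.1.level ≤ k → (mis.output
    (levelRun mis N L w k (msgsAt (logTo x.2 (N.id u)) k).length v)).isSome
  sent : ∀ u k, N.graph.Adj v u → k + 1 = x.1.level →
    (msgsAt (logTo x.2 (N.id u)) k).length = x.1.sent
  unsent : ∀ u k, N.graph.Adj v u → k + 1 < x.1.level → msgsAt (logTo x.2 (N.id u)) k = []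
  running : ∀ k, k + 1 = x.1.level → ∀ r < x.1.sent, mis.output (levelRun mis N L w k r v) = none
  entry : ∀ e ∈ x.2, ∀ u, N.graph.Adj v u → LevelEntryOK mis N L w v u (e (N.id u))

variable {mis N L w}

theorem logTo_append {E : Type} (l : List (ℕ → E)) (e : ℕ → E) (i : ℕ) :
    logTo (l ++ [e]) i = logTo l i ++ [e i] := by simp [logTo]

variable {x : Fin n → LevelState × List (ℕ → LevelEntry)} (h : ∀ v, LevelInv mis N L w v (x v))
variable {f : ℕ → List LevelEntry} {v : Fin n}
variable (hf : ∀ u, N.graph.Adj v u → f (N.id u) = logTo (x u).2 (N.id v))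

include h hf

theorem readyAt_view {u : Fin n} (hu : N.graph.Adj v u) (k : ℕ) : readyAt (f (N.id u)) k =
    if (x u).1.level ≤ k then some (levelPot mis N L w k u) else none := by
  rw [hf u hu, (h u).ready v hu.symm k]

theorem forall_ready_iff (k : ℕ) : (∀ i ∈ (x v).1.li.nbrs, (readyAt (f i) k).isSome) ↔
    ∀ u, N.graph.Adj v u → (x u).1.level ≤ k := by
  rw [(h v).li]
  constructor
  · intro h' u hu
    have := h' _ (Network.id_mem_nbrs.2 hu)
    rw [readyAt_view h hf hu] at this
    by_contra hcon
    simp [hcon] at this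
  · intro h' i hi
    obtain ⟨u, hu, rfl⟩ := Network.mem_nbrs.1 hi
    rw [readyAt_view h hf hu, if_pos (h' u hu)]
    rfl

variable {k : ℕ} (hready : ∀ u, N.graph.Adj v u → (x u).1.level ≤ k + 1)

include hready

theorem readyAt_view_getD {u : Fin n} (hu : N.graph.Adj v u) :
    (readyAt (f (N.id u)) (k + 1)).getD 0 = levelPot mis N L w (k + 1) u := by
  rw [readyAt_view h hf hu, if_pos (hready u hu)]
  rfl

variable (hk : (x v).1.level = k + 1)

include hk

theorem levelNbrs_eq :
    (x v).1.levelNbrs f k = ((levelGraph mis N L w k).localInput v).nbrs := by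
  ext i
  rw [LevelState.levelNbrs, Finset.mem_filter, (h v).li, (h v).pot, hk,
    Network.mem_nbrs, Network.mem_nbrs]
  constructor
  · rintro ⟨⟨u, hu, rfl⟩, h1, h2⟩
    rw [readyAt_view_getD h hf hready hu, Network.localInput_weight hu] at h1 h2
    exact ⟨u, ⟨hu, h1, h2⟩, rfl⟩
  · rintro ⟨u, ⟨hu, h1, h2⟩, rfl⟩
    have e : (levelGraph mis N L w k).id u = N.id u := rfl
    rw [e, readyAt_view_getD h hf hready hu, Network.localInput_weight hu]
    exact ⟨⟨u, hu, rfl⟩, h1, h2⟩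

theorem mem_levelNbrs_iff {u : Fin n} :
    N.id u ∈ (x v).1.levelNbrs f k ↔ (levelGraph mis N L w k).graph.Adj v u := by
  rw [levelNbrs_eq h hf hready hk]
  exact Network.id_mem_nbrs (N := levelGraph mis N L w k)

theorem levelNbrs_eq_empty_iff : (x v).1.levelNbrs f k = ∅ ↔
    ¬ ∃ u, (levelGraph mis N L w k).graph.Adj v u := by
  rw [levelNbrs_eq h hf hready hk, Finset.eq_empty_iff_forall_notMem]
  constructor
  · rintro h' ⟨u, hu⟩
    exact h' _ (Network.id_mem_nbrs.2 hu)
  · intro h' i hi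
    obtain ⟨u, hu, -⟩ := Network.mem_nbrs.1 hi
    exact h' ⟨u, hu⟩

theorem newPot_eq (m : Option ℕ) : (x v).1.newPot f k m =
    levelPot mis N L w (k + 1) v + N.gain (levelPot mis N L w (k + 1)) v m := by
  rcases m with _ | j
  · rw [LevelState.newPot, (h v).pot, hk]; rfl
  · rw [LevelState.newPot, (h v).pot, hk, Network.gain, (h v).li]
    by_cases hj : ∃ u, N.graph.Adj v u ∧ N.id u = j
    · obtain ⟨u, hu, rfl⟩ := hj
      rw [readyAt_view_getD h hf hready hu, Network.pull_id hu]
    · have : (N.localInput v).weight j = 0 := dif_neg hj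
      rw [this]
      simp

/-- Messages missing from the log of a neighbour are read as empty. By `hsync` a short log means
that the neighbour has finished level `k`; it has then halted in the black box and is silent, so the
reading is right. -/
theorem levelSim_eq (hsync : ∀ i ∈ (x v).1.levelNbrs f k,
      (x v).1.sent ≤ (msgsAt (f i) k).length ∨ (readyAt (f i) k).isSome) :
    (x v).1.levelSim mis f k = levelRun mis N L w k (x v).1.sent v := by
  have hli : (⟨(x v).1.li.n, (x v).1.li.id, (x v).1.levelNbrs f k,
      fun i => if i ∈ (x v).1.levelNbrs f k then 1 else 0⟩ : LocalInput) =
      (levelGraph mis N L w k).localInput v := by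
    rw [(h v).li, levelNbrs_eq h hf hready hk]
    have : ∀ li : LocalInput, li = ⟨li.n, li.id, li.nbrs, li.weight⟩ := fun _ => rfl
    rw [this ((levelGraph mis N L w k).localInput v)]
    congr 1
    funext i
    by_cases hi : i ∈ ((levelGraph mis N L w k).localInput v).nbrs
    · rw [if_pos hi]
      obtain ⟨u, hu, rfl⟩ := Network.mem_nbrs.1 hi
      rw [Network.localInput_weight hu]
      rfl
    · rw [if_neg hi]
      have : ((levelGraph mis N L w k).localInput v).weight i = 0 :=
        dif_neg fun h' => hi (Network.mem_nbrs.2 h')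
      exact this.symm
  rw [LevelState.levelSim, hli, (h v).coins]
  refine MsgAlg.replay_eq_run fun r hr => ?_
  funext i
  by_cases hi : i ∈ (x v).1.levelNbrs f k
  · rw [if_pos hi]
    have hsi := hsync i hi
    rw [levelNbrs_eq h hf hready hk] at hi
    obtain ⟨u, hu, rfl⟩ := Network.mem_nbrs.1 hi
    have e : ∀ u, (levelGraph mis N L w k).id u = N.id u := fun _ => rfl
    rw [Network.inbox_id hu, e, e]
    rw [e, readyAt_view h hf hu.1] at hsi
    rw [hf u hu.1] at hsi ⊢
    by_cases hlen : r < (msgsAt (logTo (x u).2 (N.id v)) k).length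
    · rw [List.getElem?_eq_getElem hlen, Option.getD_some]
      exact (h u).msg v k hu.symm r _ (List.getElem?_eq_getElem hlen)
    · rw [List.getElem?_eq_none (not_lt.1 hlen), Option.getD_none]
      have hlev : (x u).1.level ≤ k := by
        rcases hsi with h' | h'
        · omega
        · by_contra hcon
          simp [hcon] at h'
      have hh := (h u).halted v k hu.symm hlev
      have := MsgAlg.run_of_halted hh (not_lt.1 hlen)
      rw [MsgAlg.msgOf, this]
      exact (if_pos hh).symm
  · rw [if_neg hi]
    rw [Network.inbox_eq_pull, Network.pull_of_not]
    rw [levelNbrs_eq h hf hready hk, Network.mem_nbrs] at hi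
    exact hi

/-- A node finishes a level either because it is isolated there, without ever starting the black
box, or because the black box has halted; `hhalt` is therefore needed only in the presence of
neighbours. -/
theorem levelInv_finish {m : Option ℕ} (hm : levelMates mis N L w k v = m)
    (hhalt : (∃ u, (levelGraph mis N L w k).graph.Adj v u) →
      (mis.output (levelRun mis N L w k (x v).1.sent v)).isSome) :
    LevelInv mis N L w v
      (((x v).1.finish f k m).1, (x v).2 ++ [((x v).1.finish f k m).2]) := by
  have hkL : k < L := by have := (h v).level_le; omega
  have hpot : (x v).1.newPot f k m = levelPot mis N L w k v := by
    rw [newPot_eq h hf hready hk, levelPot_of_lt hkL, hm]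
  set e : ℕ → LevelEntry := ((x v).1.finish f k m).2 with he
  have he' : ∀ j, e j = (k, .inl ((x v).1.newPot f k m)) := fun _ => rfl
  refine ⟨(h v).li, (h v).coins, hkL.le, hpot, ?_, ?_, ?_, ?_, ?_, ?_, ?_, ?_⟩
  · show m.toList ++ (x v).1.stk = levelStack mis N L w k v
    rw [levelStack_of_lt hkL, hm, (h v).stk, hk]
  · intro u hu j
    rw [logTo_append, readyAt_append, (h v).ready u hu, hk, he', readyAt_inl, hpot]
    change _ = if k ≤ j then _ else _
    by_cases h1 : k + 1 ≤ j
    · rw [if_pos h1, if_pos (show k ≤ j by omega), Option.some_or, if_pos (by omega)]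
    · rw [if_neg h1]
      by_cases h2 : k ≤ j
      · have : j = k := by omega
        subst this
        simp
      · simp [h2]
  · intro u j hu r m' hr
    refine (h v).msg u j hu r m' ?_
    rwa [logTo_append, msgsAt_append, he', msgsAt_inl, List.append_nil] at hr
  · intro u j hu hj
    rw [logTo_append, msgsAt_append, he', msgsAt_inl, List.append_nil]
    change k ≤ j at hj
    rcases hj.eq_or_lt with rfl | hj
    · rw [(h v).sent u k hu.1 hk.symm]
      exact hhalt ⟨u, hu⟩
    · exact (h v).halted u j hu (by omega)
  · intro u j hu hj
    rw [logTo_append, msgsAt_append, he', msgsAt_inl, List.append_nil]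
    change j + 1 = k at hj
    rw [(h v).unsent u j hu (by omega)]
    rfl
  · intro u j hu hj
    rw [logTo_append, msgsAt_append, he', msgsAt_inl, List.append_nil]
    change j + 1 < k at hj
    exact (h v).unsent u j hu (by omega)
  · intro j _ r hr
    exact absurd hr (Nat.not_lt_zero r)
  · intro e₁ h₁ u hu
    rcases List.mem_append.1 h₁ with h₁ | h₁
    · exact (h v).entry e₁ h₁ u hu
    · rw [List.mem_singleton.1 h₁, he']
      exact ⟨hkL.le, Or.inl (congrArg _ hpot)⟩

theorem levelInv_sendMsg (hsync : ∀ i ∈ (x v).1.levelNbrs f k,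
      (x v).1.sent ≤ (msgsAt (f i) k).length ∨ (readyAt (f i) k).isSome)
    (hnh : mis.output (levelRun mis N L w k (x v).1.sent v) = none) :
    LevelInv mis N L w v
      (((x v).1.sendMsg mis f k).1, (x v).2 ++ [((x v).1.sendMsg mis f k).2]) := by
  have hsim := levelSim_eq h hf hready hk hsync
  set e : ℕ → LevelEntry := ((x v).1.sendMsg mis f k).2 with he
  set m : ℕ → List Bool := fun j => if j ∈ (x v).1.levelNbrs f k then
    mis.send ((x v).1.levelSim mis f k) ((x v).1.coins k (x v).1.sent) j else [] with hm
  have he' : ∀ j, e j = (k, .inr (m j)) := fun j => rfl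
  have hmsg : ∀ u, (levelGraph mis N L w k).graph.Adj v u → m (N.id u) =
      mis.msgOf (levelRun mis N L w k (x v).1.sent v) (w k (x v).1.sent v) (N.id u) := by
    intro u hu
    rw [hm]
    simp only
    rw [if_pos ((mem_levelNbrs_iff h hf hready hk).2 hu), hsim, (h v).coins, MsgAlg.msgOf, hnh]
    rfl
  refine ⟨(h v).li, (h v).coins, (h v).level_le, (h v).pot, (h v).stk, ?_, ?_, ?_, ?_, ?_, ?_, ?_⟩
  · intro u hu j
    rw [logTo_append, readyAt_append, he', readyAt_inr, Option.or_none]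
    exact (h v).ready u hu j
  · intro u j hu r m' hr
    rw [logTo_append, msgsAt_append, he', msgsAt_inr] at hr
    by_cases hjk : k = j
    · subst hjk
      rw [if_pos rfl, List.getElem?_append] at hr
      split_ifs at hr with hlt
      · exact (h v).msg u k hu r m' hr
      · rw [(h v).sent u k hu.1 hk.symm] at hr hlt
        have hr0 : r = (x v).1.sent := by
          by_contra hne
          rw [List.getElem?_eq_none (by simp; omega)] at hr
          simp at hr
        subst hr0
        simp only [Nat.sub_self, List.getElem?_cons_zero, Option.some.injEq] at hr
        rw [← hr, hmsg u hu]
    · rw [if_neg hjk, List.append_nil] at hr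
      exact (h v).msg u j hu r m' hr
  · intro u j hu hj
    change (x v).1.level ≤ j at hj
    rw [logTo_append, msgsAt_append, he', msgsAt_inr, if_neg (by omega), List.append_nil]
    exact (h v).halted u j hu hj
  · intro u j hu hj
    change j + 1 = (x v).1.level at hj
    have : k = j := by omega
    subst this
    rw [logTo_append, msgsAt_append, he', msgsAt_inr, if_pos rfl, List.length_append,
      (h v).sent u k hu hj]
    rfl
  · intro u j hu hj
    change j + 1 < (x v).1.level at hj
    rw [logTo_append, msgsAt_append, he', msgsAt_inr, if_neg (by omega), List.append_nil]
    exact (h v).unsent u j hu hj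
  · intro j hj r hr
    change j + 1 = (x v).1.level at hj
    change r < (x v).1.sent + 1 at hr
    have : k = j := by omega
    subst this
    rcases (Nat.lt_succ_iff.1 hr).eq_or_lt with rfl | hr
    · exact hnh
    · exact (h v).running k hj r hr
  · intro e' he'' u hu
    rcases List.mem_append.1 he'' with he'' | he''
    · exact (h v).entry e' he'' u hu
    · rw [List.mem_singleton.1 he'', he']
      refine ⟨?_, Or.inr ?_⟩
      · have := (h v).level_le; show k ≤ L; omega
      · by_cases hadj : (levelGraph mis N L w k).graph.Adj v u
        · exact Or.inr ⟨_, hadj, congrArg _ (hmsg u hadj)⟩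
        · left
          show Sum.inr (if _ then _ else _) = _
          rw [if_neg]
          rwa [mem_levelNbrs_iff h hf hready hk]

omit hready

/-- The possible next steps of a node. -/
theorem next_cases {s : LevelState} {e : ℕ → LevelEntry}
    (hs : (x v).1.next mis f = some (s, e)) :
    LevelInv mis N L w v (s, (x v).2 ++ [e]) ∧
      (s.level = k ∨ s.level = k + 1 ∧ s.sent = (x v).1.sent + 1) := by
  rw [LevelState.next, hk] at hs
  simp only at hs
  split_ifs at hs with h1 h2 h3
  · rw [forall_ready_iff h hf] at h1
    have h2' := (levelNbrs_eq_empty_iff h hf h1 hk).1 h2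
    have := levelInv_finish h hf h1 hk (levelMates_of_isolated h2') (fun h' => absurd h' h2')
    rw [Option.some.inj hs] at this
    refine ⟨this, Or.inl ?_⟩
    rw [← show _ = s from congrArg Prod.fst (Option.some.inj hs)]
    rfl
  · rw [forall_ready_iff h hf] at h1
    have h2' := not_not.1 (mt (levelNbrs_eq_empty_iff h hf h1 hk).2 h2)
    have hsim := levelSim_eq h hf h1 hk h3
    rw [hsim] at hs
    rcases ho : mis.output (levelRun mis N L w k (x v).1.sent v) with _ | m
    · rw [ho] at hs
      simp only at hs
      have := levelInv_sendMsg h hf h1 hk h3 ho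
      rw [Option.some.inj hs] at this
      refine ⟨this, Or.inr ?_⟩
      rw [← show _ = s from congrArg Prod.fst (Option.some.inj hs)]
      exact ⟨hk, rfl⟩
    · rw [ho] at hs
      simp only at hs
      have := levelInv_finish h hf h1 hk (levelMates_of_output h2' ho) (fun _ => by rw [ho]; rfl)
      rw [Option.some.inj hs] at this
      refine ⟨this, Or.inl ?_⟩
      rw [← show _ = s from congrArg Prod.fst (Option.some.inj hs)]
      rfl

/-- A node takes a step if no neighbour lags behind. -/
theorem next_ne_none (hready : ∀ u, N.graph.Adj v u → (x u).1.level ≤ k + 1)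
    (hsync : ∀ u, (x u).1.level = k + 1 → (x v).1.sent ≤ (x u).1.sent) :
    (x v).1.next mis f ≠ none := by
  rw [LevelState.next, hk]
  simp only
  rw [if_pos ((forall_ready_iff h hf _).2 hready)]
  split_ifs with h2 h3
  · simp
  · rcases mis.output ((x v).1.levelSim mis f k) <;> simp
  · exfalso
    apply h3
    intro i hi
    rw [levelNbrs_eq h hf hready hk] at hi
    obtain ⟨u, hu, rfl⟩ := Network.mem_nbrs.1 hi
    have e : (levelGraph mis N L w k).id u = N.id u := rfl
    rw [e, readyAt_view h hf hu.1, hf u hu.1]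
    by_cases hlev : (x u).1.level ≤ k
    · right; rw [if_pos hlev]; rfl
    · left
      have hlu : (x u).1.level = k + 1 := by have := hready u hu.1; omega
      rw [(h u).sent v k hu.1.symm hlu.symm]
      exact hsync u hlu

end LevelInvariant

/-! ### Locality of executions. -/

namespace MsgAlg

variable {A : MsgAlg} {n : ℕ} {N : Network n}

/-- The states on a union of connected components up to round `t` depend only on the numbers drawn
there before round `t`. -/
theorem run_congr {S : Set (Fin n)} (hS : ∀ v ∈ S, ∀ u, N.graph.Adj v u → u ∈ S)
    {ω ω' : Coins n (A.maxCoin n)} {t : ℕ} (h : ∀ r < t, ∀ v ∈ S, ω r v = ω' r v) :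
    ∀ v ∈ S, A.run N ω t v = A.run N ω' t v := by
  induction t with
  | zero => exact fun v _ => rfl
  | succ t ih =>
    intro v hv
    have ih' := ih fun r hr => h r (by omega)
    rw [run_succ, run_succ, ih' v hv, h t (by omega) v hv]
    have : N.inbox (fun u j => A.msgOf (A.run N ω t u) (ω t u) j) v =
        N.inbox (fun u j => A.msgOf (A.run N ω' t u) (ω' t u) j) v := by
      funext i
      by_cases hi : ∃ u, N.graph.Adj v u ∧ N.id u = i
      · obtain ⟨u, hu, rfl⟩ := hi
        rw [Network.inbox_id hu, Network.inbox_id hu, ih' u (hS v hv u hu),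
          h t (by omega) u (hS v hv u hu)]
      · rw [Network.inbox_eq_pull, Network.inbox_eq_pull, Network.pull_of_not hi,
          Network.pull_of_not hi]
    rw [this]

theorem halted_of_unwind {F : MsgAlg} {stack : F.State → List ℕ} {ω : Coins n (F.maxCoin n)}
    {t : ℕ} {out : Fin n → Option ℕ} (hout : (unwind F stack).HaltedWith N ω t out) (v : Fin n) :
    (F.output (F.run N ω t v)).isSome := by
  have h : unwindOutput F (unwindRun F stack N ω t v) = some (out v) := hout v
  rcases unwind_sim (stack := stack) (N := N) (ω := ω) t v with ⟨h1, -⟩ | ⟨-, h1⟩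
  · rw [h1] at h
    simp [unwindOutput] at h
  · exact h1

end MsgAlg

/-! ### Building stacks and unwinding them. -/

namespace LogAlg

variable (A : LogAlg) (stk : A.State → List ℕ)

/-- Build stacks of mates, then unwind them. -/
def solve : MsgAlg := MsgAlg.unwind A.toMsgAlg (implStack stk)

variable {A stk} {n : ℕ} {N : Network n} {ω : Coins n (A.maxCoin n)}
variable {st : Fin n → List (Fin n)} {R σ : Fin n → Fin n → ℕ} {Y : Fin n → ℕ} {s : ℕ}

theorem implStack_of_halted (hst : ∀ t v, A.done (A.run N (fun v => ω 0 v) t v).1 →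
      stk (A.run N (fun v => ω 0 v) t v).1 = (st v).map N.id) (t : ℕ) (v : Fin n)
    (h : (A.toMsgAlg.output (A.toMsgAlg.run N ω t v)).isSome) :
    implStack stk (A.toMsgAlg.run N ω t v) = (st v).map N.id := by
  obtain ⟨t', h1, h2⟩ := halted_imp (A := A) h
  exact (h2 stk).trans (hst t' v h1)

/-- A node that has halted has also finished building its stack. So the stacks need to be correct
only under the assumption that every node gets done, which matters since the black box guarantees
nothing before it halts. -/
theorem solve_sound {t : ℕ} {out : Fin n → Option ℕ} (hout : (A.solve stk).HaltedWith N ω t out)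
    (H : (∀ v, ∃ t, A.done (A.run N (fun v => ω 0 v) t v).1) →
      ∃ st R σ Y s, N.StarStacks st R σ Y s ∧
        (∀ v u, N.graph.Adj v u → N.weight s(v, u) ≤ Y v + Y u) ∧
        ∀ t v, A.done (A.run N (fun v => ω 0 v) t v).1 →
          stk (A.run N (fun v => ω 0 v) t v).1 = (st v).map N.id) :
    N.IsTwoApproxMatching out := by
  obtain ⟨st, R, σ, Y, s, h1, h2, h3⟩ := H fun v => by
    obtain ⟨t', h', -⟩ := halted_imp (A := A) (MsgAlg.halted_of_unwind hout v)
    exact ⟨t', h'⟩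
  exact MsgAlg.unwind_sound (h1.certificate h2) (implStack_of_halted h3) hout

theorem solve_halts {t₀ : ℕ} (hdone : ∀ v, A.done (A.run N (fun v => ω 0 v) t₀ v).1)
    (hS : N.StarStacks st R σ Y s)
    (hst : ∀ t v, A.done (A.run N (fun v => ω 0 v) t v).1 →
      stk (A.run N (fun v => ω 0 v) t v).1 = (st v).map N.id) :
    ∃ out, (A.solve stk).HaltedWith N ω (t₀ + 2 + 3 * s) out :=
  MsgAlg.unwind_halts hS.nodup hS.adj hS.symm (implStack_of_halted hst) σ s hS.step_symm
    hS.step_lt hS.sorted hS.leaf fun v => halted_of_done (hdone v)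

theorem solve_messageBound {b : ℕ}
    (h : ∀ (ω : Coins n (A.maxCoin n)) v u, N.graph.Adj v u → ∀ t,
      ∀ e ∈ (A.run N (fun v => ω 0 v) t v).2, (A.enc (e (N.id u))).length ≤ b) :
    (A.solve stk).MessageBound N (b + 2) :=
  MsgAlg.unwind_messageBound (toMsgAlg_messageBound h)

end LogAlg

/-! ### Executions of the algorithm that processes the levels. -/

section LevelExec

variable (mis : MsgAlg) (maxCoin : ℕ → ℕ) (decode : ℕ → ℕ → ℕ → ℕ → ℕ) (go : ℕ → Prop)
variable {n : ℕ} (N : Network n) (c : Fin n → ℕ)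

/-- The states and logs of the nodes. -/
def levelExec (t : ℕ) (v : Fin n) : LevelState × List (ℕ → LevelEntry) :=
  (levelAlg mis maxCoin decode go).run N c t v

variable {mis maxCoin decode go N c}

/-- At level `0` a node has no next step anyway, so being done and waiting look alike and the
halting condition drops out of the recursion. -/
theorem levelExec_succ (t : ℕ) (v : Fin n) :
    levelExec mis maxCoin decode go N c (t + 1) v =
      match (levelExec mis maxCoin decode go N c t v).1.next mis
        (N.pull (fun u => logTo (levelExec mis maxCoin decode go N c t u).2 (N.id v)) [] v) with
      | none => levelExec mis maxCoin decode go N c t v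
      | some (s, e) => (s, (levelExec mis maxCoin decode go N c t v).2 ++ [e]) := by
  by_cases hd : (levelAlg mis maxCoin decode go).done
      ((levelAlg mis maxCoin decode go).run N c t v).1
  · have h0 : (levelExec mis maxCoin decode go N c t v).1.level = 0 := hd.1
    have hn : ∀ f, (levelExec mis maxCoin decode go N c t v).1.next mis f = none := by
      intro f
      rw [LevelState.next, h0]
    rw [hn]
    exact LogAlg.run_succ_of_done hd
  · refine (LogAlg.run_succ_of_not_done hd).trans ?_
    rcases h : (levelAlg mis maxCoin decode go).next ((levelAlg mis maxCoin decode go).run N c t v).1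
        ((levelAlg mis maxCoin decode go).view N ((levelAlg mis maxCoin decode go).run N c t) v)
      with _ | ⟨s, e⟩
    · have h' : (levelExec mis maxCoin decode go N c t v).1.next mis
        (N.pull (fun u => logTo (levelExec mis maxCoin decode go N c t u).2 (N.id v)) [] v) =
          none := h
      rw [h']
      rfl
    · have h' : (levelExec mis maxCoin decode go N c t v).1.next mis
        (N.pull (fun u => logTo (levelExec mis maxCoin decode go N c t u).2 (N.id v)) [] v) =
          some (s, e) := h
      rw [h']
      rfl

variable {L : ℕ} {w : ℕ → Coins n (mis.maxCoin n)}
variable (hL : ∀ v u, N.graph.Adj v u → Nat.log 2 (N.weight s(v, u)) < L)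
variable (hw : ∀ k r v, decode n (c v) k r = w k r v)

include hL hw

theorem levelInv_zero (v : Fin n) :
    LevelInv mis N L w v (levelExec mis maxCoin decode go N c 0 v) := by
  set k₀ := (N.localInput v).nbrs.sup fun i => Nat.log 2 ((N.localInput v).weight i) + 1 with hk₀
  have hk : ∀ u, N.graph.Adj v u → Nat.log 2 (N.weight s(v, u)) < k₀ := by
    intro u hu
    have := Finset.le_sup (f := fun i => Nat.log 2 ((N.localInput v).weight i) + 1)
      (Network.id_mem_nbrs.2 hu)
    simp only [Network.localInput_weight hu] at this
    exact this
  have hkL : k₀ ≤ L := by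
    refine Finset.sup_le fun i hi => ?_
    obtain ⟨u, hu, rfl⟩ := Network.mem_nbrs.1 hi
    rw [Network.localInput_weight hu]
    exact hL v u hu
  have hk' : ∀ j, k₀ ≤ j → ∀ u, N.graph.Adj v u → Nat.log 2 (N.weight s(v, u)) < j :=
    fun j hj u hu => (hk u hu).trans_le hj
  have hx : levelExec mis maxCoin decode go N c 0 v = (⟨N.localInput v, decode n (c v), k₀, 0, 0, []⟩,
      [fun _ => (k₀, .inl 0)]) := rfl
  have hlog : ∀ i, logTo (levelExec mis maxCoin decode go N c 0 v).2 i = [(k₀, .inl 0)] :=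
    fun _ => rfl
  constructor
  · rw [hx]
  · rw [hx]; funext k r; exact hw k r v
  · rw [hx]; exact hkL
  · rw [hx]; exact (levelPot_eq_zero hk).1.symm
  · rw [hx]; exact (levelPot_eq_zero hk).2.symm
  · intro u hu k
    rw [hlog, readyAt_inl, hx]
    show _ = if k₀ ≤ k then _ else _
    by_cases h : k₀ ≤ k
    · rw [if_pos h, if_pos h, (levelPot_eq_zero (hk' k h)).1]
    · rw [if_neg h, if_neg h]
  · intro u k _ r m hr
    rw [hlog, msgsAt_inl] at hr
    simp at hr
  · intro u k hu hlev
    rw [hx] at hlev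
    exact absurd ⟨u, hu⟩ (levelGraph_isolated (hk' k hlev))
  · intro u k _ _
    rw [hlog, msgsAt_inl, hx]; rfl
  · intro u k _ _
    rw [hlog, msgsAt_inl]
  · intro k _ r hr
    rw [hx] at hr
    exact absurd hr (Nat.not_lt_zero r)
  · intro e he u _
    rw [hx, List.mem_singleton] at he
    rw [he]
    exact ⟨hkL, Or.inl (congrArg _ (levelPot_eq_zero hk).1.symm)⟩

theorem levelInv (t : ℕ) (v : Fin n) :
    LevelInv mis N L w v (levelExec mis maxCoin decode go N c t v) := by
  induction t generalizing v with
  | zero => exact levelInv_zero hL hw v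
  | succ t ih =>
    rw [levelExec_succ]
    rcases hn : (levelExec mis maxCoin decode go N c t v).1.next mis (N.pull
      (fun u => logTo (levelExec mis maxCoin decode go N c t u).2 (N.id v)) [] v) with _ | ⟨s, e⟩
    · exact ih v
    · rcases hk : (levelExec mis maxCoin decode go N c t v).1.level with _ | k
      · rw [LevelState.next, hk] at hn
        simp at hn
      · exact (next_cases ih (fun u hu => Network.pull_id hu) hk hn).1

theorem level_succ_le (t : ℕ) (v : Fin n) :
    (levelExec mis maxCoin decode go N c (t + 1) v).1.level ≤
      (levelExec mis maxCoin decode go N c t v).1.level := by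
  rw [levelExec_succ]
  rcases hn : (levelExec mis maxCoin decode go N c t v).1.next mis (N.pull
    (fun u => logTo (levelExec mis maxCoin decode go N c t u).2 (N.id v)) [] v) with _ | ⟨s, e⟩
  · exact le_rfl
  · rcases hk : (levelExec mis maxCoin decode go N c t v).1.level with _ | k
    · rw [LevelState.next, hk] at hn
      simp at hn
    · have := (next_cases (levelInv hL hw t) (fun u hu => Network.pull_id hu) hk hn).2
      simp only
      omega

/-- Progress within a level. -/
theorem level_progress {t k : ℕ}
    (h : ∀ v, (levelExec mis maxCoin decode go N c t v).1.level ≤ k + 1) (a : ℕ) (v : Fin n) :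
    (levelExec mis maxCoin decode go N c (t + a) v).1.level ≤ k ∨
      (levelExec mis maxCoin decode go N c (t + a) v).1.level = k + 1 ∧
        a ≤ (levelExec mis maxCoin decode go N c (t + a) v).1.sent := by
  induction a generalizing v with
  | zero =>
    have := h v
    rw [Nat.add_zero]
    omega
  | succ a ih =>
    have hle := level_succ_le hL hw (go := go) (maxCoin := maxCoin) (t + a) v
    rw [← Nat.add_assoc]
    rcases ih v with h1 | ⟨h1, h2⟩
    · left; omega
    · rw [levelExec_succ]
      rcases hn : (levelExec mis maxCoin decode go N c (t + a) v).1.next mis (N.pull (fun u =>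
          logTo (levelExec mis maxCoin decode go N c (t + a) u).2 (N.id v)) [] v) with _ | ⟨s, e⟩
      · right
        refine ⟨h1, ?_⟩
        by_contra hcon
        change ¬ a + 1 ≤ (levelExec mis maxCoin decode go N c (t + a) v).1.sent at hcon
        refine next_ne_none (levelInv hL hw (t + a)) (fun u hu => Network.pull_id hu) h1 ?_ ?_ hn
        · intro u _
          rcases ih u with h3 | h3 <;> omega
        · intro u hu
          rcases ih u with h3 | h3 <;> omega
      · have := (next_cases (levelInv hL hw (t + a)) (fun u hu => Network.pull_id hu) h1 hn).2
        simp only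
        omega

/-- If `mis` halts in every level within `T` rounds, a level takes at most `T + 1` rounds. -/
theorem level_le {T : ℕ}
    (hT : ∀ k < L, ∀ v, (mis.output (levelRun mis N L w k T v)).isSome) {d : ℕ} (hd : d ≤ L)
    (v : Fin n) : (levelExec mis maxCoin decode go N c (d * (T + 1)) v).1.level ≤ L - d := by
  induction d generalizing v with
  | zero => exact (levelInv hL hw _ v).level_le
  | succ d ih =>
    have h := level_progress hL hw (go := go) (maxCoin := maxCoin) (t := d * (T + 1))
      (k := L - (d + 1)) (fun v => (ih (by omega) v).trans (by omega)) (T + 1) v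
    rw [Nat.succ_mul]
    rcases h with h | ⟨h1, h2⟩
    · exact h
    · exfalso
      have h3 := (levelInv hL hw _ v).running _ h1.symm T (by omega)
      have h4 := hT (L - (d + 1)) (by omega) v
      rw [h3] at h4
      simp at h4

omit hL hw in
/-- If all nodes that take part in a level halt, the outputs are correct, as the other nodes could
halt as well. -/
theorem levelsCorrect
    (hsound : ∀ k < L, ∀ ω t out, mis.HaltedWith (levelGraph mis N L w k) ω t out →
      (levelGraph mis N L w k).IsLineGraphMIS out)
    (hex : ∀ k < L, ∃ ω t out, mis.HaltedWith (levelGraph mis N L w k) ω t out)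
    (hh : ∀ k < L, ∀ v, (∃ u, (levelGraph mis N L w k).graph.Adj v u) →
      ∃ t, (mis.output (levelRun mis N L w k t v)).isSome) :
    LevelsCorrect mis N L w := by
  classical
  intro k hk
  set H := levelGraph mis N L w k with hH
  obtain ⟨ω', t', out', h'⟩ := hex k hk
  have hh' : ∀ v, ∃ t, (∃ u, H.graph.Adj v u) → (mis.output (levelRun mis N L w k t v)).isSome := by
    intro v
    by_cases hv : ∃ u, H.graph.Adj v u
    · obtain ⟨t, ht⟩ := hh k hk v hv
      exact ⟨t, fun _ => ht⟩
    · exact ⟨0, fun h => absurd h hv⟩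
  choose τ hτ using hh'
  let t := t' + ∑ v, τ v
  -- Isolated nodes never run the black box, so nothing is known about their halting under the
  -- actual draws. They are given the draws of some execution in which everybody halts. They do not
  -- communicate with the others, so this yields an execution in which all nodes halt, and its
  -- correctness carries over to the participants.
  let ω : Coins n (mis.maxCoin n) := fun r v => if ∃ u, H.graph.Adj v u then w k r v else ω' r v
  have h1 : ∀ v, (∃ u, H.graph.Adj v u) → mis.run H ω t v = levelRun mis N L w k t v := by
    intro v hv
    refine MsgAlg.run_congr (S := {v | ∃ u, H.graph.Adj v u}) ?_ ?_ v hv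
    · exact fun v _ u hu => ⟨v, hu.symm⟩
    · exact fun r _ v hv => if_pos hv
  have h2 : ∀ v, (¬ ∃ u, H.graph.Adj v u) → mis.run H ω t v = mis.run H ω' t v := by
    intro v hv
    refine MsgAlg.run_congr (S := {v | ¬ ∃ u, H.graph.Adj v u}) ?_ ?_ v hv
    · exact fun v hv u hu => absurd ⟨u, hu⟩ hv
    · exact fun r _ v hv => if_neg hv
  have h3 : ∀ v, (mis.output (mis.run H ω t v)).isSome := by
    intro v
    by_cases hv : ∃ u, H.graph.Adj v u
    · rw [h1 v hv]
      have hle : τ v ≤ t :=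
        (Finset.single_le_sum (fun _ _ => Nat.zero_le _) (Finset.mem_univ v)).trans
          (Nat.le_add_left _ _)
      have e : levelRun mis N L w k t v = levelRun mis N L w k (τ v) v :=
        MsgAlg.run_of_halted (hτ v hv) hle
      rw [e]
      exact hτ v hv
    · have h4 : (mis.output (mis.run H ω' t' v)).isSome := by rw [h' v]; rfl
      rw [h2 v hv, MsgAlg.run_of_halted h4 (Nat.le_add_right _ _)]
      exact h4
  choose out hout using fun v => Option.isSome_iff_exists.1 (h3 v)
  obtain ⟨hc, hm⟩ := Network.isLineGraphMIS_iff.1 (hsound k hk ω t out hout)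
  have heq : levelMates mis N L w k = out := by
    funext v
    by_cases hv : ∃ u, H.graph.Adj v u
    · refine levelMates_of_output (t := t) hv ?_
      rw [← hout v, h1 v hv]
      rfl
    · rw [levelMates_of_isolated hv]
      rcases ho : out v with _ | i
      · rfl
      · obtain ⟨u, hu, -⟩ := hc v i ho
        exact absurd ⟨u, hu⟩ hv
  rw [heq]
  exact ⟨hc, hm⟩

theorem levelExec_stk {t : ℕ} {v : Fin n}
    (h : (levelExec mis maxCoin decode go N c t v).1.level = 0) :
    (levelExec mis maxCoin decode go N c t v).1.stk = levelStack mis N L w 0 v := by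
  rw [(levelInv hL hw t v).stk, h]

theorem exists_halted_of_level_eq_zero {t : ℕ} {v : Fin n}
    (h : (levelExec mis maxCoin decode go N c t v).1.level = 0) {k : ℕ}
    (hv : ∃ u, (levelGraph mis N L w k).graph.Adj v u) :
    ∃ t, (mis.output (levelRun mis N L w k t v)).isSome := by
  obtain ⟨u, hu⟩ := hv
  exact ⟨_, (levelInv hL hw t v).halted u k hu (by rw [h]; exact Nat.zero_le k)⟩

omit hw in
/-- The stacks built from correct matchings. -/
theorem exists_starStacks_cover (hmis : LevelsCorrect mis N L w) :
    ∃ st R σ Y, N.StarStacks st R σ Y L ∧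
      (∀ v u, N.graph.Adj v u → N.weight s(v, u) ≤ Y v + Y u) ∧
      ∀ v, levelStack mis N L w 0 v = (st v).map N.id := by
  obtain ⟨st, R, σ, h1, h2⟩ := exists_starStacks hmis le_rfl
  rw [Nat.sub_self] at h1 h2
  refine ⟨st, R, σ, _, h1, fun v u hvu => ?_, h2⟩
  have := residual_lt hL hmis le_rfl hvu
  rw [Nat.sub_self] at this
  omega

end LevelExec

/-! ### Counting -/

section Counting

variable {Ω Z : Type*} [Fintype Ω] [Fintype Z]

/-- If the component `get w` of a uniformly random `w` can be replaced by `set`, it suffices to bound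
the probability of an event conditioned on the rest of `w`. -/
theorem card_filter_le_of_lens [Nonempty Z] {get : Ω → Z} {set : Ω → Z → Ω}
    (get_set : ∀ w z, get (set w z) = z) (set_get : ∀ w z, set (set w z) (get w) = w)
    {B : Ω → Prop} [DecidablePred B] {q : ℝ}
    (h : ∀ w, (Finset.card {z | B (set w z)} : ℝ) ≤ q * Fintype.card Z) :
    (Finset.card {w | B w} : ℝ) ≤ q * Fintype.card Ω := by
  -- The map `(w, z) ↦ (set w z, get w)` is an involution of `Ω × Z`: replacing a uniform component
  -- by an independent uniform value changes no count.
  have e1 : Finset.card {x : Ω × Z | B (set x.1 x.2)} = Finset.card {x : Ω × Z | B x.1} := by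
    refine Finset.card_bij' (fun x _ => (set x.1 x.2, get x.1)) (fun x _ => (set x.1 x.2, get x.1))
      ?_ ?_ ?_ ?_
    · intro x hx
      simpa using hx
    · intro x hx
      simpa [set_get] using hx
    · intro x _
      simp [get_set, set_get]
    · intro x _
      simp [get_set, set_get]
  have e2 : Finset.card {x : Ω × Z | B x.1} = Finset.card {w | B w} * Fintype.card Z := by
    rw [← Finset.card_univ, ← Finset.card_product]
    congr 1
    ext x
    simp
  have e3 : Finset.card {x : Ω × Z | B (set x.1 x.2)} = ∑ w, Finset.card {z | B (set w z)} := by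
    rw [← Finset.card_sigma]
    refine Finset.card_bij' (fun x _ => ⟨x.1, x.2⟩) (fun x _ => (x.1, x.2)) ?_ ?_ ?_ ?_ <;> simp
  have hZ : (0 : ℝ) < Fintype.card Z := by exact_mod_cast Fintype.card_pos
  refine le_of_mul_le_mul_right ?_ hZ
  calc (Finset.card {w | B w} : ℝ) * Fintype.card Z
      = ∑ w, (Finset.card {z | B (set w z)} : ℝ) := by
        rw [← Nat.cast_mul, ← e2, ← e1, e3, Nat.cast_sum]
    _ ≤ ∑ _w : Ω, q * Fintype.card Z := Finset.sum_le_sum fun w _ => h w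
    _ = q * Fintype.card Ω * Fintype.card Z := by
        rw [Finset.sum_const, Finset.card_univ, nsmul_eq_mul]; ring

end Counting

/-! ### Probabilities of events determined by finitely many rounds. -/

section CoinProb

variable {n m T : ℕ} {E : Coins n m → Prop} {p : ℝ}

open Classical in
theorem le_coinProb_iff : 1 - p ≤ coinProb n m T E ↔
    (Finset.card {ω : Fin T → Fin n → Fin (m + 1) | ¬ E (extendCoins ω)} : ℝ) ≤
      p * Fintype.card (Fin T → Fin n → Fin (m + 1)) := by
  have hc : (0 : ℝ) < Fintype.card (Fin T → Fin n → Fin (m + 1)) := by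
    exact_mod_cast Fintype.card_pos
  have h := Finset.card_filter_add_card_filter_not (s := Finset.univ)
    (fun ω : Fin T → Fin n → Fin (m + 1) => E (extendCoins ω))
  rw [Finset.card_univ] at h
  have h' : (Finset.card {ω : Fin T → Fin n → Fin (m + 1) | E (extendCoins ω)} : ℝ) +
    Finset.card {ω : Fin T → Fin n → Fin (m + 1) | ¬ E (extendCoins ω)} =
      Fintype.card (Fin T → Fin n → Fin (m + 1)) := by exact_mod_cast h
  rw [coinProb, le_div_iff₀ hc, ← h']
  constructor <;> intro h <;> linarith

theorem coinProb_nonneg : 0 ≤ coinProb n m T E := by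
  unfold coinProb; positivity

theorem exists_of_coinProb_pos (h : 0 < coinProb n m T E) : ∃ ω, E ω := by
  classical
  by_contra! hcon
  rw [coinProb, Finset.filter_false_of_mem fun ω _ => hcon _] at h
  simp at h

theorem extendCoins_apply (ω : Fin T → Fin n → Fin (m + 1)) {t : ℕ} (ht : t < T) :
    extendCoins ω t = ω ⟨t, ht⟩ := by
  funext v
  exact dif_pos ht

/-- An event that is likely for every choice of the draws that `set` does not change is likely. -/
theorem le_coinProb_of_lens {n' m' T' : ℕ} {E' : Coins n' m' → Prop}
    {get : (Fin T → Fin n → Fin (m + 1)) → Fin T' → Fin n' → Fin (m' + 1)}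
    {set : (Fin T → Fin n → Fin (m + 1)) → (Fin T' → Fin n' → Fin (m' + 1)) →
      Fin T → Fin n → Fin (m + 1)}
    (get_set : ∀ w z, get (set w z) = z) (set_get : ∀ w z, set (set w z) (get w) = w)
    (hE : ∀ w z, E' (extendCoins z) → E (extendCoins (set w z)))
    (h : 1 - p ≤ coinProb n' m' T' E') : 1 - p ≤ coinProb n m T E := by
  classical
  rw [le_coinProb_iff] at h ⊢
  refine card_filter_le_of_lens (B := fun ω => ¬ E (extendCoins ω)) get_set set_get fun w => ?_
  refine le_trans (Nat.cast_le.2 (Finset.card_le_card fun z hz => ?_)) h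
  rw [Finset.mem_filter] at hz ⊢
  exact ⟨Finset.mem_univ _, fun hz' => hz.2 (hE w z hz')⟩

/-- More rounds can be considered than an event depends on. -/
theorem le_coinProb_of_le {T' : ℕ} {E' : Coins n m → Prop} (hT : T ≤ T')
    (hE : ∀ ω ω' : Coins n m, (∀ r < T, ω r = ω' r) → E ω → E' ω')
    (h : 1 - p ≤ coinProb n m T E) : 1 - p ≤ coinProb n m T' E' := by
  let set : (Fin T' → Fin n → Fin (m + 1)) → (Fin T → Fin n → Fin (m + 1)) →
      Fin T' → Fin n → Fin (m + 1) := fun w z t => if ht : t.1 < T then z ⟨t, ht⟩ else w t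
  refine le_coinProb_of_lens (get := fun w t => w (t.castLE hT)) (set := set) ?_ ?_ ?_ h
  · intro w z
    funext t
    exact dif_pos t.2
  · intro w z
    funext t
    by_cases ht : t.1 < T
    · exact dif_pos ht
    · exact (dif_neg ht).trans (dif_neg ht)
  · intro w z
    refine hE _ _ fun r hr => ?_
    rw [extendCoins_apply _ hr, extendCoins_apply _ (hr.trans_le hT)]
    simp only [set, hr, dif_pos]

end CoinProb

namespace MsgAlg

variable {A : MsgAlg} {n : ℕ} {N : Network n}

theorem HaltedWith.mono {ω : Coins n (A.maxCoin n)} {t t' : ℕ} {out : Fin n → Option ℕ}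
    (h : A.HaltedWith N ω t out) (ht : t ≤ t') : A.HaltedWith N ω t' out := by
  intro v
  rw [run_of_halted (by rw [h v]; rfl) ht, h v]

theorem HaltedWith.congr {ω ω' : Coins n (A.maxCoin n)} {t : ℕ} {out : Fin n → Option ℕ}
    (h : A.HaltedWith N ω t out) (hω : ∀ r < t, ω r = ω' r) : A.HaltedWith N ω' t out := by
  intro v
  rw [← h v, run_congr (S := Set.univ) (ω := ω) (ω' := ω') (fun _ _ _ _ => Set.mem_univ _)
    (fun r hr v _ => congrFun (hω r hr) v) v (Set.mem_univ v)]

theorem Computes.mono {P : (Fin n → Option ℕ) → Prop} {T T' : ℕ} {p : ℝ} (h : A.Computes N P T p)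
    (hT : T ≤ T') : A.Computes N P T' p :=
  ⟨h.1, le_coinProb_of_le hT
    (fun _ _ hω ⟨out, ho⟩ => ⟨out, (ho.congr hω).mono hT⟩) h.2⟩

theorem Computes.exists_halted {P : (Fin n → Option ℕ) → Prop} {T : ℕ} {p : ℝ}
    (h : A.Computes N P T p) (hp : p < 1) : ∃ ω t out, A.HaltedWith N ω t out := by
  obtain ⟨ω, out, ho⟩ := exists_of_coinProb_pos ((sub_pos.2 hp).trans_le h.2)
  exact ⟨ω, T, out, ho⟩

end MsgAlg

/-! ### One random number for all levels and rounds -/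

section Draws

/-- The random numbers that a node needs for `K` levels with `R` rounds each. -/
abbrev LevelDraws (M K R : ℕ) : Type := Fin K → Fin R → Fin (M + 1)

/-- The largest number that encodes an element of `LevelDraws M K R`. -/
def drawBound (M K R : ℕ) : ℕ := Fintype.card (LevelDraws M K R) - 1

/-- Encoding of `LevelDraws` by numbers. -/
def levelDrawsEquiv (M K R : ℕ) :
    Fin (drawBound M K R + 1) ≃ LevelDraws M K R :=
  (finCongr (Nat.sub_add_cancel Fintype.card_pos)).trans (Fintype.equivFin _).symm

variable (M K R : ℕ)

/-- The random numbers for all levels and rounds, if `d` is what a node draws. -/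
def levelCoins {n : ℕ} (d : Fin n → Fin (drawBound M K R + 1)) (k : ℕ) :
    Coins n M :=
  fun r v => if h : k < K ∧ r < R then levelDrawsEquiv M K R (d v) ⟨k, h.1⟩ ⟨r, h.2⟩ else 0

/-- Extraction of a random number from what a node draws. -/
def decodeDraw (c k r : ℕ) : ℕ :=
  if h : c < drawBound M K R + 1 then
    (levelCoins M K R (n := 1) (fun _ => ⟨c, h⟩) k r 0 : ℕ) else 0

variable {M K R}

theorem decodeDraw_eq {n : ℕ} (d : Fin n → Fin (drawBound M K R + 1))
    (k r : ℕ) (v : Fin n) : decodeDraw M K R (d v) k r = levelCoins M K R d k r v :=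
  dif_pos (d v).2

open Classical in
/-- Changing what the nodes draw for level `k`. -/
def setLevelCoins {n : ℕ} (d : Fin n → Fin (drawBound M K R + 1)) (k : Fin K)
    (z : Fin R → Fin n → Fin (M + 1)) : Fin n → Fin (drawBound M K R + 1) :=
  fun v => (levelDrawsEquiv M K R).symm
    (Function.update (levelDrawsEquiv M K R (d v)) k fun r => z r v)

theorem levelCoins_set_self {n : ℕ} (d : Fin n → Fin (drawBound M K R + 1))
    (k : Fin K) (z : Fin R → Fin n → Fin (M + 1)) :
    levelCoins M K R (setLevelCoins d k z) k = extendCoins z := by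
  funext r v
  by_cases hr : r < R
  · simp [levelCoins, extendCoins, setLevelCoins, hr]
  · simp [levelCoins, extendCoins, hr]

theorem levelCoins_set_of_ne {n : ℕ} (d : Fin n → Fin (drawBound M K R + 1))
    (k : Fin K) (z : Fin R → Fin n → Fin (M + 1)) {j : ℕ} (hj : j ≠ k) :
    levelCoins M K R (setLevelCoins d k z) j = levelCoins M K R d j := by
  funext r v
  by_cases h : j < K ∧ r < R
  · have : (⟨j, h.1⟩ : Fin K) ≠ k := fun e => hj (congrArg Fin.val e)
    simp [levelCoins, setLevelCoins, h, Function.update_of_ne this]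
  · simp [levelCoins, h]

/-- An event that is unlikely for every choice of the draws for other levels is unlikely. -/
theorem card_filter_levelCoins_le {n T : ℕ} (k : Fin K)
    {B : (Fin n → Fin (drawBound M K R + 1)) → Prop} [DecidablePred B] {q : ℝ}
    (h : ∀ d, (Finset.card {z | B (setLevelCoins d k z)} : ℝ) ≤
      q * Fintype.card (Fin R → Fin n → Fin (M + 1))) :
    (Finset.card {ω : Fin (T + 1) → Fin n → Fin (drawBound M K R + 1) |
      B (ω 0)} : ℝ) ≤ q * Fintype.card (Fin (T + 1) → Fin n →
        Fin (drawBound M K R + 1)) := by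
  refine card_filter_le_of_lens (Z := Fin R → Fin n → Fin (M + 1))
    (get := fun w r v => levelDrawsEquiv M K R (w 0 v) k r)
    (set := fun w z => Function.update w 0 (setLevelCoins (w 0) k z)) ?_ ?_ fun w => ?_
  · intro w z
    funext r v
    simp [setLevelCoins]
  · intro w z
    simp only [Function.update_idem, Function.update_self]
    have : setLevelCoins (setLevelCoins (w 0) k z) k
        (fun r v => levelDrawsEquiv M K R (w 0 v) k r) = w 0 := by
      funext v
      simp [setLevelCoins]
    rw [this, Function.update_eq_self]
  · simpa using h (w 0)

end Draws

theorem Network.localInput_weight_le {n : ℕ} {N : Network n} {W : ℕ} (hW : N.WeightBound W)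
    (v : Fin n) (j : ℕ) : (N.localInput v).weight j ≤ W := by
  by_cases hj : ∃ u, N.graph.Adj v u ∧ N.id u = j
  · obtain ⟨u, hu, rfl⟩ := hj
    rw [localInput_weight hu]
    exact (hW _ hu).2
  · have : (N.localInput v).weight j = 0 := dif_neg hj
    omega

section Bounds

variable {mis : MsgAlg} {n : ℕ} {N : Network n} {L : ℕ} {w w' : ℕ → Coins n (mis.maxCoin n)}

theorem levelPot_congr {k : ℕ} (h : ∀ j ≥ k, w j = w' j) :
    levelPot mis N L w k = levelPot mis N L w' k := by
  by_cases hk : k < L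
  · funext v
    rw [levelPot_of_lt hk, levelPot_of_lt hk, levelMates, levelMates, h k le_rfl,
      levelPot_congr (k := k + 1) fun j hj => h j (by omega)]
  · funext v
    rw [levelPot_of_le (by omega), levelPot_of_le (by omega)]
termination_by L - k

/-- Levels are processed downwards, so the graph of level `k` is fixed before its own draws are
used. This independence is what allows the guarantee of the black box to be applied to a random
graph. -/
theorem levelGraph_congr {k : ℕ} (h : ∀ j > k, w j = w' j) :
    levelGraph mis N L w k = levelGraph mis N L w' k := by
  rw [levelGraph, levelGraph, levelPot_congr h]

/-- A positive gain `w - (Y v + Y u)` lifts the potential of `v` to at most `w`, so potentials do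
not accumulate beyond `W` over the levels. -/
theorem levelPot_le {W : ℕ} (hW : N.WeightBound W) (k : ℕ) (v : Fin n) :
    levelPot mis N L w k v ≤ W := by
  by_cases hk : k < L
  · have ih := levelPot_le hW (k + 1) v
    rw [levelPot_of_lt hk]
    rcases levelMates mis N L w k v with _ | j
    · exact ih
    · have := Network.localInput_weight_le hW v j
      rw [Network.gain]
      omega
  · rw [levelPot_of_le (by omega)]
    exact Nat.zero_le _
termination_by L - k

end Bounds

theorem pow_le_two_pow (n κ : ℕ) : n ^ κ ≤ 2 ^ (κ * (Nat.log 2 n + 1)) := by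
  rw [mul_comm, pow_mul]
  exact Nat.pow_le_pow_left (Nat.lt_pow_succ_log_self Nat.one_lt_two n).le κ

theorem log_pow_le (n κ : ℕ) : Nat.log 2 (n ^ κ) ≤ κ * (Nat.log 2 n + 1) :=
  (Nat.log_mono_right (pow_le_two_pow n κ)).trans (Nat.log_pow Nat.one_lt_two _).le

theorem Network.maxDegree_le {n : ℕ} (N : Network n) : N.maxDegree ≤ n := by
  classical
  refine SimpleGraph.maxDegree_le_of_forall_degree_le _ _ fun v => ?_
  exact (SimpleGraph.degree_lt_card_verts v).le.trans (Fintype.card_fin n).le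

/-! ### The randomized algorithm with a black box for the line graph. -/

section

variable (κ : ℕ) (mis : MsgAlg) (T : ℕ → ℕ → ℕ) (p : ℕ → ℝ)

/-- The level-wise construction of stacks, with `mis` used for at most `log₂ (n ^ κ) + 1` levels and
`T n n` rounds per level. -/
def stackAlg : LogAlg :=
  levelAlg mis
    (fun n => drawBound (mis.maxCoin n) (Nat.log 2 (n ^ κ) + 1) (T n n))
    (fun n => decodeDraw (mis.maxCoin n) (Nat.log 2 (n ^ κ) + 1) (T n n)) (fun n => p n < 1)

variable {κ mis T p} {n : ℕ} {N : Network n} {W : ℕ}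

/-- The random numbers for the levels. -/
abbrev stackCoins (κ : ℕ) (mis : MsgAlg) (T : ℕ → ℕ → ℕ) (p : ℕ → ℝ)
    (d : Fin n → Fin ((stackAlg κ mis T p).maxCoin n + 1)) : ℕ → Coins n (mis.maxCoin n) :=
  levelCoins (mis.maxCoin n) (Nat.log 2 (n ^ κ) + 1) (T n n) d

theorem log_weight_lt (hW : N.WeightBound W) (v u : Fin n) (hvu : N.graph.Adj v u) :
    Nat.log 2 (N.weight s(v, u)) < Nat.log 2 W + 1 :=
  Nat.lt_succ_of_le (Nat.log_mono_right (hW _ hvu).2)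

/-- The term `2 * κ` pays for the unary level and for the potential, `B` for a message of the black
box, and the rest for separators and for the tag bits added by the two wrappers. -/
theorem stackAlg_messageBound {B : ℕ}
    (hmis : ∀ H : Network n, H.IdBound κ → H.WeightBound 1 → mis.MessageBound H (logBits B n))
    (hid : N.IdBound κ) (hW : N.WeightBound W) (hWn : W ≤ n ^ κ) :
    ((stackAlg κ mis T p).solve LevelState.stk).MessageBound N
      (logBits (2 * κ + B + 6) n) := by
  have key : ∀ (ω : Coins n ((stackAlg κ mis T p).maxCoin n)) v u, N.graph.Adj v u → ∀ t,
      ∀ e ∈ ((stackAlg κ mis T p).run N (fun v => ω 0 v) t v).2,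
        ((stackAlg κ mis T p).enc (e (N.id u))).length ≤ logBits (2 * κ + B + 4) n := by
    intro ω v u hvu t e he
    have hinv := levelInv (mis := mis) (N := N) (L := Nat.log 2 W + 1)
      (w := stackCoins κ mis T p (ω 0)) (c := fun v => ω 0 v)
      (maxCoin := (stackAlg κ mis T p).maxCoin)
      (decode := fun n => decodeDraw (mis.maxCoin n) (Nat.log 2 (n ^ κ) + 1) (T n n))
      (go := fun n => p n < 1) (log_weight_lt hW) (fun k r v => decodeDraw_eq (ω 0) k r v) t v
    obtain ⟨h1, h2⟩ := hinv.entry e he u hvu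
    show (LevelEntry.enc (e (N.id u))).length ≤ _
    have hl := log_pow_le n κ
    have hlog := Nat.log_mono_right (b := 2) hWn
    generalize e (N.id u) = y at h1 h2 ⊢
    obtain ⟨k, x⟩ := y
    change k ≤ _ at h1
    set ℓ := Nat.log 2 n + 1 with hℓ
    have hb : logBits (2 * κ + B + 4) n = 2 * (κ * ℓ) + B * ℓ + 4 * ℓ := by
      rw [logBits]; ring
    have hB : logBits B n = B * ℓ := rfl
    rcases h2 with h2 | h2 | ⟨r, hadj, h2⟩
    · change x = _ at h2
      have hy := (levelPot_le (mis := mis) (L := Nat.log 2 W + 1)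
        (w := stackCoins κ mis T p (ω 0)) hW k v).trans hWn
      have := LevelEntry.length_enc_inl (k := k)
        (hy.trans_lt (Nat.lt_pow_succ_log_self Nat.one_lt_two (n ^ κ)))
      rw [h2, hb]
      refine this.trans ?_
      omega
    · change x = _ at h2
      rw [h2, LevelEntry.length_enc_inr, hb]
      simp only [List.length_nil]
      omega
    · change x = _ at h2
      have := hmis (levelGraph mis N _ (stackCoins κ mis T p (ω 0)) k)
        (Network.levelNet_idBound hid _ _) (Network.levelNet_weightBound _ _)
        (stackCoins κ mis T p (ω 0) k) r v u hadj
      rw [h2, LevelEntry.length_enc_inr, hb]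
      rw [hB] at this
      refine (Nat.add_le_add_left this _).trans ?_
      omega
  intro ω t v u hvu
  refine (LogAlg.solve_messageBound key ω t v u hvu).trans ?_
  rw [logBits, logBits, show 2 * κ + B + 6 = 2 * κ + B + 4 + 2 by ring, add_mul _ 2]
  omega

/-- Nodes get done only if `p n < 1`, so whenever a node is done, the black box has a halting
execution on every network of a level. This is the existence that `levelsCorrect` requires for the
isolated nodes; the network without nodes is treated apart. -/
theorem stackAlg_sound (hp : ∀ H : Network n, H.IdBound κ → H.WeightBound 1 →
      mis.Computes H H.IsLineGraphMIS (T n H.maxDegree) (p n))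
    (hid : N.IdBound κ) (hW : N.WeightBound W) {ω : Coins n ((stackAlg κ mis T p).maxCoin n)}
    {t : ℕ} {out : Fin n → Option ℕ}
    (hout : ((stackAlg κ mis T p).solve LevelState.stk).HaltedWith N ω t out) :
    N.IsTwoApproxMatching out := by
  have hcomp : ∀ k, _ := fun k => hp (levelGraph mis N (Nat.log 2 W + 1)
    (stackCoins κ mis T p (ω 0)) k) (Network.levelNet_idBound hid _ _)
    (Network.levelNet_weightBound _ _)
  refine LogAlg.solve_sound hout fun hdone => ?_
  have hw : ∀ k r v, decodeDraw (mis.maxCoin n) (Nat.log 2 (n ^ κ) + 1) (T n n) (ω 0 v) k r =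
    stackCoins κ mis T p (ω 0) k r v := fun k r v => decodeDraw_eq (ω 0) k r v
  have hstk : ∀ t v, (stackAlg κ mis T p).done
      ((stackAlg κ mis T p).run N (fun v => ω 0 v) t v).1 →
      LevelState.stk ((stackAlg κ mis T p).run N (fun v => ω 0 v) t v).1 =
        levelStack mis N (Nat.log 2 W + 1) (stackCoins κ mis T p (ω 0)) 0 v :=
    fun t v h => levelExec_stk (decode := fun n => decodeDraw (mis.maxCoin n)
      (Nat.log 2 (n ^ κ) + 1) (T n n)) (maxCoin := (stackAlg κ mis T p).maxCoin)
      (go := fun n => p n < 1) (log_weight_lt hW) hw h.1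
  have hcor : LevelsCorrect mis N (Nat.log 2 W + 1) (stackCoins κ mis T p (ω 0)) := by
    refine levelsCorrect (fun k _ => (hcomp k).1) (fun k _ => ?_) fun k _ v hv => ?_
    · obtain hn | ⟨⟨v⟩⟩ := isEmpty_or_nonempty (Fin n)
      · exact ⟨fun _ _ => 0, 0, fun _ => none, fun v => hn.elim v⟩
      · obtain ⟨t, ht⟩ := hdone v
        have hli := (levelInv (decode := fun n => decodeDraw (mis.maxCoin n)
          (Nat.log 2 (n ^ κ) + 1) (T n n)) (maxCoin := (stackAlg κ mis T p).maxCoin)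
          (go := fun n => p n < 1) (log_weight_lt hW) hw t v).li
        have hgo : p (LevelState.li
          ((stackAlg κ mis T p).run N (fun v => ω 0 v) t v).1).n < 1 := ht.2
        have e : LevelState.li ((stackAlg κ mis T p).run N (fun v => ω 0 v) t v).1 =
          N.localInput v := hli
        rw [e] at hgo
        exact (hcomp k).exists_halted hgo
    · obtain ⟨t, ht⟩ := hdone v
      exact exists_halted_of_level_eq_zero (decode := fun n => decodeDraw (mis.maxCoin n)
        (Nat.log 2 (n ^ κ) + 1) (T n n)) (maxCoin := (stackAlg κ mis T p).maxCoin)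
        (go := fun n => p n < 1) (log_weight_lt hW) hw (t := t) ht.1 hv
  obtain ⟨st, R, σ, Y, h1, h2, h3⟩ := exists_starStacks_cover (log_weight_lt hW) hcor
  exact ⟨st, R, σ, Y, _, h1, h2, fun t v h => (hstk t v h).trans (h3 v)⟩

theorem stackAlg_halts (hp : ∀ H : Network n, H.IdBound κ → H.WeightBound 1 →
      mis.Computes H H.IsLineGraphMIS (T n H.maxDegree) (p n)) (hpn : p n < 1)
    (hid : N.IdBound κ) (hW : N.WeightBound W) {ω : Coins n ((stackAlg κ mis T p).maxCoin n)}
    {d : Fin n → Fin ((stackAlg κ mis T p).maxCoin n + 1)} (hd : ω 0 = d) {T₀ : ℕ}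
    (hT₀ : ∀ k < Nat.log 2 W + 1, ∃ out, mis.HaltedWith (levelGraph mis N
      (Nat.log 2 W + 1) (stackCoins κ mis T p d) k) (stackCoins κ mis T p d k) T₀ out) :
    ∃ out, ((stackAlg κ mis T p).solve LevelState.stk).HaltedWith N ω
      ((Nat.log 2 W + 1) * (T₀ + 1) + 2 + 3 * (Nat.log 2 W + 1)) out := by
  subst hd
  have hcomp : ∀ k, _ := fun k => hp (levelGraph mis N (Nat.log 2 W + 1)
    (stackCoins κ mis T p (ω 0)) k) (Network.levelNet_idBound hid _ _)
    (Network.levelNet_weightBound _ _)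
  have hw : ∀ k r v, decodeDraw (mis.maxCoin n) (Nat.log 2 (n ^ κ) + 1) (T n n) (ω 0 v) k r =
    stackCoins κ mis T p (ω 0) k r v := fun k r v => decodeDraw_eq (ω 0) k r v
  have hhalt : ∀ k < Nat.log 2 W + 1, ∀ v, (mis.output (levelRun mis N (Nat.log 2 W + 1)
      (stackCoins κ mis T p (ω 0)) k T₀ v)).isSome := by
    intro k hk v
    obtain ⟨out, ho⟩ := hT₀ k hk
    rw [levelRun, ho v]
    rfl
  have hcor : LevelsCorrect mis N (Nat.log 2 W + 1) (stackCoins κ mis T p (ω 0)) :=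
    levelsCorrect (fun k _ => (hcomp k).1)
      (fun k hk => ⟨_, _, hT₀ k hk⟩) fun k hk v _ => ⟨T₀, hhalt k hk v⟩
  obtain ⟨st, R, σ, Y, h1, h2, h3⟩ := exists_starStacks_cover (log_weight_lt hW) hcor
  refine LogAlg.solve_halts (fun v => ?_) h1 fun t v h => ?_
  · have hlev := level_le (decode := fun n => decodeDraw (mis.maxCoin n)
      (Nat.log 2 (n ^ κ) + 1) (T n n)) (maxCoin := (stackAlg κ mis T p).maxCoin)
      (go := fun n => p n < 1) (log_weight_lt hW) hw hhalt le_rfl v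
    rw [Nat.sub_self] at hlev
    have hli := (levelInv (decode := fun n => decodeDraw (mis.maxCoin n)
      (Nat.log 2 (n ^ κ) + 1) (T n n)) (maxCoin := (stackAlg κ mis T p).maxCoin)
      (go := fun n => p n < 1) (log_weight_lt hW) hw ((Nat.log 2 W + 1) * (T₀ + 1)) v).li
    refine ⟨Nat.le_zero.1 hlev, ?_⟩
    have e : LevelState.li ((stackAlg κ mis T p).run N (fun v => ω 0 v)
      ((Nat.log 2 W + 1) * (T₀ + 1)) v).1 = N.localInput v := hli
    show p (LevelState.li ((stackAlg κ mis T p).run N (fun v => ω 0 v)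
      ((Nat.log 2 W + 1) * (T₀ + 1)) v).1).n < 1
    rw [e]
    exact hpn
  · refine Eq.trans ?_ (h3 v)
    exact levelExec_stk (decode := fun n => decodeDraw (mis.maxCoin n)
      (Nat.log 2 (n ^ κ) + 1) (T n n)) (maxCoin := (stackAlg κ mis T p).maxCoin)
      (go := fun n => p n < 1) (log_weight_lt hW) hw h.1

open Classical in
/-- The probability that in some level not all nodes halt. -/
theorem card_not_halted_le {K R L T₀ T₁ : ℕ} {q : ℝ} (hLK : L ≤ K) (hT : Monotone (T n))
    (hp : ∀ H : Network n, H.IdBound κ → H.WeightBound 1 →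
      mis.Computes H H.IsLineGraphMIS (T n H.maxDegree) q)
    (hid : N.IdBound κ) (hT₀ : T n N.maxDegree ≤ T₀) (hR : T₀ ≤ R) :
    (Finset.card {ω : Fin (T₁ + 1) → Fin n → Fin (drawBound (mis.maxCoin n) K R + 1) |
      ¬ ∀ k < L, ∃ out, mis.HaltedWith
        (levelGraph mis N L (levelCoins (mis.maxCoin n) K R (ω 0)) k)
        (levelCoins (mis.maxCoin n) K R (ω 0) k) T₀ out} : ℝ) ≤
      q * L * Fintype.card (Fin (T₁ + 1) → Fin n → Fin (drawBound (mis.maxCoin n) K R + 1)) := by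
  let Bad : ℕ → (Fin n → Fin (drawBound (mis.maxCoin n) K R + 1)) → Prop := fun k d =>
    ¬ ∃ out, mis.HaltedWith (levelGraph mis N L (levelCoins (mis.maxCoin n) K R d) k)
      (levelCoins (mis.maxCoin n) K R d k) T₀ out
  have hbad : ∀ k < L, (Finset.card {ω : Fin (T₁ + 1) → Fin n →
      Fin (drawBound (mis.maxCoin n) K R + 1) | Bad k (ω 0)} : ℝ) ≤
      q * Fintype.card (Fin (T₁ + 1) → Fin n → Fin (drawBound (mis.maxCoin n) K R + 1)) := by
    intro k hk
    -- Conditioned on the draws `d` for the other levels, the graph of level `k` is a fixed network,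
    -- and only the draws of its black box are random.
    refine card_filter_levelCoins_le (T := T₁) (B := Bad k) ⟨k, hk.trans_le hLK⟩ fun d => ?_
    have hcomp := hp (levelGraph mis N L (levelCoins (mis.maxCoin n) K R d) k)
      (Network.levelNet_idBound hid _ _) (Network.levelNet_weightBound _ _)
    have hle : T n (levelGraph mis N L (levelCoins (mis.maxCoin n) K R d) k).maxDegree ≤ T₀ :=
      (hT (Network.maxDegree_mono (Network.levelNet_le _ _))).trans hT₀
    have h := le_coinProb_iff.1 (le_coinProb_of_le (hle.trans hR)
      (E' := fun ω => ∃ out, mis.HaltedWith (levelGraph mis N L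
        (levelCoins (mis.maxCoin n) K R d) k) ω T₀ out)
      (fun _ _ hω ⟨out, ho⟩ => ⟨out, (ho.congr hω).mono hle⟩) hcomp.2)
    refine le_trans (Nat.cast_le.2 (Finset.card_le_card fun z hz => ?_)) h
    rw [Finset.mem_filter] at hz ⊢
    refine ⟨Finset.mem_univ _, ?_⟩
    have h1 := levelCoins_set_self d ⟨k, hk.trans_le hLK⟩ z
    have h2 : levelGraph mis N L (levelCoins (mis.maxCoin n) K R
        (setLevelCoins d ⟨k, hk.trans_le hLK⟩ z)) k =
        levelGraph mis N L (levelCoins (mis.maxCoin n) K R d) k :=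
      levelGraph_congr fun j hj => levelCoins_set_of_ne d ⟨k, hk.trans_le hLK⟩ z (ne_of_gt hj)
    have h3 := hz.2
    simp only [Bad] at h3
    rw [h2] at h3
    exact h1 ▸ h3
  have hsub : (Finset.univ.filter fun ω : Fin (T₁ + 1) → Fin n →
      Fin (drawBound (mis.maxCoin n) K R + 1) => ¬ ∀ k < L, ∃ out, mis.HaltedWith
        (levelGraph mis N L (levelCoins (mis.maxCoin n) K R (ω 0)) k)
        (levelCoins (mis.maxCoin n) K R (ω 0) k) T₀ out) ⊆
      (Finset.range L).biUnion fun k => Finset.univ.filter fun ω : Fin (T₁ + 1) → Fin n →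
        Fin (drawBound (mis.maxCoin n) K R + 1) => Bad k (ω 0) := by
    intro ω hω
    rw [Finset.mem_filter] at hω
    have := hω.2
    push Not at this
    obtain ⟨k, hk, h⟩ := this
    exact Finset.mem_biUnion.2 ⟨k, Finset.mem_range.2 hk,
        Finset.mem_filter.2 ⟨Finset.mem_univ _, not_exists.2 h⟩⟩
  calc _ ≤ ((Finset.card ((Finset.range L).biUnion fun k =>
        Finset.univ.filter fun ω : Fin (T₁ + 1) → Fin n →
          Fin (drawBound (mis.maxCoin n) K R + 1) => Bad k (ω 0)) : ℕ) : ℝ) :=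
        Nat.cast_le.2 (Finset.card_le_card hsub)
    _ ≤ ((∑ k ∈ Finset.range L, Finset.card (Finset.univ.filter fun ω : Fin (T₁ + 1) → Fin n →
      Fin (drawBound (mis.maxCoin n) K R + 1) => Bad k (ω 0)) : ℕ) : ℝ) :=
        Nat.cast_le.2 Finset.card_biUnion_le
    _ ≤ ∑ k ∈ Finset.range L, q * Fintype.card (Fin (T₁ + 1) → Fin n →
      Fin (drawBound (mis.maxCoin n) K R + 1)) := by
        rw [Nat.cast_sum]
        exact Finset.sum_le_sum fun k hk => hbad k (Finset.mem_range.1 hk)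
    _ = _ := by
        rw [Finset.sum_const, Finset.card_range, nsmul_eq_mul]
        ring

/-- If `p n ≥ 1`, the claimed probability is not positive and only soundness has content. Otherwise
a union bound over the levels applies. A level takes `T + 1` rounds to build and three to unwind,
and the implementation adds two rounds in all; `6` absorbs this. Since `Δ ≤ n`, drawing numbers for
`T n n` rounds per level suffices, although `Δ` is unknown. -/
theorem stackAlg_computes (hT : Monotone (T n)) (hp0 : 0 ≤ p n)
    (hp : ∀ H : Network n, H.IdBound κ → H.WeightBound 1 →
      mis.Computes H H.IsLineGraphMIS (T n H.maxDegree) (p n))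
    (hid : N.IdBound κ) (hW : N.WeightBound W) (hWn : W ≤ n ^ κ) :
    ((stackAlg κ mis T p).solve LevelState.stk).Computes N N.IsTwoApproxMatching
      (6 * ((T n N.maxDegree + 1) * (Nat.log 2 W + 1))) (p n * (Nat.log 2 W + 1)) := by
  classical
  refine ⟨fun ω t out hout => stackAlg_sound hp hid hW hout, ?_⟩
  by_cases hpn : 1 ≤ p n
  · refine le_trans ?_ coinProb_nonneg
    have : (0 : ℝ) ≤ Nat.log 2 W := Nat.cast_nonneg _
    nlinarith
  push Not at hpn
  set L := Nat.log 2 W + 1 with hL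
  have hLK : L ≤ Nat.log 2 (n ^ κ) + 1 := Nat.succ_le_succ (Nat.log_mono_right hWn)
  set T₀ := T n N.maxDegree with hT₀
  have hT₀n : T₀ ≤ T n n := hT N.maxDegree_le
  -- The number of rounds has to be positive because every draw that is used happens in round `0`.
  obtain ⟨T₁, hT₁⟩ : ∃ T₁, 6 * ((T₀ + 1) * L) = T₁ + 1 :=
    ⟨6 * ((T₀ + 1) * L) - 1, by have : 0 < (T₀ + 1) * L := by positivity
                                omega⟩
  have hTle : L * (T₀ + 1) + 2 + 3 * L ≤ T₁ + 1 := by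
    rw [← hT₁]
    nlinarith [Nat.zero_le (T₀ * L), Nat.zero_le (Nat.log 2 W)]
  rw [hT₁, le_coinProb_iff]
  have h := card_not_halted_le (T₁ := T₁) hLK hT hp hid hT₀.ge hT₀n
  rw [hL, Nat.cast_add, Nat.cast_one] at h
  refine le_trans (Nat.cast_le.2 (Finset.card_le_card fun ω hω => ?_)) h
  refine Finset.mem_filter.2 ⟨Finset.mem_univ _, fun hall => (Finset.mem_filter.1 hω).2 ?_⟩
  obtain ⟨out, ho⟩ := stackAlg_halts hp hpn hid hW
    (extendCoins_apply ω (Nat.succ_pos T₁)) hall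
  exact ⟨out, ho.mono hTle⟩

end

/-- A 2-approximation from a black box for maximal independent sets of the line graph. -/
theorem exists_twoApprox_of_lineGraphMIS (κ B : ℕ) (mis : MsgAlg) (T : ℕ → ℕ → ℕ) (p : ℕ → ℝ)
    (hT : ∀ n, Monotone (T n)) (hp : ∀ n, 0 ≤ p n)
    (hmis : ∀ (n : ℕ) (H : Network n), H.IdBound κ → H.WeightBound 1 →
      mis.MessageBound H (logBits B n) ∧
      mis.Computes H H.IsLineGraphMIS (T n H.maxDegree) (p n)) :
    ∃ (A : MsgAlg) (B' : ℕ), ∀ (n : ℕ) (N : Network n) (W : ℕ),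
      N.IdBound κ → N.WeightBound W → W ≤ n ^ κ →
        A.MessageBound N (logBits B' n) ∧
        A.Computes N N.IsTwoApproxMatching
          (6 * ((T n N.maxDegree + 1) * (Nat.log 2 W + 1))) (p n * (Nat.log 2 W + 1)) :=
  ⟨(stackAlg κ mis T p).solve LevelState.stk, 2 * κ + B + 6, fun n _ _ hid hW hWn =>
    ⟨stackAlg_messageBound (fun H h1 h2 => (hmis n H h1 h2).1) hid hW hWn,
      stackAlg_computes (hT n) (hp n) (fun H h1 h2 => (hmis n H h1 h2).2) hid hW hWn⟩⟩

/-! ### Executions of local aggregation algorithms. -/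

namespace AggAlg

variable {A : AggAlg} {n : ℕ} {N : Network n}

theorem run_succ (ω : Coins n (A.maxCoin n)) (t : ℕ) (v : Fin n) : A.run N ω (t + 1) v =
    if (A.output n (A.run N ω t v)).isSome then A.run N ω t v
    else A.step n (A.run N ω t v) (ω t v)
      (A.agg n (A.run N ω t v) (nbrData N (A.run N ω t) v)) := rfl

theorem run_of_halted {ω : Coins n (A.maxCoin n)} {t : ℕ} {v : Fin n}
    (h : (A.output n (A.run N ω t v)).isSome) {t' : ℕ} (ht : t ≤ t') :
    A.run N ω t' v = A.run N ω t v := by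
  induction t', ht using Nat.le_induction with
  | base => rfl
  | succ m _ ih => rw [run_succ, ih, if_pos h]

/-- The data on a union of connected components depend only on the numbers drawn there. -/
theorem run_congr {S : Set (Fin n)} (hS : ∀ v ∈ S, ∀ u, N.graph.Adj v u → u ∈ S)
    {ω ω' : Coins n (A.maxCoin n)} {t : ℕ} (h : ∀ r < t, ∀ v ∈ S, ω r v = ω' r v) :
    ∀ v ∈ S, A.run N ω t v = A.run N ω' t v := by
  classical
  induction t with
  | zero => exact fun v _ => rfl
  | succ t ih =>
    intro v hv
    have ih' := ih fun r hr => h r (by omega)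
    have : nbrData N (A.run N ω t) v = nbrData N (A.run N ω' t) v := by
      refine Multiset.map_congr rfl fun u hu => ih' u ?_
      have hu' : u ∈ Finset.univ.filter fun u => N.graph.Adj v u := hu
      exact hS v hv u (Finset.mem_filter.1 hu').2
    rw [run_succ, run_succ, this, ih' v hv, h t (by omega) v hv]

end AggAlg

/-! ### The line graph as a network -/

namespace Network

variable {n : ℕ} (N : Network n)

/-- Pairs of nodes, numbered. -/
def pairEquiv (n : ℕ) : Fin (n ^ 2) ≃ Fin n × Fin n :=
  (finCongr (sq n)).trans finProdFinEquiv.symm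

/-- The number of the edge `vu`: the endpoint with the smaller identifier comes first. -/
def edge (v u : Fin n) : Fin (n ^ 2) :=
  (pairEquiv n).symm (if N.id v < N.id u then (v, u) else (u, v))

variable {N}

theorem edge_of_lt {v u : Fin n} (h : N.id v < N.id u) : pairEquiv n (N.edge v u) = (v, u) := by
  rw [edge, if_pos h, Equiv.apply_symm_apply]

theorem edge_comm (v u : Fin n) : N.edge v u = N.edge u v := by
  rcases lt_trichotomy (N.id v) (N.id u) with h | h | h
  · rw [edge, edge, if_pos h, if_neg h.not_gt]
  · rw [N.id_injective h]
  · rw [edge, edge, if_pos h, if_neg h.not_gt]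

theorem edge_eq_edge {v u a b : Fin n} :
    N.edge v u = N.edge a b ↔ v = a ∧ u = b ∨ v = b ∧ u = a := by
  constructor
  · intro h
    have h := (pairEquiv n).symm.injective h
    split_ifs at h <;> simp only [Prod.mk.injEq] at h <;> tauto
  · rintro (⟨rfl, rfl⟩ | ⟨rfl, rfl⟩)
    · rfl
    · exact edge_comm _ _

variable (N) in
/-- The line graph as a network on the pairs of nodes; pairs that are not of the form `edge v u` with
adjacent `v` and `u` are isolated. -/
def lineNetwork {κ : ℕ} (hid : N.IdBound κ) : Network (n ^ 2) where
  graph :=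
    { Adj := fun x y => ∃ v u w, N.graph.Adj v u ∧ N.graph.Adj v w ∧ u ≠ w ∧
        x = N.edge v u ∧ y = N.edge v w
      symm := ⟨fun _ _ ⟨v, u, w, h1, h2, h3, h4, h5⟩ => ⟨v, w, u, h2, h1, h3.symm, h5, h4⟩⟩
      loopless := ⟨fun _ ⟨v, u, w, h1, h2, h3, h4, h5⟩ => by
        rcases edge_eq_edge.1 (h4.symm.trans h5) with ⟨-, h⟩ | ⟨h, h'⟩
        · exact h3 h
        · exact h1.ne h'.symm⟩ }
  id x := N.id (pairEquiv n x).1 * n ^ κ + N.id (pairEquiv n x).2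
  id_injective x y h := by
    beta_reduce at h
    have h1 := hid (pairEquiv n x).2
    have h2 := hid (pairEquiv n y).2
    have h3 : N.id (pairEquiv n x).1 = N.id (pairEquiv n y).1 := by
      rcases lt_trichotomy (N.id (pairEquiv n x).1) (N.id (pairEquiv n y).1) with h' | h' | h'
      · have := Nat.mul_le_mul_right (n ^ κ) (Nat.succ_le_of_lt h')
        rw [Nat.succ_mul] at this
        omega
      · exact h'
      · have := Nat.mul_le_mul_right (n ^ κ) (Nat.succ_le_of_lt h')
        rw [Nat.succ_mul] at this
        omega
    rw [h3] at h
    exact (pairEquiv n).injective (Prod.ext (N.id_injective h3)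
      (N.id_injective (Nat.add_left_cancel h)))
  weight _ := 1

variable {κ : ℕ} {hid : N.IdBound κ}

theorem lineNetwork_idBound : (N.lineNetwork hid).IdBound κ := by
  intro x
  have h1 := hid (pairEquiv n x).1
  have h2 := hid (pairEquiv n x).2
  show N.id (pairEquiv n x).1 * n ^ κ + N.id (pairEquiv n x).2 < (n ^ 2) ^ κ
  have h3 : (n ^ 2) ^ κ = n ^ κ * n ^ κ := by rw [← pow_mul, mul_comm 2, pow_mul, sq]
  rw [h3]
  nlinarith

theorem lineNetwork_adj_edge {v u : Fin n} (hvu : N.graph.Adj v u) {y : Fin (n ^ 2)} :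
    (N.lineNetwork hid).graph.Adj (N.edge v u) y ↔
      (∃ w, N.graph.Adj v w ∧ w ≠ u ∧ y = N.edge v w) ∨
        ∃ w, N.graph.Adj u w ∧ w ≠ v ∧ y = N.edge u w := by
  constructor
  · rintro ⟨a, b, w, h1, h2, h3, h4, h5⟩
    rcases edge_eq_edge.1 h4 with ⟨rfl, rfl⟩ | ⟨rfl, rfl⟩
    · exact Or.inl ⟨w, h2, h3.symm, h5⟩
    · exact Or.inr ⟨w, h2, h3.symm, h5⟩
  · rintro (⟨w, h1, h2, h3⟩ | ⟨w, h1, h2, h3⟩)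
    · exact ⟨v, u, w, hvu, h1, h2.symm, rfl, h3⟩
    · exact ⟨u, v, w, hvu.symm, h1, h2.symm, edge_comm _ _, h3⟩

open Classical in
/-- The other neighbours of `v`. -/
def otherNbrs (N : Network n) (v u : Fin n) : Finset (Fin n) :=
  (Finset.univ.filter fun w => N.graph.Adj v w).erase u

theorem mem_otherNbrs {v u w : Fin n} : w ∈ N.otherNbrs v u ↔ w ≠ u ∧ N.graph.Adj v w := by
  simp [otherNbrs]

theorem edge_injective (v : Fin n) : Function.Injective (N.edge v) := by
  intro a b h
  rcases edge_eq_edge.1 h with h | h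
  · exact h.2
  · exact h.2.trans h.1

-- Distinct edges share at most one endpoint, so the neighbours of `vu` in the line graph are the
-- disjoint union of the other edges at `v` and those at `u`. The equation is between multisets,
-- with the sum to which the joining function applies.
open Classical in
theorem lineNetwork_nbrs {v u : Fin n} (hvu : N.graph.Adj v u) :
    (Finset.univ.filter fun y => (N.lineNetwork hid).graph.Adj (N.edge v u) y).val =
      (N.otherNbrs v u).val.map (N.edge v) + (N.otherNbrs u v).val.map (N.edge u) := by
  have hd : Disjoint ((N.otherNbrs v u).map ⟨N.edge v, edge_injective v⟩)
      ((N.otherNbrs u v).map ⟨N.edge u, edge_injective u⟩) := by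
    rw [Finset.disjoint_left]
    intro y h1 h2
    obtain ⟨a, ha, rfl⟩ := Finset.mem_map.1 h1
    obtain ⟨b, hb, e⟩ := Finset.mem_map.1 h2
    rw [mem_otherNbrs] at ha hb
    rcases edge_eq_edge.1 e with h | h
    · exact hvu.ne h.1.symm
    · exact ha.1 h.1.symm
  have : (Finset.univ.filter fun y => (N.lineNetwork hid).graph.Adj (N.edge v u) y) =
      Finset.disjUnion _ _ hd := by
    ext y
    rw [Finset.mem_filter, lineNetwork_adj_edge hvu, Finset.mem_disjUnion, Finset.mem_map,
      Finset.mem_map]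
    simp only [mem_otherNbrs, Finset.mem_univ, true_and, Function.Embedding.coeFn_mk]
    constructor
    · rintro (⟨w, h1, h2, h3⟩ | ⟨w, h1, h2, h3⟩)
      · exact Or.inl ⟨w, ⟨h2, h1⟩, h3.symm⟩
      · exact Or.inr ⟨w, ⟨h2, h1⟩, h3.symm⟩
    · rintro (⟨w, ⟨h2, h1⟩, h3⟩ | ⟨w, ⟨h2, h1⟩, h3⟩)
      · exact Or.inl ⟨w, h1, h2, h3.symm⟩
      · exact Or.inr ⟨w, h1, h2, h3.symm⟩
  rw [this]
  rfl

theorem card_otherNbrs_lt {v u : Fin n} (hvu : N.graph.Adj v u) :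
    (N.otherNbrs v u).card < N.maxDegree := by
  classical
  rw [otherNbrs]
  refine (Finset.card_erase_lt_of_mem (by simpa using hvu)).trans_le ?_
  refine le_trans (Finset.card_le_card fun w hw => ?_) (SimpleGraph.degree_le_maxDegree _ v)
  rw [SimpleGraph.mem_neighborFinset]
  exact (Finset.mem_filter.1 hw).2

theorem lineNetwork_maxDegree_le : (N.lineNetwork hid).maxDegree ≤ 2 * N.maxDegree - 2 := by
  classical
  refine SimpleGraph.maxDegree_le_of_forall_degree_le _ _ fun x => ?_
  by_cases hx : ∃ v u, N.graph.Adj v u ∧ x = N.edge v u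
  · obtain ⟨v, u, hvu, rfl⟩ := hx
    have h1 := card_otherNbrs_lt hvu
    have h2 := card_otherNbrs_lt hvu.symm
    have h3 := congrArg Multiset.card (lineNetwork_nbrs (hid := hid) hvu)
    rw [Multiset.card_add, Multiset.card_map, Multiset.card_map] at h3
    have h4 : (N.lineNetwork hid).graph.degree (N.edge v u) ≤ Multiset.card (Finset.univ.filter
        fun y => (N.lineNetwork hid).graph.Adj (N.edge v u) y).val := by
      refine Finset.card_le_card fun y hy => ?_
      rw [SimpleGraph.mem_neighborFinset] at hy
      exact Finset.mem_filter.2 ⟨Finset.mem_univ _, hy⟩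
    change _ = (N.otherNbrs v u).card + (N.otherNbrs u v).card at h3
    omega
  · have : (N.lineNetwork hid).graph.degree x = 0 := by
      rw [SimpleGraph.degree_eq_zero_iff_notMem_support, SimpleGraph.mem_support]
      rintro ⟨y, v, u, w, h1, -, -, h4, -⟩
      exact hx ⟨v, u, h1, h4⟩
    omega

/-- Matchings from independent sets of the line network. -/
theorem isLineGraphMIS_of_lineNetwork {sel : Fin (n ^ 2) → Prop}
    (hind : ∀ v u w, N.graph.Adj v u → N.graph.Adj v w → sel (N.edge v u) → sel (N.edge v w) →
      u = w)
    (hmax : ∀ v u, N.graph.Adj v u → sel (N.edge v u) ∨ ∃ w, N.graph.Adj v w ∧ sel (N.edge v w) ∨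
      N.graph.Adj u w ∧ sel (N.edge u w))
    {out : Fin n → Option ℕ}
    (h1 : ∀ v i, out v = some i → ∃ u, N.graph.Adj v u ∧ N.id u = i ∧ sel (N.edge v u))
    (h2 : ∀ v u, N.graph.Adj v u → sel (N.edge v u) → out v ≠ none) :
    N.IsLineGraphMIS out := by
  refine isLineGraphMIS_iff.2 ⟨?_, ?_⟩
  · intro v i hi
    obtain ⟨u, hu, rfl, hs⟩ := h1 v i hi
    refine ⟨u, hu, rfl, ?_⟩
    rw [edge_comm] at hs
    obtain ⟨j, hj⟩ := Option.ne_none_iff_exists'.1 (h2 u v hu.symm hs)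
    obtain ⟨w, hw, rfl, hsw⟩ := h1 u j hj
    rw [hj, hind u v w hu.symm hw hs hsw]
  · intro v u hvu
    rcases hmax v u hvu with h | ⟨w, ⟨hw, h⟩ | ⟨hw, h⟩⟩
    · exact Or.inl (h2 v u hvu h)
    · exact Or.inl (h2 v w hw h)
    · exact Or.inr (h2 u w hw h)

/-- If the aggregation algorithm halts on all edges, the edges selected form a maximal independent
set, as the other pairs could halt as well. -/
theorem lineNetwork_selected {A : AggAlg} {ω ω' : Coins (n ^ 2) (A.maxCoin (n ^ 2))}
    (hA : ∀ ω t out, A.HaltedWith (N.lineNetwork hid) ω t out →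
      Maximal (N.lineNetwork hid).graph.IsIndepSet {v | out v = true}) {t' : ℕ}
    {out' : Fin (n ^ 2) → Bool} (h' : A.HaltedWith (N.lineNetwork hid) ω' t' out') {t : ℕ}
    (hh : ∀ v u, N.graph.Adj v u →
      (A.output (n ^ 2) (A.run (N.lineNetwork hid) ω t (N.edge v u))).isSome) :
    ∀ sel : Fin (n ^ 2) → Prop, (∀ x, sel x ↔
      A.output (n ^ 2) (A.run (N.lineNetwork hid) ω t x) = some true) →
    (∀ v u w, N.graph.Adj v u → N.graph.Adj v w → sel (N.edge v u) → sel (N.edge v w) →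
      u = w) ∧
    (∀ v u, N.graph.Adj v u → sel (N.edge v u) ∨ ∃ w, N.graph.Adj v w ∧ sel (N.edge v w) ∨
      N.graph.Adj u w ∧ sel (N.edge u w)) := by
  classical
  intro sel hsel
  let S : Set (Fin (n ^ 2)) := {x | ∃ v u, N.graph.Adj v u ∧ x = N.edge v u}
  have hS : ∀ x ∈ S, ∀ y, (N.lineNetwork hid).graph.Adj x y → y ∈ S :=
    fun x _ y ⟨v, u, w, h1, h2, h3, h4, h5⟩ => ⟨v, w, h2, h5⟩
  have hS' : ∀ x ∈ Sᶜ, ∀ y, (N.lineNetwork hid).graph.Adj x y → y ∈ Sᶜ :=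
    fun x hx y hy hy' => hx (hS y hy' x hy.symm)
  -- Pairs that are not edges are simulated by nobody. They take the draws of an execution that
  -- halts, and since they are not adjacent to edges, the result is an execution that halts
  -- everywhere and agrees with the simulated one on the edges.
  let ω₁ : Coins (n ^ 2) (A.maxCoin (n ^ 2)) := fun r x => if x ∈ S then ω r x else ω' r x
  have h1 : ∀ x ∈ S, A.run (N.lineNetwork hid) ω₁ (t + t') x = A.run (N.lineNetwork hid) ω t x := by
    intro x hx
    rw [AggAlg.run_congr (ω' := ω) hS (fun r _ x hx => if_pos hx) x hx]
    obtain ⟨v, u, hvu, rfl⟩ := hx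
    exact AggAlg.run_of_halted (hh v u hvu) (Nat.le_add_right _ _)
  have h2 : ∀ x ∈ Sᶜ, A.run (N.lineNetwork hid) ω₁ (t + t') x =
      A.run (N.lineNetwork hid) ω' t' x := by
    intro x hx
    rw [AggAlg.run_congr (ω' := ω') hS' (fun r _ x hx => if_neg hx) x hx]
    exact AggAlg.run_of_halted (by rw [h' x]; rfl) (Nat.le_add_left _ _)
  have h3 : ∀ x, (A.output (n ^ 2) (A.run (N.lineNetwork hid) ω₁ (t + t') x)).isSome := by
    intro x
    by_cases hx : x ∈ S
    · rw [h1 x hx]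
      obtain ⟨v, u, hvu, rfl⟩ := hx
      exact hh v u hvu
    · rw [h2 x hx, h' x]
      rfl
  choose out hout using fun x => Option.isSome_iff_exists.1 (h3 x)
  have hmax := hA ω₁ _ out hout
  have hsel' : ∀ v u, N.graph.Adj v u → (sel (N.edge v u) ↔ out (N.edge v u) = true) := by
    intro v u hvu
    rw [hsel, ← h1 _ ⟨v, u, hvu, rfl⟩, hout, Option.some.injEq]
  refine ⟨fun v u w hvu hvw h4 h5 => ?_, fun v u hvu => ?_⟩
  · by_contra hne
    rw [hsel' v u hvu] at h4
    rw [hsel' v w hvw] at h5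
    exact hmax.prop h4 h5 (fun h => hne (edge_injective v h)) ⟨v, u, w, hvu, hvw, hne, rfl, rfl⟩
  · by_contra! hcon
    obtain ⟨hc1, hc2⟩ := hcon
    have hnot : N.edge v u ∉ {x | out x = true} := fun h => hc1 ((hsel' v u hvu).2 h)
    refine hnot (hmax.le_of_ge (y := insert (N.edge v u) {x | out x = true}) ?_
      (Set.subset_insert _ _) (Set.mem_insert _ _))
    have hno : ∀ y, (N.lineNetwork hid).graph.Adj (N.edge v u) y → ¬ out y = true := by
      intro y hy hy'
      rcases (lineNetwork_adj_edge hvu).1 hy with ⟨w, h1, -, rfl⟩ | ⟨w, h1, -, rfl⟩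
      · exact (hc2 w).1 h1 ((hsel' v w h1).2 hy')
      · exact (hc2 w).2 h1 ((hsel' u w h1).2 hy')
    intro x hx y hy hxy hadj
    rcases hx with rfl | hx <;> rcases hy with rfl | hy
    · exact hxy rfl
    · exact hno y hadj hy
    · exact hno x hadj.symm hx
    · exact hmax.prop hx hy hxy hadj

end Network

/-! ### Simulation of an aggregation algorithm on the line graph. -/

/-- The state of a node that simulates an aggregation algorithm on its incident edges: the data of
the edges and, in every other round, the aggregates received from the other endpoints (both indexed
by the identifiers of the other endpoints). -/
structure EdgeState where
  li : LocalInput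
  dat : ℕ → List Bool
  received : Option (ℕ → List Bool)

namespace EdgeState

variable (A : AggAlg) (κ : ℕ) (s : EdgeState)

/-- The edge to neighbour `j` has halted. -/
def EdgeDone (j : ℕ) : Prop := (A.output (s.li.n ^ 2) (s.dat j)).isSome

/-- The aggregate of the other incident edges. -/
def ownAgg (j : ℕ) : List Bool :=
  A.agg (s.li.n ^ 2) (s.dat j) ((s.li.nbrs.erase j).val.map s.dat)

/-- The new data of the edge to `j`, if the other endpoint sends the aggregate `a`. -/
def newData (a : List Bool) (c j : ℕ) : List Bool :=
  A.step (s.li.n ^ 2) (s.dat j) (decodeDraw (A.maxCoin (s.li.n ^ 2)) (s.li.n ^ κ) 1 c j 0)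
    (A.join (s.li.n ^ 2) (s.dat j) (s.ownAgg A j) a)

open Classical in
/-- The mate: an edge that has been selected. -/
def mate : Option ℕ :=
  if h : ∃ j ∈ s.li.nbrs, A.output (s.li.n ^ 2) (s.dat j) = some true then some h.choose else none

open Classical in
/-- Messages: aggregates and new data alternate. -/
def send (c j : ℕ) : List Bool :=
  if s.EdgeDone A j then [] else
    match s.received with
    | none => s.ownAgg A j
    | some r => if s.li.id < j then s.newData A κ (r j) c j else []

open Classical in
/-- Transitions: aggregates and new data alternate. -/
def step (c : ℕ) (inb : ℕ → List Bool) : EdgeState :=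
  match s.received with
  | none => { s with received := some inb }
  | some r =>
    { s with
      dat := fun j => if s.EdgeDone A j then s.dat j else
        if s.li.id < j then s.newData A κ (r j) c j else inb j
      received := none }

open Classical in
/-- A node halts when its incident edges have halted, and only if `go` holds. -/
def output (go : ℕ → Prop) : Option (Option ℕ) :=
  if go s.li.n ∧ ∀ j ∈ s.li.nbrs, s.EdgeDone A j then some (s.mate A) else none

end EdgeState

/-- The simulation of an aggregation algorithm on the line graph. The endpoint with the smaller
identifier computes the data of an edge. -/
def lineAlg (A : AggAlg) (κ : ℕ) (go : ℕ → Prop) : MsgAlg where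
  State := EdgeState
  maxCoin n := drawBound (A.maxCoin (n ^ 2)) (n ^ κ) 1
  init li := ⟨li, fun j => A.init (li.n ^ 2)
    (if li.id < j then li.id * li.n ^ κ + j else j * li.n ^ κ + li.id), none⟩
  send s c j := s.send A κ c j
  step s c inb := s.step A κ c inb
  output s := s.output A go

section Simulation

variable {A : AggAlg} {κ : ℕ} {go : ℕ → Prop} {n : ℕ} {N : Network n} {hid : N.IdBound κ}

/-- The states of the simulation. -/
def lineRun (A : AggAlg) (κ : ℕ) (go : ℕ → Prop) (N : Network n)
    (ω : Coins n ((lineAlg A κ go).maxCoin n)) (t : ℕ) (v : Fin n) : EdgeState :=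
  (lineAlg A κ go).run N ω t v

/-- The messages of the simulation. -/
def lineMsg (A : AggAlg) (κ : ℕ) (go : ℕ → Prop) (s : EdgeState) (c j : ℕ) : List Bool :=
  if (s.output A go).isSome then [] else s.send A κ c j

/-- The random numbers for the nodes of the line network. -/
def edgeCoins (A : AggAlg) (κ : ℕ) (go : ℕ → Prop) (N : Network n)
    (ω : Coins n ((lineAlg A κ go).maxCoin n)) : Coins (n ^ 2) (A.maxCoin (n ^ 2)) :=
  fun t x => levelCoins (A.maxCoin (n ^ 2)) (n ^ κ) 1 (ω (2 * t + 1))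
    (N.id (Network.pairEquiv n x).2) 0 (Network.pairEquiv n x).1

/-- The data of the edge `vu`. -/
def edgeData (A : AggAlg) (go : ℕ → Prop) (hid : N.IdBound κ)
    (ω : Coins n ((lineAlg A κ go).maxCoin n)) (t : ℕ) (v u : Fin n) : List Bool :=
  A.run (N.lineNetwork hid) (edgeCoins A κ go N ω) t (N.edge v u)

/-- The data of the other edges at `v`. -/
def otherData (A : AggAlg) (go : ℕ → Prop) (hid : N.IdBound κ)
    (ω : Coins n ((lineAlg A κ go).maxCoin n)) (t : ℕ) (v u : Fin n) : Multiset (List Bool) :=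
  (N.otherNbrs v u).val.map (edgeData A go hid ω t v)

variable {ω : Coins n ((lineAlg A κ go).maxCoin n)}

theorem edgeData_comm (t : ℕ) (v u : Fin n) :
    edgeData A go hid ω t v u = edgeData A go hid ω t u v := by
  rw [edgeData, Network.edge_comm, edgeData]

theorem nbrData_edge (t : ℕ) {v u : Fin n} (hvu : N.graph.Adj v u) :
    AggAlg.nbrData (N.lineNetwork hid) (A.run (N.lineNetwork hid) (edgeCoins A κ go N ω) t)
      (N.edge v u) = otherData A go hid ω t v u + otherData A go hid ω t u v := by
  rw [AggAlg.nbrData, Network.lineNetwork_nbrs hvu, Multiset.map_add, Multiset.map_map,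
    Multiset.map_map]
  rfl

/-- The joining function enters here: each endpoint contributes the aggregate of its own other
edges, so congestion stays bounded although an edge may have about `2 * Δ` neighbours. -/
theorem edgeData_succ (t : ℕ) {v u : Fin n} (hvu : N.graph.Adj v u) (hlt : N.id v < N.id u) :
    edgeData A go hid ω (t + 1) v u =
      if (A.output (n ^ 2) (edgeData A go hid ω t v u)).isSome then edgeData A go hid ω t v u
      else A.step (n ^ 2) (edgeData A go hid ω t v u)
        (decodeDraw (A.maxCoin (n ^ 2)) (n ^ κ) 1 (ω (2 * t + 1) v) (N.id u) 0)
        (A.join (n ^ 2) (edgeData A go hid ω t v u)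
          (A.agg (n ^ 2) (edgeData A go hid ω t v u) (otherData A go hid ω t v u))
          (A.agg (n ^ 2) (edgeData A go hid ω t v u) (otherData A go hid ω t u v))) := by
  rw [edgeData, AggAlg.run_succ, nbrData_edge t hvu, A.agg_add]
  have h1 : (edgeCoins A κ go N ω t (N.edge v u) : ℕ) =
      decodeDraw (A.maxCoin (n ^ 2)) (n ^ κ) 1 (ω (2 * t + 1) v) (N.id u) 0 := by
    rw [edgeCoins, Network.edge_of_lt hlt]
    exact (decodeDraw_eq (ω (2 * t + 1)) _ _ _).symm
  rw [h1]
  rfl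

theorem edgeData_succ_of_done {t : ℕ} {v u : Fin n}
    (h : (A.output (n ^ 2) (edgeData A go hid ω t v u)).isSome) :
    edgeData A go hid ω (t + 1) v u = edgeData A go hid ω t v u := by
  rw [edgeData, AggAlg.run_succ]
  exact if_pos h

theorem lineRun_succ (t : ℕ) (v : Fin n) : lineRun A κ go N ω (t + 1) v =
    if ((lineRun A κ go N ω t v).output A go).isSome then lineRun A κ go N ω t v
    else (lineRun A κ go N ω t v).step A κ (ω t v)
      (N.inbox (fun u j => lineMsg A κ go (lineRun A κ go N ω t u) (ω t u) j) v) := rfl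

/-- The state `s` of `v` knows the data after `t` rounds. -/
def Knows (A : AggAlg) (go : ℕ → Prop) (hid : N.IdBound κ)
    (ω : Coins n ((lineAlg A κ go).maxCoin n)) (t : ℕ) (v : Fin n) (s : EdgeState) : Prop :=
  s.li = N.localInput v ∧ ∀ u, N.graph.Adj v u → s.dat (N.id u) = edgeData A go hid ω t v u

namespace Knows

variable {t : ℕ} {v : Fin n} {s : EdgeState} (h : Knows A go hid ω t v s)

include h

theorem edgeDone_iff {u : Fin n} (hu : N.graph.Adj v u) :
    s.EdgeDone A (N.id u) ↔ (A.output (n ^ 2) (edgeData A go hid ω t v u)).isSome := by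
  rw [EdgeState.EdgeDone, h.1, h.2 u hu]
  rfl

theorem ownAgg_eq {u : Fin n} (hu : N.graph.Adj v u) : s.ownAgg A (N.id u) =
    A.agg (n ^ 2) (edgeData A go hid ω t v u) (otherData A go hid ω t v u) := by
  classical
  rw [EdgeState.ownAgg, h.1, h.2 u hu]
  have e : (N.localInput v).nbrs.erase (N.id u) =
      (N.otherNbrs v u).map ⟨N.id, N.id_injective⟩ := by
    ext i
    rw [Finset.mem_erase, Network.mem_nbrs, Finset.mem_map]
    constructor
    · rintro ⟨h1, w, hw, rfl⟩
      exact ⟨w, Network.mem_otherNbrs.2 ⟨fun h => h1 (congrArg _ h), hw⟩, rfl⟩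
    · rintro ⟨w, hw, rfl⟩
      obtain ⟨h1, h2⟩ := Network.mem_otherNbrs.1 hw
      exact ⟨fun h => h1 (N.id_injective h), w, h2, rfl⟩
  have e' : ((N.localInput v).nbrs.erase (N.id u)).val.map s.dat =
      otherData A go hid ω t v u := by
    rw [e, Finset.map_val, Multiset.map_map]
    refine Multiset.map_congr rfl fun w hw => ?_
    exact h.2 w (Network.mem_otherNbrs.1 (Finset.mem_val.mp hw)).2
  rw [e']
  rfl

theorem output_eq_none {u : Fin n} (hu : N.graph.Adj v u)
    (hd : ¬ (A.output (n ^ 2) (edgeData A go hid ω t v u)).isSome) :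
    s.output A go = none := by
  refine if_neg fun h' => hd ((h.edgeDone_iff hu).1 (h'.2 _ ?_))
  rw [h.1]
  exact Network.id_mem_nbrs.2 hu

theorem succ_of_halted (hs : (s.output A go).isSome) : Knows A go hid ω (t + 1) v s := by
  refine ⟨h.1, fun u hu => ?_⟩
  have hd : (A.output (n ^ 2) (edgeData A go hid ω t v u)).isSome := by
    by_contra hd
    rw [h.output_eq_none hu hd] at hs
    simp at hs
  rw [h.2 u hu, edgeData_succ_of_done hd]

/-- The new data of an edge as computed by the endpoint with the smaller identifier. -/
theorem newData_eq {u : Fin n} (hu : N.graph.Adj v u) (hlt : N.id v < N.id u)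
    (hd : ¬ (A.output (n ^ 2) (edgeData A go hid ω t v u)).isSome) {a : List Bool}
    (ha : a = A.agg (n ^ 2) (edgeData A go hid ω t v u) (otherData A go hid ω t u v)) :
    s.newData A κ a (ω (2 * t + 1) v) (N.id u) = edgeData A go hid ω (t + 1) v u := by
  rw [edgeData_succ t hu hlt, if_neg hd, EdgeState.newData, h.ownAgg_eq hu, h.1, h.2 u hu, ha]
  rfl

end Knows

/-- The aggregates received by `v`. -/
def ReceivedOK (A : AggAlg) (go : ℕ → Prop) (hid : N.IdBound κ)
    (ω : Coins n ((lineAlg A κ go).maxCoin n)) (t : ℕ) (v : Fin n) (s : EdgeState) : Prop :=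
  s.output A go = none → ∃ r, s.received = some r ∧ ∀ u, N.graph.Adj v u →
    ¬ (A.output (n ^ 2) (edgeData A go hid ω t v u)).isSome →
      r (N.id u) = A.agg (n ^ 2) (edgeData A go hid ω t v u) (otherData A go hid ω t u v)

/-- In even rounds the endpoints of every edge exchange their partial aggregates. In odd rounds the
endpoint with the smaller identifier computes the new data with its draw of round `2 * t + 1` and
sends them to the other one. An edge that has not halted keeps both endpoints from halting
(`Knows.output_eq_none`), so the messages that matter are sent. -/
theorem lineRun_spec (t : ℕ) :
    (∀ v, Knows A go hid ω t v (lineRun A κ go N ω (2 * t) v) ∧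
      ((lineRun A κ go N ω (2 * t) v).output A go = none →
        (lineRun A κ go N ω (2 * t) v).received = none)) ∧
    ∀ v, Knows A go hid ω t v (lineRun A κ go N ω (2 * t + 1) v) ∧
      ReceivedOK A go hid ω t v (lineRun A κ go N ω (2 * t + 1) v) := by
  classical
  have odd : ∀ t, (∀ v, Knows A go hid ω t v (lineRun A κ go N ω (2 * t) v) ∧
      ((lineRun A κ go N ω (2 * t) v).output A go = none →
        (lineRun A κ go N ω (2 * t) v).received = none)) →
      ∀ v, Knows A go hid ω t v (lineRun A κ go N ω (2 * t + 1) v) ∧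
      ReceivedOK A go hid ω t v (lineRun A κ go N ω (2 * t + 1) v) := by
    intro t h v
    rw [lineRun_succ]
    by_cases hs : ((lineRun A κ go N ω (2 * t) v).output A go).isSome
    · rw [if_pos hs]
      refine ⟨(h v).1, fun h' => ?_⟩
      rw [h'] at hs
      simp at hs
    · rw [if_neg hs, EdgeState.step, (h v).2 (by simpa using hs)]
      refine ⟨(h v).1, fun _ => ⟨_, rfl, fun u hu hd => ?_⟩⟩
      have hd' : ¬ (A.output (n ^ 2) (edgeData A go hid ω t u v)).isSome := by
        rwa [edgeData_comm]
      have ho := (h u).1.output_eq_none hu.symm hd'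
      rw [Network.inbox_id hu, lineMsg, ho, EdgeState.send,
        if_neg (mt ((h u).1.edgeDone_iff hu.symm).1 hd'), (h u).2 ho]
      simp only [Option.isSome_none, Bool.false_eq_true, if_false]
      rw [(h u).1.ownAgg_eq hu.symm, edgeData_comm]
  suffices h : ∀ v, Knows A go hid ω t v (lineRun A κ go N ω (2 * t) v) ∧
      ((lineRun A κ go N ω (2 * t) v).output A go = none →
        (lineRun A κ go N ω (2 * t) v).received = none) from ⟨h, odd t h⟩
  induction t with
  | zero =>
    refine fun v => ⟨⟨rfl, fun u hu => ?_⟩, fun _ => rfl⟩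
    rw [edgeData]
    show A.init (n ^ 2) (if N.id v < N.id u then _ else _) =
      A.init (n ^ 2) (N.id (Network.pairEquiv n _).1 * n ^ κ + N.id (Network.pairEquiv n _).2)
    by_cases hlt : N.id v < N.id u
    · rw [if_pos hlt, Network.edge_of_lt hlt]
      rfl
    · have hlt' : N.id u < N.id v :=
        lt_of_le_of_ne (not_lt.1 hlt) fun e => hu.ne (N.id_injective e).symm
      rw [if_neg hlt, Network.edge_comm, Network.edge_of_lt hlt']
      rfl
  | succ t ih =>
    have h := odd t ih
    intro v
    show Knows A go hid ω (t + 1) v (lineRun A κ go N ω (2 * t + 1 + 1) v) ∧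
      ((lineRun A κ go N ω (2 * t + 1 + 1) v).output A go = none →
        (lineRun A κ go N ω (2 * t + 1 + 1) v).received = none)
    rw [lineRun_succ]
    by_cases hs : ((lineRun A κ go N ω (2 * t + 1) v).output A go).isSome
    · rw [if_pos hs]
      refine ⟨(h v).1.succ_of_halted hs, fun h' => ?_⟩
      rw [h'] at hs
      simp at hs
    · rw [if_neg hs]
      obtain ⟨r, hr, hr'⟩ := (h v).2 (by simpa using hs)
      rw [EdgeState.step, hr]
      refine ⟨⟨(h v).1.1, fun u hu => ?_⟩, fun _ => rfl⟩
      show ite _ _ _ = _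
      by_cases hd : (A.output (n ^ 2) (edgeData A go hid ω t v u)).isSome
      · rw [if_pos (((h v).1.edgeDone_iff hu).2 hd), edgeData_succ_of_done hd]
        exact (h v).1.2 u hu
      · rw [if_neg (mt ((h v).1.edgeDone_iff hu).1 hd)]
        have hid' : (lineRun A κ go N ω (2 * t + 1) v).li.id = N.id v := by rw [(h v).1.1]; rfl
        rw [hid']
        by_cases hlt : N.id v < N.id u
        · rw [if_pos hlt]
          exact (h v).1.newData_eq hu hlt hd (hr' u hu hd)
        · rw [if_neg hlt]
          have hlt' : N.id u < N.id v :=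
            lt_of_le_of_ne (not_lt.1 hlt) fun e => hu.ne (N.id_injective e).symm
          have hd' : ¬ (A.output (n ^ 2) (edgeData A go hid ω t u v)).isSome := by
            rwa [edgeData_comm]
          have ho := (h u).1.output_eq_none hu.symm hd'
          obtain ⟨r', hr1, hr2⟩ := (h u).2 ho
          have hidu : (lineRun A κ go N ω (2 * t + 1) u).li.id = N.id u := by rw [(h u).1.1]; rfl
          rw [Network.inbox_id hu, lineMsg, ho, EdgeState.send,
            if_neg (mt ((h u).1.edgeDone_iff hu.symm).1 hd'), hr1, hidu]
          simp only [Option.isSome_none, Bool.false_eq_true, if_false, if_pos hlt']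
          rw [(h u).1.newData_eq hu.symm hlt' hd' (hr2 v hu.symm hd'), edgeData_comm]

end Simulation

section Simulation

variable {A : AggAlg} {κ : ℕ} {go : ℕ → Prop} {n : ℕ} {N : Network n} (hid : N.IdBound κ)
variable {ω : Coins n ((lineAlg A κ go).maxCoin n)}

include hid

/-- A message is the data of an edge or an aggregate over part of its neighbourhood; the latter is
why `SizeBound` speaks of all sub-multisets. -/
theorem lineAlg_messageBound {b : ℕ} (h : A.SizeBound (N.lineNetwork hid) b) :
    (lineAlg A κ go).MessageBound N b := by
  classical
  intro ω t v u hvu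
  show (lineMsg A κ go (lineRun A κ go N ω t v) (ω t v) (N.id u)).length ≤ b
  rw [lineMsg]
  split_ifs with ho
  · exact Nat.zero_le _
  have ho : (lineRun A κ go N ω t v).output A go = none := by simpa using ho
  rw [EdgeState.send]
  by_cases hd : (lineRun A κ go N ω t v).EdgeDone A (N.id u)
  · rw [if_pos hd]
    exact Nat.zero_le _
  rw [if_neg hd]
  obtain ⟨t, rfl | rfl⟩ := Nat.even_or_odd' t
  · obtain ⟨h1, h2⟩ := (lineRun_spec (A := A) (go := go) (hid := hid) (ω := ω) t).1 v
    rw [h2 ho]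
    simp only
    rw [h1.ownAgg_eq hvu]
    refine (h (edgeCoins A κ go N ω) t (N.edge v u)).2 _ ?_
    rw [nbrData_edge t hvu]
    exact Multiset.le_add_right _ _
  · obtain ⟨h1, h2⟩ := (lineRun_spec (A := A) (go := go) (hid := hid) (ω := ω) t).2 v
    obtain ⟨r, hr, hr'⟩ := h2 ho
    rw [hr]
    simp only
    split_ifs with hlt
    · have hlt' : N.id v < N.id u := by rw [h1.1] at hlt; exact hlt
      have hd' := mt (h1.edgeDone_iff hvu).2 hd
      rw [h1.newData_eq hvu hlt' hd' (hr' u hvu hd')]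
      exact (h (edgeCoins A κ go N ω) (t + 1) (N.edge v u)).1
    · exact Nat.zero_le _

/-- Halting of a node guarantees `go n`, hence a halting execution on the whole line network, which
supplies the behaviour of the pairs that are not edges. -/
theorem lineAlg_sound (hA : ∀ ω t out, A.HaltedWith (N.lineNetwork hid) ω t out →
      Maximal (N.lineNetwork hid).graph.IsIndepSet {v | out v = true})
    (hex : go n → ∃ ω t out, A.HaltedWith (N.lineNetwork hid) ω t out) {t : ℕ}
    {out : Fin n → Option ℕ} (hout : (lineAlg A κ go).HaltedWith N ω t out) :
    N.IsLineGraphMIS out := by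
  classical
  obtain hn | ⟨⟨v₀⟩⟩ := isEmpty_or_nonempty (Fin n)
  · exact Network.isLineGraphMIS_iff.2 ⟨fun v => hn.elim v, fun v => hn.elim v⟩
  have hout' : ∀ v, (lineRun A κ go N ω (2 * t) v).output A go = some (out v) :=
    hout.mono (by omega : t ≤ 2 * t)
  have hk := fun v => ((lineRun_spec (A := A) (go := go) (hid := hid) (ω := ω) t).1 v).1
  have hv : ∀ v, (go n ∧ ∀ u, N.graph.Adj v u →
      (A.output (n ^ 2) (edgeData A go hid ω t v u)).isSome) ∧
      (lineRun A κ go N ω (2 * t) v).mate A = out v := by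
    intro v
    have h := hout' v
    rw [EdgeState.output] at h
    split_ifs at h with h'
    rw [(hk v).1] at h'
    refine ⟨⟨h'.1, fun u hu => ?_⟩, Option.some_injective _ h⟩
    exact ((hk v).edgeDone_iff hu).1 (h'.2 _ (Network.id_mem_nbrs.2 hu))
  obtain ⟨ω', t', out', h'⟩ := hex (hv v₀).1.1
  obtain ⟨h1, h2⟩ := Network.lineNetwork_selected hA h' (fun v u hvu => (hv v).1.2 u hvu)
    (fun x => A.output (n ^ 2) (A.run (N.lineNetwork hid) (edgeCoins A κ go N ω) t x) = some true)
    fun _ => Iff.rfl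
  refine Network.isLineGraphMIS_of_lineNetwork (sel := fun x => A.output (n ^ 2)
    (A.run (N.lineNetwork hid) (edgeCoins A κ go N ω) t x) = some true) h1 h2 ?_ ?_
  · intro v i hi
    rw [← (hv v).2, EdgeState.mate] at hi
    split_ifs at hi with hm
    obtain ⟨h3, h4⟩ := hm.choose_spec
    rw [Option.some_injective _ hi] at h3 h4
    rw [(hk v).1] at h3
    obtain ⟨u, hu, rfl⟩ := Network.mem_nbrs.1 h3
    rw [(hk v).1, (hk v).2 u hu] at h4
    exact ⟨u, hu, rfl, h4⟩
  · intro v u hu hsel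
    rw [← (hv v).2, EdgeState.mate, dif_pos]
    · simp
    · refine ⟨N.id u, ?_, ?_⟩
      · rw [(hk v).1]
        exact Network.id_mem_nbrs.2 hu
      · rw [(hk v).1, (hk v).2 u hu]
        exact hsel

theorem lineAlg_halts (hgo : go n) {t : ℕ} (hh : ∀ x, (A.output (n ^ 2)
      (A.run (N.lineNetwork hid) (edgeCoins A κ go N ω) t x)).isSome) :
    ∃ out, (lineAlg A κ go).HaltedWith N ω (2 * t) out := by
  classical
  refine ⟨fun v => (lineRun A κ go N ω (2 * t) v).mate A, fun v => ?_⟩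
  have hk := ((lineRun_spec (A := A) (go := go) (hid := hid) (ω := ω) t).1 v).1
  refine if_pos ⟨?_, fun i hi => ?_⟩
  · show go (lineRun A κ go N ω (2 * t) v).li.n
    rw [hk.1]
    exact hgo
  · change i ∈ (lineRun A κ go N ω (2 * t) v).li.nbrs at hi
    rw [hk.1] at hi
    obtain ⟨u, hu, rfl⟩ := Network.mem_nbrs.1 hi
    exact (hk.edgeDone_iff hu).2 (hh _)

end Simulation

/-! ### Draws of the edges as a component of the draws of the nodes. -/

section EdgeDraws

variable {M K n : ℕ} {N : Network n}

open Classical in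
/-- Changing the random numbers for the identifiers of nodes. -/
def setRow (N : Network n) (d : Fin (drawBound M K 1 + 1)) (row : Fin n → Fin (M + 1)) :
    Fin (drawBound M K 1 + 1) :=
  (levelDrawsEquiv M K 1).symm fun i r =>
    if h : ∃ b, N.id b = i then row h.choose else levelDrawsEquiv M K 1 d i r

theorem equiv_setRow (d : Fin (drawBound M K 1 + 1)) (row : Fin n → Fin (M + 1)) {b : Fin n}
    (hb : N.id b < K) : levelDrawsEquiv M K 1 (setRow N d row) ⟨N.id b, hb⟩ 0 = row b := by
  have h : ∃ a, N.id a = ((⟨N.id b, hb⟩ : Fin K) : ℕ) := ⟨b, rfl⟩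
  rw [setRow, Equiv.apply_symm_apply, dif_pos h, N.id_injective h.choose_spec]

theorem setRow_setRow (d : Fin (drawBound M K 1 + 1)) (row : Fin n → Fin (M + 1))
    (hid : ∀ b, N.id b < K) : setRow N (setRow N d row)
      (fun b => levelDrawsEquiv M K 1 d ⟨N.id b, hid b⟩ 0) = d := by
  apply (levelDrawsEquiv M K 1).injective
  funext i r
  rw [setRow, Equiv.apply_symm_apply]
  by_cases h : ∃ b, N.id b = i
  · rw [dif_pos h, Subsingleton.elim r 0]
    exact congrArg (fun i => levelDrawsEquiv M K 1 d i 0) (Fin.ext h.choose_spec)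
  · rw [dif_neg h, setRow, Equiv.apply_symm_apply, dif_neg h]

open Classical in
/-- Changing the random numbers of the edges. -/
def setEdgeCoins (N : Network n) {T : ℕ} (w : Fin (2 * T) → Fin n → Fin (drawBound M K 1 + 1))
    (z : Fin T → Fin (n ^ 2) → Fin (M + 1)) : Fin (2 * T) → Fin n → Fin (drawBound M K 1 + 1) :=
  fun s v => if s.1 % 2 = 1 then setRow N (w s v) fun b => z ⟨s.1 / 2, by omega⟩
    ((Network.pairEquiv n).symm (v, b)) else w s v

/-- The random numbers of the edges. -/
def getEdgeCoins (hid : ∀ b, N.id b < K) {T : ℕ}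
    (w : Fin (2 * T) → Fin n → Fin (drawBound M K 1 + 1)) : Fin T → Fin (n ^ 2) → Fin (M + 1) :=
  fun t x => levelDrawsEquiv M K 1 (w ⟨2 * t.1 + 1, by omega⟩ (Network.pairEquiv n x).1)
    ⟨N.id (Network.pairEquiv n x).2, hid _⟩ 0

/-- This law and the next one are the hypotheses of `le_coinProb_of_lens`: the draws of all pairs
form a uniform component of the draws of the nodes. Draws in even rounds and entries for identifiers
that no node has are left unchanged. -/
theorem getEdgeCoins_setEdgeCoins (hid : ∀ b, N.id b < K) {T : ℕ}
    (w : Fin (2 * T) → Fin n → Fin (drawBound M K 1 + 1)) (z : Fin T → Fin (n ^ 2) → Fin (M + 1)) :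
    getEdgeCoins hid (setEdgeCoins N w z) = z := by
  funext t x
  rw [getEdgeCoins, setEdgeCoins, if_pos (show (2 * t.1 + 1) % 2 = 1 by omega), equiv_setRow,
    Prod.mk.eta, Equiv.symm_apply_apply]
  congr 1
  exact Fin.ext (show (2 * t.1 + 1) / 2 = t.1 by omega)

theorem setEdgeCoins_getEdgeCoins (hid : ∀ b, N.id b < K) {T : ℕ}
    (w : Fin (2 * T) → Fin n → Fin (drawBound M K 1 + 1)) (z : Fin T → Fin (n ^ 2) → Fin (M + 1)) :
    setEdgeCoins N (setEdgeCoins N w z) (getEdgeCoins hid w) = w := by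
  funext s v
  rw [setEdgeCoins]
  by_cases h : s.1 % 2 = 1
  · rw [if_pos h, setEdgeCoins, if_pos h]
    have e : (fun b => getEdgeCoins hid w ⟨s.1 / 2, by omega⟩
        ((Network.pairEquiv n).symm (v, b))) =
        fun b => levelDrawsEquiv M K 1 (w s v) ⟨N.id b, hid b⟩ 0 := by
      funext b
      simp only [getEdgeCoins, Equiv.apply_symm_apply]
      have : (⟨2 * (s.1 / 2) + 1, by omega⟩ : Fin (2 * T)) = s := Fin.ext (by simp only; omega)
      rw [this]
    rw [e]
    exact setRow_setRow _ _ hid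
  · rw [if_neg h, setEdgeCoins, if_neg h]

theorem levelCoins_setEdgeCoins (hid : ∀ b, N.id b < K) {T : ℕ}
    (w : Fin (2 * T) → Fin n → Fin (drawBound M K 1 + 1)) (z : Fin T → Fin (n ^ 2) → Fin (M + 1))
    {t : ℕ} (ht : t < T) (x : Fin (n ^ 2)) :
    levelCoins M K 1 (extendCoins (setEdgeCoins N w z) (2 * t + 1))
      (N.id (Network.pairEquiv n x).2) 0 (Network.pairEquiv n x).1 = z ⟨t, ht⟩ x := by
  have h := congrFun (congrFun (getEdgeCoins_setEdgeCoins hid w z) ⟨t, ht⟩) x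
  rw [levelCoins, dif_pos ⟨hid _, Nat.one_pos⟩,
    extendCoins_apply _ (show 2 * t + 1 < 2 * T by omega)]
  exact h

end EdgeDraws

theorem lineAlg_computes {A : AggAlg} {κ : ℕ} {n : ℕ} {N : Network n} (hid : N.IdBound κ)
    {p : ℕ → ℝ} {T : ℕ} (h : A.ComputesMIS (N.lineNetwork hid) T (p n)) :
    (lineAlg A κ fun n => p n < 1).Computes N N.IsLineGraphMIS (2 * T) (p n) := by
  refine ⟨fun ω t out hout => lineAlg_sound hid h.1 (fun hgo => ?_) hout, ?_⟩
  · obtain ⟨ω, out, ho⟩ := exists_of_coinProb_pos ((sub_pos.2 hgo).trans_le h.2)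
    exact ⟨ω, T, out, ho⟩
  by_cases hpn : 1 ≤ p n
  · exact (sub_nonpos.2 hpn).trans coinProb_nonneg
  refine le_coinProb_of_lens (getEdgeCoins_setEdgeCoins hid) (setEdgeCoins_getEdgeCoins hid)
    (fun w z ⟨out, ho⟩ => ?_) h.2
  refine lineAlg_halts (go := fun n => p n < 1) hid (show p n < 1 from not_le.1 hpn) fun x => ?_
  rw [AggAlg.run_congr (S := Set.univ) (ω' := extendCoins z) (fun _ _ _ _ => Set.mem_univ _)
    (fun r hr x _ => ?_) x (Set.mem_univ x), ho x]
  · rfl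
  · rw [extendCoins_apply z hr]
    exact levelCoins_setEdgeCoins hid w z hr x

/-- A 2-approximation from a local aggregation algorithm for maximal independent sets. -/
theorem exists_twoApprox_of_aggMIS (κ B : ℕ) (mis : AggAlg) (T : ℕ → ℕ → ℕ) (p : ℕ → ℝ)
    (hT : ∀ n, Monotone (T n)) (hp : ∀ n, 0 ≤ p n)
    (hmis : ∀ (n : ℕ) (H : Network n), H.IdBound κ →
      mis.SizeBound H (logBits B n) ∧ mis.ComputesMIS H (T n H.maxDegree) (p n)) :
    ∃ (A : MsgAlg) (B' : ℕ), ∀ (n : ℕ) (N : Network n) (W : ℕ),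
      N.IdBound κ → N.WeightBound W → W ≤ n ^ κ →
        A.MessageBound N (logBits B' n) ∧
        A.Computes N N.IsTwoApproxMatching
          (12 * ((T (n ^ 2) (2 * N.maxDegree - 2) + 1) * (Nat.log 2 W + 1)))
          (p (n ^ 2) * (Nat.log 2 W + 1)) := by
  -- The factor `3` comes from `log₂ (n ^ 2) + 1 ≤ 3 * (log₂ n + 1)`. With `2 * T` rounds for the
  -- black box, `6 * (2 * T + 1) ≤ 12 * (T + 1)` gives the final constant.
  obtain ⟨A, B', hA⟩ := exists_twoApprox_of_lineGraphMIS κ (3 * B)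
    (lineAlg mis κ fun n => p (n ^ 2) < 1) (fun n d => 2 * T (n ^ 2) (2 * d - 2))
    (fun n => p (n ^ 2))
    (fun n _ _ h => Nat.mul_le_mul_left 2 (hT _ (Nat.sub_le_sub_right (Nat.mul_le_mul_left 2 h) 2)))
    (fun n => hp _) fun n H hid _ => by
      obtain ⟨h1, h2⟩ := hmis (n ^ 2) (H.lineNetwork hid) Network.lineNetwork_idBound
      refine ⟨fun ω t v u hvu => (lineAlg_messageBound hid h1 ω t v u hvu).trans ?_,
        (lineAlg_computes (p := fun n => p (n ^ 2)) hid h2).mono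
          (Nat.mul_le_mul_left 2 (hT _ Network.lineNetwork_maxDegree_le))⟩
      have := log_pow_le n 2
      rw [logBits, logBits, mul_comm 3 B, mul_assoc]
      exact Nat.mul_le_mul_left B (by omega)
  refine ⟨A, B', fun n N W h1 h2 h3 => ⟨(hA n N W h1 h2 h3).1, (hA n N W h1 h2 h3).2.mono ?_⟩⟩
  rw [← mul_assoc, ← mul_assoc]
  exact Nat.mul_le_mul_right _ (by omega)

/-! ### Synchronous algorithms that exchange numbers -/

/-- Deterministic algorithms in which every node sends a number to each neighbour in every round; a node
that is done no longer changes its state, and repeats its messages. -/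
structure SyncAlg where
  State : Type
  init : LocalInput → State
  msg : State → ℕ → ℕ
  upd : State → (ℕ → ℕ) → State
  done : State → Prop

namespace SyncAlg

variable (A : SyncAlg) {n : ℕ} (N : Network n)

open Classical in
/-- The states after `t` rounds. -/
def run : ℕ → Fin n → A.State
  | 0 => fun v => A.init (N.localInput v)
  | t + 1 => fun v => if A.done (run t v) then run t v else
      A.upd (run t v) (N.pull (fun u => A.msg (run t u) (N.id v)) 0 v)

/-- The implementation by logs. -/
def toLogAlg : LogAlg where
  Entry := ℕ
  State := A.State
  enc := Nat.bits
  dec := ofBits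
  dec_enc := ofBits_bits
  maxCoin _ := 0
  init li _ := (A.init li, A.msg (A.init li))
  next s f := some (A.upd s fun i => (f i).getLast?.getD 0,
    A.msg (A.upd s fun i => (f i).getLast?.getD 0))
  done := A.done

variable {A N}

theorem run_succ_of_done {t : ℕ} {v : Fin n} (h : A.done (A.run N t v)) :
    A.run N (t + 1) v = A.run N t v := if_pos h

theorem run_succ_of_not_done {t : ℕ} {v : Fin n} (h : ¬ A.done (A.run N t v)) :
    A.run N (t + 1) v =
      A.upd (A.run N t v) (N.pull (fun u => A.msg (A.run N t u) (N.id v)) 0 v) := if_neg h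

/-- The last entry of a log is the current message; a node that is done appends nothing, so its last
message remains visible. -/
theorem toLogAlg_run (c : Fin n → ℕ) (t : ℕ) (v : Fin n) :
    (A.toLogAlg.run N c t v).1 = A.run N t v ∧
      (∀ j, (logTo (A.toLogAlg.run N c t v).2 j).getLast? = some (A.msg (A.run N t v) j)) ∧
      ∀ e ∈ (A.toLogAlg.run N c t v).2, ∃ t, e = A.msg (A.run N t v) := by
  induction t generalizing v with
  | zero =>
    refine ⟨rfl, fun j => rfl, fun e he => ⟨0, ?_⟩⟩
    exact List.mem_singleton.1 he
  | succ t ih =>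
    obtain ⟨h1, h2, h3⟩ := ih v
    by_cases hd : A.done (A.run N t v)
    · rw [LogAlg.run_succ_of_done (by rw [h1]; exact hd), run_succ_of_done hd]
      exact ⟨h1, h2, h3⟩
    · have hview : (fun i => (A.toLogAlg.view N (A.toLogAlg.run N c t) v i).getLast?.getD (0 : ℕ)) =
          N.pull (fun u => A.msg (A.run N t u) (N.id v)) 0 v := by
        funext i
        by_cases hi : ∃ u, N.graph.Adj v u ∧ N.id u = i
        · obtain ⟨u, hu, rfl⟩ := hi
          rw [LogAlg.view, Network.pull_id hu, Network.pull_id hu]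
          exact congrArg (fun x : Option ℕ => x.getD 0) ((ih u).2.1 (N.id v))
        · rw [LogAlg.view, Network.pull_of_not hi, Network.pull_of_not hi]
          rfl
      rw [LogAlg.run_succ_of_not_done (by rw [h1]; exact hd), run_succ_of_not_done hd]
      have hn : A.toLogAlg.next (A.toLogAlg.run N c t v).1
          (A.toLogAlg.view N (A.toLogAlg.run N c t) v) = some
          (A.upd (A.run N t v) (N.pull (fun u => A.msg (A.run N t u) (N.id v)) 0 v), A.msg
          (A.upd (A.run N t v) (N.pull (fun u => A.msg (A.run N t u) (N.id v)) 0 v))) := by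
        rw [← hview, ← h1]
        rfl
      rw [hn]
      refine ⟨rfl, fun j => ?_, fun e he => ?_⟩
      · refine (congrArg List.getLast? (logTo_append (E := ℕ) _ _ j)).trans ?_
        rw [List.getLast?_append]
        rfl
      · rcases List.mem_append.1 he with he | he
        · exact h3 e he
        · exact ⟨t + 1, by rw [List.mem_singleton.1 he, run_succ_of_not_done hd]⟩

end SyncAlg

/-! ### Halting immediately in trivial networks -/

namespace MsgAlg

/-- Halts before the first round if there is at most one node. -/
def haltSmall (A : MsgAlg) : MsgAlg where
  State := ℕ × A.State
  maxCoin := A.maxCoin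
  init li := (li.n, A.init li)
  send s := A.send s.2
  step s c inb := (s.1, A.step s.2 c inb)
  output s := if s.1 ≤ 1 then some none else A.output s.2

variable {A : MsgAlg} {n : ℕ} {N : Network n} {ω : Coins n (A.maxCoin n)}

theorem haltSmall_run (hn : 1 < n) (t : ℕ) (v : Fin n) :
    A.haltSmall.run N ω t v = (n, A.run N ω t v) := by
  induction t generalizing v with
  | zero => rfl
  | succ t ih =>
    have hmsg : (fun u j => A.haltSmall.msgOf (A.haltSmall.run N ω t u) (ω t u) j) =
        fun u j => A.msgOf (A.run N ω t u) (ω t u) j := by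
      funext u j
      rw [ih]
      show (if (if n ≤ 1 then some none else A.output _).isSome then _ else _) = _
      rw [if_neg hn.not_ge]
      rfl
    have hs : A.haltSmall.run N ω (t + 1) v =
        if (A.haltSmall.output (A.haltSmall.run N ω t v)).isSome then A.haltSmall.run N ω t v
        else A.haltSmall.step (A.haltSmall.run N ω t v) (ω t v)
          (N.inbox (fun u j => A.haltSmall.msgOf (A.haltSmall.run N ω t u) (ω t u) j) v) := rfl
    rw [hs, hmsg, ih, run_succ]
    show (if (if n ≤ 1 then some none else A.output _).isSome then _ else (n, _)) = _
    rw [if_neg hn.not_ge]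
    split_ifs <;> rfl

theorem haltSmall_messageBound {b : ℕ} (h : 1 < n → A.MessageBound N b) :
    A.haltSmall.MessageBound N b := by
  intro ω t v u hvu
  have hn : 1 < n := by
    have h1 := v.2
    have h2 := u.2
    have h3 : v.1 ≠ u.1 := fun e => hvu.ne (Fin.ext e)
    omega
  have : A.haltSmall.msgOf (A.haltSmall.run N ω t v) (ω t v) (N.id u) =
      A.msgOf (A.run N ω t v) (ω t v) (N.id u) := by
    have hr := haltSmall_run (A := A) (N := N) (ω := ω) hn t v
    rw [hr]
    show (if (if n ≤ 1 then some none else A.output _).isSome then _ else _) = _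
    rw [if_neg hn.not_ge]
    rfl
  rw [this]
  exact h hn ω t v u hvu

theorem haltSmall_haltedWith (hn : 1 < n) {t : ℕ} {out : Fin n → Option ℕ} :
    A.haltSmall.HaltedWith N ω t out ↔ A.HaltedWith N ω t out := by
  refine forall_congr' fun v => ?_
  have hr := haltSmall_run (A := A) (N := N) (ω := ω) hn t v
  rw [hr]
  show (if n ≤ 1 then some none else A.output _) = _ ↔ _
  rw [if_neg hn.not_ge]

/-- For `n ≤ 1` both `Δ` and `log* n` are zero, so the deterministic bound leaves no round at all.
-/
theorem haltSmall_haltedWith_of_le (hn : n ≤ 1) (t : ℕ) :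
    A.haltSmall.HaltedWith N ω t fun _ => none := by
  refine HaltedWith.mono (t := 0) (fun v => ?_) (Nat.zero_le t)
  exact if_pos hn

end MsgAlg

theorem Network.isTwoApproxMatching_of_le_one {n : ℕ} {N : Network n} (hn : n ≤ 1)
    {out : Fin n → Option ℕ} (hout : out = fun _ => none) : N.IsTwoApproxMatching out := by
  classical
  have hno : ∀ v u, ¬ N.graph.Adj v u := fun v u hvu => by
    have h1 := v.2
    have h2 := u.2
    have h3 : v.1 ≠ u.1 := fun e => hvu.ne (Fin.ext e)
    omega
  refine ⟨⊥, ?_, ?_, fun M' _ => ?_⟩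
  · intro v hv
    exact absurd hv (Set.notMem_empty v)
  · intro v i
    rw [hout]
    constructor
    · intro h
      exact absurd h (by simp)
    · rintro ⟨u, hu, -⟩
      exact absurd hu.adj_sub (hno v u)
  · refine le_trans (le_of_eq ?_) (Nat.zero_le _)
    refine Finset.sum_eq_zero fun e he => ?_
    have he' := (Finset.mem_filter.1 he).2
    induction e with
    | h v u => exact absurd (M'.adj_sub he') (hno v u)

/-! ### Colour reduction -/

open Classical in
/-- The new colour of a node with colour `a` whose parent has colour `b`. -/
def reduceColor (a b : ℕ) : ℕ :=
  if h : ∃ i, a.testBit i ≠ b.testBit i then 2 * Nat.find h + (a.testBit (Nat.find h)).toNat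
  else a % 2

theorem exists_testBit_ne {a b : ℕ} (h : a ≠ b) : ∃ i, a.testBit i ≠ b.testBit i := by
  by_contra! hcon
  exact h (Nat.eq_of_testBit_eq hcon)

/-- Equal new colours would have equal bit positions and equal bits, so `a` and `b` would agree at
the very position where they differ. -/
theorem reduceColor_ne {a b c : ℕ} (hab : a ≠ b) (hbc : b ≠ c) :
    reduceColor a b ≠ reduceColor b c := by
  have h1 := exists_testBit_ne hab
  have h2 := exists_testBit_ne hbc
  rw [reduceColor, reduceColor, dif_pos h1, dif_pos h2]
  intro h
  have h3 := Bool.toNat_lt (a.testBit (Nat.find h1))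
  have h4 := Bool.toNat_lt (b.testBit (Nat.find h2))
  have h5 : Nat.find h1 = Nat.find h2 := by omega
  have h6 : (a.testBit (Nat.find h1)).toNat = (b.testBit (Nat.find h2)).toNat := by omega
  refine Nat.find_spec h1 ?_
  rw [← h5] at h6
  revert h6
  cases a.testBit (Nat.find h1) <;> cases b.testBit (Nat.find h1) <;> simp

/-- A root takes `b % 2`, as if it differed from a fictitious parent in bit `0`; the argument of
`reduceColor_ne` then applies. -/
theorem reduceColor_ne_mod_two {a b : ℕ} (hab : a ≠ b) : reduceColor a b ≠ b % 2 := by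
  have h1 := exists_testBit_ne hab
  rw [reduceColor, dif_pos h1]
  intro h
  have h5 : Nat.find h1 = 0 := by omega
  have h2 := Nat.find_spec h1
  rw [h5] at h h2
  apply h2
  rw [Nat.mul_zero, Nat.zero_add] at h
  rw [Nat.testBit_zero b]
  revert h
  cases a.testBit 0 <;> rcases Nat.mod_two_eq_zero_or_one b with hb | hb <;> simp [hb]

theorem reduceColor_lt {a b q : ℕ} (ha : a < 2 ^ q) (hb : b < 2 ^ q) :
    reduceColor a b < 2 * q + 2 := by
  rw [reduceColor]
  split_ifs with h
  · have h1 : Nat.find h < q := by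
      by_contra! hcon
      refine Nat.find_spec h ?_
      have := Nat.pow_le_pow_right (n := 2) Nat.two_pos hcon
      rw [Nat.testBit_lt_two_pow (ha.trans_le this), Nat.testBit_lt_two_pow (hb.trans_le this)]
    have h2 := Bool.toNat_lt (a.testBit (Nat.find h))
    omega
  · omega

/-- A bound on the colours after `k` rounds of colour reduction. -/
def paletteBound (m : ℕ) : ℕ → ℕ
  | 0 => m
  | k + 1 => 2 * Nat.clog 2 (paletteBound m k) + 2

theorem clog_mul_le (a b : ℕ) : Nat.clog 2 (a * b) ≤ Nat.clog 2 a + Nat.clog 2 b := by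
  refine Nat.clog_le_of_le_pow ?_
  rw [pow_add]
  exact Nat.mul_le_mul (Nat.le_pow_clog Nat.one_lt_two a) (Nat.le_pow_clog Nat.one_lt_two b)

theorem clog_pow_le (n κ : ℕ) : Nat.clog 2 (n ^ κ) ≤ κ * Nat.clog 2 n := by
  refine Nat.clog_le_of_le_pow ?_
  rw [mul_comm, pow_mul]
  exact Nat.pow_le_pow_left (Nat.le_pow_clog Nat.one_lt_two n) κ

theorem two_mul_add_twelve_le (κ : ℕ) : 2 * κ + 12 ≤ 2 ^ (κ + 4) := by
  induction κ with
  | zero => norm_num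
  | succ κ ih => rw [show κ + 1 + 4 = κ + 4 + 1 by ring, pow_succ]; omega

/-- With `x` the iterated logarithm, a palette of size `2 ^ (κ + 4) * x` becomes one of size at most
`2 * (κ + 4 + clog x) + 2 ≤ (2 * κ + 12) * max (clog x) 1`. The constant reproduces itself because
`2 * κ + 12 ≤ 2 ^ (κ + 4)`. -/
theorem paletteBound_le (n κ k : ℕ) : paletteBound (n ^ κ) (k + 1) ≤
    2 ^ (κ + 4) * max ((Nat.clog 2)^[k + 1] n) 1 := by
  have hD := two_mul_add_twelve_le κ
  induction k with
  | zero =>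
    rw [paletteBound, paletteBound, Function.iterate_one]
    have h1 := clog_pow_le n κ
    have h2 : Nat.clog 2 n ≤ max (Nat.clog 2 n) 1 := le_max_left _ _
    have h3 : 1 ≤ max (Nat.clog 2 n) 1 := le_max_right _ _
    calc 2 * Nat.clog 2 (n ^ κ) + 2 ≤ 2 * (κ * max (Nat.clog 2 n) 1) + 2 * max (Nat.clog 2 n) 1 := by
          have := Nat.mul_le_mul_left κ h2
          omega
      _ = (2 * κ + 2) * max (Nat.clog 2 n) 1 := by ring
      _ ≤ _ := Nat.mul_le_mul_right _ (by omega)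
  | succ k ih =>
    rw [paletteBound, Function.iterate_succ_apply']
    set x := (Nat.clog 2)^[k + 1] n with hx
    have h1 : Nat.clog 2 (paletteBound (n ^ κ) (k + 1)) ≤ κ + 4 + Nat.clog 2 (max x 1) := by
      refine (Nat.clog_mono_right 2 ih).trans ((clog_mul_le _ _).trans ?_)
      rw [Nat.clog_pow 2 _ Nat.one_lt_two]
    have h2 : Nat.clog 2 (max x 1) ≤ Nat.clog 2 x := by
      rcases Nat.eq_zero_or_pos x with h | h
      · rw [h]; simp
      · rw [max_eq_left h]
    have h3 : Nat.clog 2 x ≤ max (Nat.clog 2 x) 1 := le_max_left _ _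
    have h4 : 1 ≤ max (Nat.clog 2 x) 1 := le_max_right _ _
    calc _ ≤ (2 * κ + 10) * max (Nat.clog 2 x) 1 + 2 * max (Nat.clog 2 x) 1 := by
          have := Nat.mul_le_mul_left (2 * κ + 10) h4
          omega
      _ = (2 * κ + 12) * max (Nat.clog 2 x) 1 := by ring
      _ ≤ _ := Nat.mul_le_mul_right _ hD

theorem clog_iterate_logStar (n : ℕ) : (Nat.clog 2)^[logStar n] n ≤ 1 := by
  refine Nat.sInf_mem (s := {k | (Nat.clog 2)^[k] n ≤ 1}) ?_
  induction n using Nat.strong_induction_on with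
  | _ n ih =>
    by_cases hn : n ≤ 1
    · exact ⟨0, hn⟩
    · have : Nat.clog 2 n < n := by
        have : Nat.clog 2 n ≤ n - 1 := Nat.clog_le_of_le_pow (by
          have := Nat.lt_two_pow_self (n := n - 1)
          omega)
        omega
      obtain ⟨k, hk⟩ := ih _ this
      exact ⟨k + 1, by rw [Set.mem_ofPred_eq, Function.iterate_succ_apply]; exact hk⟩

theorem logStar_pos {n : ℕ} (hn : 1 < n) : 0 < logStar n := by
  by_contra! h
  have := clog_iterate_logStar n
  rw [Nat.le_zero.1 h] at this
  simp only [Function.iterate_zero, id_eq] at this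
  omega

theorem paletteBound_logStar_le {n : ℕ} (hn : 1 < n) (κ : ℕ) :
    paletteBound (n ^ κ) (logStar n) ≤ 2 ^ (κ + 4) := by
  obtain ⟨k, hk⟩ : ∃ k, logStar n = k + 1 := ⟨logStar n - 1, by have := logStar_pos hn; omega⟩
  have := paletteBound_le n κ k
  rwa [← hk, max_eq_right (clog_iterate_logStar n), mul_one] at this

/-! ### Pushing the edges of a star -/

/-- The edges pushed, with amounts, when the edges from a centre with potential `p` to nodes with
potentials `y` are considered one by one; the weights are `w`. -/
def pushes {α : Type*} (w y : α → ℕ) : ℕ → List α → List (α × ℕ)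
  | _, [] => []
  | p, a :: l => if w a ≤ y a + p then pushes w y p l
      else (a, w a - (y a + p)) :: pushes w y (p + (w a - (y a + p))) l

section Pushes

variable {α β : Type*} {w y : α → ℕ} {p : ℕ} {l : List α}

theorem pushes_map (f : β → α) (l : List β) : pushes w y p (l.map f) =
    (pushes (w ∘ f) (y ∘ f) p l).map (Prod.map f id) := by
  induction l generalizing p with
  | nil => rfl
  | cons b l ih =>
    simp only [List.map_cons, pushes, Function.comp_apply]
    split_ifs
    · exact ih
    · rw [List.map_cons, ih]
      rfl

theorem pushes_sublist : ((pushes w y p l).map Prod.fst).Sublist l := by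
  induction l generalizing p with
  | nil => exact List.Sublist.slnil
  | cons b l ih =>
    rw [pushes]
    split_ifs
    · exact ih.cons _
    · exact ih.cons_cons _

/-- The amount is the residual weight at the moment of the push, when the potential of the centre
has grown by the earlier amounts `P`. -/
theorem pushes_append {P Q : List (α × ℕ)} {a : α} {r : ℕ}
    (h : pushes w y p l = P ++ (a, r) :: Q) :
    0 < r ∧ r + (P.map Prod.snd).sum + p + y a = w a := by
  induction l generalizing p P with
  | nil => simp [pushes] at h
  | cons b l ih =>
    rw [pushes] at h
    split_ifs at h with hb
    · exact ih h
    · rcases P with _ | ⟨c, P⟩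
      · simp only [List.nil_append, List.cons.injEq, Prod.mk.injEq] at h
        obtain ⟨⟨rfl, rfl⟩, -⟩ := h
        simp only [List.map_nil, List.sum_nil]
        omega
      · simp only [List.cons_append, List.cons.injEq] at h
        obtain ⟨rfl, h⟩ := h
        obtain ⟨h1, h2⟩ := ih h
        simp only [List.map_cons, List.sum_cons]
        omega

/-- An edge is skipped because it is covered, or is covered by its own push; the potential of the
centre never decreases afterwards. -/
theorem le_of_mem_pushes {a : α} (ha : a ∈ l) :
    w a ≤ y a + (p + ((pushes w y p l).map Prod.snd).sum) := by
  induction l generalizing p with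
  | nil => exact absurd ha List.not_mem_nil
  | cons b l ih =>
    rw [pushes]
    split_ifs with hb
    · rcases List.mem_cons.1 ha with rfl | ha
      · omega
      · exact ih ha
    · simp only [List.map_cons, List.sum_cons]
      rcases List.mem_cons.1 ha with rfl | ha
      · omega
      · have := ih (p := p + (w b - (y b + p))) ha
        omega

theorem lookup_of_mem [DecidableEq α] {l : List (α × ℕ)} (hl : (l.map Prod.fst).Nodup) {a : α}
    {r : ℕ} (h : (a, r) ∈ l) : l.lookup a = some r := by
  induction l with
  | nil => exact absurd h List.not_mem_nil
  | cons b l ih =>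
    rw [List.map_cons, List.nodup_cons] at hl
    rcases List.mem_cons.1 h with rfl | h
    · simp
    · have hne : a ≠ b.1 := by
        rintro rfl
        exact hl.1 (List.mem_map.2 ⟨_, h, rfl⟩)
      rw [List.lookup_cons, beq_false_of_ne hne]
      exact ih hl.2 h

theorem lookup_eq_none [DecidableEq α] {l : List (α × ℕ)} {a : α} (h : a ∉ l.map Prod.fst) :
    l.lookup a = none := by
  induction l with
  | nil => rfl
  | cons b l ih =>
    rw [List.map_cons, List.mem_cons, not_or] at h
    rw [List.lookup_cons, beq_false_of_ne h.1]
    exact ih h.2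

theorem lookup_map [DecidableEq α] [DecidableEq β] {f : β → α} (hf : Function.Injective f)
    (l : List (β × ℕ)) (b : β) : (l.map (Prod.map f id)).lookup (f b) = l.lookup b := by
  induction l with
  | nil => rfl
  | cons c l ih =>
    rw [List.map_cons, List.lookup_cons, List.lookup_cons]
    by_cases h : b = c.1
    · subst h; simp
    · rw [beq_false_of_ne h, beq_false_of_ne (fun h' : f b = (Prod.map f id c).1 => h (hf h'))]
      exact ih

end Pushes

namespace Network

variable {n : ℕ} {N : Network n}

section

variable (N) (Y : Fin n → ℕ) (cl : Fin n → List (Fin n))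

/-- The edges pushed in the stars with centre `v` and leaves `cl v`. -/
def starPushes (v : Fin n) : List (Fin n × ℕ) :=
  pushes (fun u => N.weight s(v, u)) Y (Y v) (cl v)

/-- The new mates of the centre `v`. -/
def starMates (v : Fin n) : List (Fin n) := (N.starPushes Y cl v).map Prod.fst

/-- The amount pushed on the edge from the centre `v` to the leaf `u`. -/
def starAmount (v u : Fin n) : ℕ := ((N.starPushes Y cl v).lookup u).getD 0

end

/-- A leaf has at most one pushed edge, so its potential is unaffected by the other edges of the
star. The order in which the centre treats its edges is then the only one that matters, and it is
reversed on the stack of the centre, where the last push comes first. -/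
theorem StarStacks.push_stars {st : Fin n → List (Fin n)} {R σ : Fin n → Fin n → ℕ}
    {Y Y' : Fin n → ℕ} {s : ℕ} (h : N.StarStacks st R σ Y s) {cl par : Fin n → List (Fin n)}
    (hnd : ∀ v, (cl v).Nodup) (hadj : ∀ {v u}, u ∈ cl v → N.graph.Adj v u)
    (hleaf : ∀ {v u}, u ∈ cl v → cl u = []) (huniq : ∀ {v v' u}, u ∈ cl v → u ∈ cl v' → v = v')
    (hpar : ∀ v u, u ∈ par v ↔ v ∈ N.starMates Y cl u) (hpnd : ∀ v, (par v).Nodup)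
    (hY : ∀ v, Y' v = Y v + ((N.starPushes Y cl v).map Prod.snd).sum +
      ((par v).map fun u => N.starAmount Y cl u v).sum) :
    (∃ R' σ', N.StarStacks (fun v => (par v ++ (N.starMates Y cl v).reverse) ++ st v) R' σ' Y'
      (s + 1)) ∧ ∀ v, ∀ u ∈ cl v, N.weight s(v, u) ≤ Y' v + Y' u := by
  have hsub : ∀ {v u}, u ∈ N.starMates Y cl v → u ∈ cl v := fun hu => pushes_sublist.subset hu
  have hMnd : ∀ v, (N.starMates Y cl v).Nodup := fun v => (hnd v).sublist pushes_sublist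
  have hempty : ∀ {u}, cl u = [] → N.starPushes Y cl u = [] := by
    intro u hu
    rw [starPushes, hu, pushes]
  have hempty' : ∀ {u}, cl u = [] → N.starMates Y cl u = [] := by
    intro u hu
    rw [starMates, hempty hu]
    rfl
  have hamt0 : ∀ {u}, cl u = [] → ∀ v, N.starAmount Y cl u v = 0 := by
    intro u hu v
    rw [starAmount, hempty hu]
    rfl
  have hamt : ∀ {v u r}, (u, r) ∈ N.starPushes Y cl v → N.starAmount Y cl v u = r := by
    intro v u r hu
    rw [starAmount, lookup_of_mem (hMnd v) hu]
    rfl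
  have hcentre : ∀ {v u}, u ∈ N.starMates Y cl v → par v = [] ∧ par u = [v] ∧
      N.starMates Y cl u = [] := by
    intro v u hu
    have hu' := hsub hu
    have h1 : par v = [] := by
      refine List.eq_nil_iff_forall_not_mem.2 fun q hq => ?_
      have := hleaf (hsub ((hpar v q).1 hq))
      rw [this] at hu'
      exact absurd hu' List.not_mem_nil
    have h2 : ∀ x ∈ par u, x = v := fun x hx => huniq (hsub ((hpar u x).1 hx)) hu'
    have h3 : v ∈ par u := (hpar u v).2 hu
    refine ⟨h1, ?_, hempty' (hleaf hu')⟩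
    have h4 := hpnd u
    rcases hp : par u with _ | ⟨x, _ | ⟨z, l⟩⟩
    · rw [hp] at h3; exact absurd h3 List.not_mem_nil
    · rw [h2 x (by rw [hp]; simp)]
    · exfalso
      rw [hp] at h4 h2
      rw [h2 x (by simp), h2 z (by simp)] at h4
      simp at h4
  set a : Fin n → List (Fin n) := fun v => par v ++ (N.starMates Y cl v).reverse with ha
  have hcases : ∀ {v u}, u ∈ a v →
      (u ∈ N.starMates Y cl v ∧ a v = (N.starMates Y cl v).reverse ∧ a u = [v]) ∨
      (v ∈ N.starMates Y cl u ∧ a u = (N.starMates Y cl u).reverse ∧ a v = [u]) := by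
    intro v u hu
    rcases List.mem_append.1 hu with hu | hu
    · right
      rw [hpar] at hu
      obtain ⟨h1, h2, h3⟩ := hcentre hu
      exact ⟨hu, by simp [ha, h1], by simp [ha, h2, h3]⟩
    · left
      rw [List.mem_reverse] at hu
      obtain ⟨h1, h2, h3⟩ := hcentre hu
      exact ⟨hu, by simp [ha, h1], by simp [ha, h2, h3]⟩
  -- At most one summand is nonzero, as leaves are not centres; the sum makes the amount symmetric.
  let r : Fin n → Fin n → ℕ := fun v u => N.starAmount Y cl v u + N.starAmount Y cl u v
  have hr : ∀ {v u}, u ∈ cl v → r v u = N.starAmount Y cl v u := by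
    intro v u hu
    show _ + _ = _
    rw [hamt0 (hleaf hu), Nat.add_zero]
  have hsplit : ∀ {v q p u}, N.starMates Y cl v = q ++ u :: p →
      0 < r v u ∧ r v u + (q.map (r v)).sum + Y v + Y u = N.weight s(v, u) := by
    intro v q p u hM
    obtain ⟨P, Q, hP, hPq, hQ⟩ := List.map_eq_append_iff.1 hM
    obtain ⟨⟨x, r₀⟩, Q', rfl, hx, -⟩ := List.map_eq_cons_iff.1 hQ
    change x = u at hx
    subst hx
    obtain ⟨h1, h2⟩ := pushes_append hP
    have hmem : x ∈ cl v := hsub (by rw [hM]; simp)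
    have h3 : r v x = r₀ := by rw [hr hmem, hamt (r := r₀) (by rw [hP]; simp)]
    have h4 : (q.map (r v)).sum = (P.map Prod.snd).sum := by
      rw [← hPq, List.map_map]
      congr 1
      refine List.map_congr_left fun e he => ?_
      have he' : e ∈ N.starPushes Y cl v := by rw [hP]; simp [he]
      show r v e.1 = e.2
      rw [hr (hsub (List.mem_map_of_mem he')), hamt he']
    rw [h3, h4]
    exact ⟨h1, h2⟩
  have hsum : ∀ v, ((a v).map (r v)).sum = ((N.starPushes Y cl v).map Prod.snd).sum +
      ((par v).map fun u => N.starAmount Y cl u v).sum := by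
    intro v
    rw [ha, List.map_append, List.sum_append, List.map_reverse, List.sum_reverse, add_comm]
    congr 1
    · rw [starMates, List.map_map]
      congr 1
      refine List.map_congr_left fun e he => ?_
      show r v e.1 = e.2
      rw [hr (hsub (List.mem_map_of_mem he)), hamt he]
    · congr 1
      refine List.map_congr_left fun u hu => ?_
      have := hsub ((hpar v u).1 hu)
      show N.starAmount Y cl v u + N.starAmount Y cl u v = _
      rw [hamt0 (hleaf this), Nat.zero_add]
  have hY' : ∀ v, Y' v = Y v + ((a v).map (r v)).sum := by
    intro v
    rw [hY, hsum]
    omega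
  have hcover : ∀ v, ∀ u ∈ cl v, N.weight s(v, u) ≤ Y' v + Y' u := by
    intro v u hu
    have : N.weight s(v, u) ≤ Y u + (Y v + ((N.starPushes Y cl v).map Prod.snd).sum) :=
      le_of_mem_pushes (w := fun u => N.weight s(v, u)) hu
    rw [hY v, hY' u]
    omega
  have hcover' : ∀ v, ∀ u ∈ a v, N.weight s(v, u) ≤ Y' v + Y' u := by
    intro v u hu
    rcases hcases hu with ⟨h1, -, -⟩ | ⟨h1, -, -⟩
    · exact hcover v u (hsub h1)
    · rw [Sym2.eq_swap, add_comm]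
      exact hcover u v (hsub h1)
  have hrsymm : ∀ v u, r v u = r u v := fun v u => add_comm _ _
  refine ⟨h.push a r ?_ ?_ ?_ hrsymm ?_ ?_ hY' hcover' ?_, hcover⟩
  · intro v
    rcases hav : a v with _ | ⟨u, l⟩
    · exact List.nodup_nil
    · rw [← hav]
      rcases hcases (show u ∈ a v by rw [hav]; simp) with ⟨-, h2, -⟩ | ⟨-, -, h2⟩
      · rw [h2]; exact List.nodup_reverse.2 (hMnd v)
      · rw [h2]; simp
  · intro v u hu
    rcases hcases hu with ⟨h1, -, -⟩ | ⟨h1, -, -⟩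
    · exact hadj (hsub h1)
    · exact (hadj (hsub h1)).symm
  · intro v u hu
    rcases hcases hu with ⟨-, -, h1⟩ | ⟨h1, h2, -⟩
    · rw [h1]; simp
    · rw [h2]; simpa using h1
  · intro v u hu
    rcases hcases hu with ⟨h1, -, -⟩ | ⟨h1, -, -⟩
    · obtain ⟨q, p, hM⟩ := List.append_of_mem h1
      have := hsplit hM
      omega
    · obtain ⟨q, p, hM⟩ := List.append_of_mem h1
      have := hsplit hM
      rw [Sym2.eq_swap]
      omega
  · have key : ∀ v u p q p' q', u ∈ N.starMates Y cl v → a v = (N.starMates Y cl v).reverse →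
        a u = [v] → a v = p ++ u :: q → a u = p' ++ v :: q' →
        r v u + (q.map (r v)).sum + (q'.map (r u)).sum + Y v + Y u ≤ N.weight s(v, u) := by
      intro v u p q p' q' _ h2 h3 h4 h5
      have hq' : q' = [] := by
        rw [h3] at h5
        have := congrArg List.length h5
        simp only [List.length_cons, List.length_nil, List.length_append] at this
        exact List.eq_nil_of_length_eq_zero (by omega)
      have hM : N.starMates Y cl v = q.reverse ++ u :: p.reverse := by
        rw [← List.reverse_reverse (N.starMates Y cl v), ← h2, h4]
        simp
      have := hsplit hM
      rw [List.map_reverse, List.sum_reverse] at this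
      rw [hq', List.map_nil, List.sum_nil]
      omega
    intro v u p q p' q' h1 h2
    rcases hcases (show u ∈ a v by rw [h1]; simp) with ⟨h3, h4, h5⟩ | ⟨h3, h4, h5⟩
    · exact key v u p q p' q' h3 h4 h5 h1 h2
    · have := key u v p' q' p q h3 h4 h5 h2 h1
      rw [Sym2.eq_swap, hrsymm]
      omega
  · intro v u hu
    rcases hcases hu with ⟨-, -, h1⟩ | ⟨-, -, h1⟩
    · exact Or.inr h1
    · exact Or.inl h1

end Network

/-! ### The deterministic algorithm -/

/-- The index of the neighbour `j` among the neighbours with larger identifiers. -/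
def LocalInput.ownIdx (li : LocalInput) (j : ℕ) : ℕ :=
  (li.nbrs.filter fun i => li.id < i ∧ i < j).card

/-- The state of a node. In the forest number `i`, the parent of a node is the neighbour with a
larger identifier and index `i`. A node knows the indices `idx` of the edges from its children, its
colours `col` in the forests, and the colours `pcol` of its parents (each in the forest in question),
and keeps a potential, a stack, and the amounts pushed on edges to children. -/
structure StarState where
  li : LocalInput
  time : ℕ
  idx : ℕ → ℕ
  col : ℕ → ℕ
  pcol : ℕ → ℕ
  pot : ℕ
  stk : List ℕ
  amt : ℕ → ℕ

namespace StarState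

variable (D : ℕ) (x : StarState) (inb : ℕ → ℕ)

/-- The step in which the edge to `j` is considered. -/
def stepOf (j : ℕ) : ℕ :=
  if j < x.li.id then x.idx j * D + x.col (x.idx j) else x.li.ownIdx j * D + x.pcol j

/-- All incident edges have been considered. -/
def Done : Prop := ∀ j ∈ x.li.nbrs, logStar x.li.n + 2 + 2 * x.stepOf D j + 2 ≤ x.time

open Classical in
/-- One round of colour reduction. -/
def newCol : ℕ → ℕ := fun i =>
  if h : ∃ j ∈ x.li.nbrs, x.li.id < j ∧ x.li.ownIdx j = i then reduceColor (x.col i) (inb h.choose)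
  else x.col i % 2

/-- The children whose edges are considered in step `s`. -/
def children (s : ℕ) : List ℕ :=
  (x.li.nbrs.filter fun j => j < x.li.id ∧ x.stepOf D j = s).toList

/-- The parents to which edges are pushed in step `s`. -/
def parents (s : ℕ) : List ℕ :=
  (x.li.nbrs.filter fun j => x.li.id < j ∧ x.stepOf D j = s ∧ 0 < inb j).toList

/-- The pushes of a centre in step `s`. -/
def centrePushes (s : ℕ) : List (ℕ × ℕ) := pushes x.li.weight inb x.pot (x.children D s)

/-- A centre receives the potentials of its leaves. -/
def centre (s : ℕ) : StarState :=
  { x with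
    time := x.time + 1
    pot := x.pot + ((x.centrePushes D inb s).map Prod.snd).sum
    stk := ((x.centrePushes D inb s).map Prod.fst).reverse ++ x.stk
    amt := fun j => ((x.centrePushes D inb s).lookup j).getD 0 }

/-- A leaf receives the amount pushed. -/
def leaf (s : ℕ) : StarState :=
  { x with
    time := x.time + 1
    pot := x.pot + ((x.parents D inb s).map inb).sum
    stk := x.parents D inb s ++ x.stk }

open Classical in
/-- Messages. -/
def msg (j : ℕ) : ℕ :=
  if x.Done D then 0
  else if x.time = 0 then if x.li.id < j then x.li.ownIdx j else 0
  else if x.time < logStar x.li.n + 2 then if j < x.li.id then x.col (x.idx j) else 0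
  else if (x.time - (logStar x.li.n + 2)) % 2 = 0 then x.pot else x.amt j

/-- Transitions. -/
def upd : StarState :=
  if x.time = 0 then { x with time := x.time + 1, idx := inb }
  else if x.time < logStar x.li.n + 1 then { x with time := x.time + 1, col := x.newCol inb }
  else if x.time = logStar x.li.n + 1 then { x with time := x.time + 1, pcol := inb }
  else if (x.time - (logStar x.li.n + 2)) % 2 = 0 then
    x.centre D inb ((x.time - (logStar x.li.n + 2)) / 2)
  else x.leaf D inb ((x.time - (logStar x.li.n + 2)) / 2)

variable {D x inb}

theorem upd_color (h0 : x.time ≠ 0) (ht : x.time < logStar x.li.n + 1) :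
    x.upd D inb = { x with time := x.time + 1, col := x.newCol inb } :=
  (if_neg h0).trans (if_pos ht)

theorem upd_parent (ht : x.time = logStar x.li.n + 1) :
    x.upd D inb = { x with time := x.time + 1, pcol := inb } :=
  (if_neg (by omega)).trans ((if_neg (by omega)).trans (if_pos ht))

theorem upd_centre {s : ℕ} (ht : x.time = logStar x.li.n + 2 + 2 * s) :
    x.upd D inb = x.centre D inb s := by
  refine (if_neg (by omega)).trans ((if_neg (by omega)).trans ((if_neg (by omega)).trans
    ((if_pos (by omega)).trans ?_)))
  rw [show (x.time - (logStar x.li.n + 2)) / 2 = s by omega]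

theorem upd_leaf {s : ℕ} (ht : x.time = logStar x.li.n + 2 + 2 * s + 1) :
    x.upd D inb = x.leaf D inb s := by
  refine (if_neg (by omega)).trans ((if_neg (by omega)).trans ((if_neg (by omega)).trans
    ((if_neg (by omega)).trans ?_)))
  rw [show (x.time - (logStar x.li.n + 2)) / 2 = s by omega]

variable {j : ℕ}

theorem msg_zero (hd : ¬ x.Done D) (ht : x.time = 0) : x.msg D j = if x.li.id < j then x.li.ownIdx j else 0 :=
  (if_neg hd).trans (if_pos ht)

theorem msg_color (hd : ¬ x.Done D) (h0 : x.time ≠ 0) (ht : x.time < logStar x.li.n + 2) :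
    x.msg D j = if j < x.li.id then x.col (x.idx j) else 0 :=
  (if_neg hd).trans ((if_neg h0).trans (if_pos ht))

theorem msg_pot (hd : ¬ x.Done D) {s : ℕ} (ht : x.time = logStar x.li.n + 2 + 2 * s) : x.msg D j = x.pot :=
  (if_neg hd).trans ((if_neg (by omega)).trans ((if_neg (by omega)).trans (if_pos (by omega))))

theorem msg_amt (hd : ¬ x.Done D) {s : ℕ} (ht : x.time = logStar x.li.n + 2 + 2 * s + 1) : x.msg D j = x.amt j :=
  (if_neg hd).trans ((if_neg (by omega)).trans ((if_neg (by omega)).trans (if_neg (by omega))))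

end StarState

/-- The deterministic algorithm, with `D` colours. -/
def starAlg (D : ℕ) : SyncAlg where
  State := StarState
  init li := ⟨li, 0, fun _ => 0, fun _ => li.id, fun _ => 0, 0, [], fun _ => 0⟩
  msg x j := x.msg D j
  upd x inb := x.upd D inb
  done x := x.Done D

namespace Network

variable {n : ℕ} (N : Network n)

/-- The index of the edge from `v` to a neighbour `u` with larger identifier. -/
def parentIdx (v u : Fin n) : ℕ := (N.localInput v).ownIdx (N.id u)

open Classical in
/-- The colour of `v` in the forest number `i` after `k` rounds of colour reduction. -/
def forestColor : ℕ → Fin n → ℕ → ℕ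
  | 0 => fun v _ => N.id v
  | k + 1 => fun v i =>
      if h : ∃ u, N.graph.Adj v u ∧ N.id v < N.id u ∧ N.parentIdx v u = i then
        reduceColor (forestColor k v i) (forestColor k h.choose i)
      else forestColor k v i % 2

variable {N}

theorem ownIdx_injective {v : Fin n} {i j : ℕ} (hi : i ∈ (N.localInput v).nbrs)
    (hj : j ∈ (N.localInput v).nbrs) (hvi : N.id v < i) (hvj : N.id v < j)
    (h : (N.localInput v).ownIdx i = (N.localInput v).ownIdx j) : i = j := by
  have key : ∀ {i j}, i ∈ (N.localInput v).nbrs → N.id v < i → i < j →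
      (N.localInput v).ownIdx i < (N.localInput v).ownIdx j := by
    intro i j hi hvi hij
    refine Finset.card_lt_card (Finset.ssubset_iff_of_subset ?_ |>.2 ⟨i, ?_, ?_⟩)
    · intro a ha
      rw [Finset.mem_filter] at ha ⊢
      exact ⟨ha.1, ha.2.1, ha.2.2.trans hij⟩
    · exact Finset.mem_filter.2 ⟨hi, hvi, hij⟩
    · intro h
      exact lt_irrefl _ (Finset.mem_filter.1 h).2.2
  rcases lt_trichotomy i j with h' | h' | h'
  · exact absurd h (key hi hvi h').ne
  · exact h'
  · exact absurd h (key hj hvj h').ne'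

theorem parentIdx_injective {v u u' : Fin n} (hu : N.graph.Adj v u) (hu' : N.graph.Adj v u')
    (hlt : N.id v < N.id u) (hlt' : N.id v < N.id u') (h : N.parentIdx v u = N.parentIdx v u') :
    u = u' :=
  N.id_injective (ownIdx_injective (id_mem_nbrs.2 hu) (id_mem_nbrs.2 hu') hlt hlt' h)

theorem parentIdx_lt {v u : Fin n} (hu : N.graph.Adj v u) : N.parentIdx v u < N.maxDegree := by
  classical
  have h1 : N.parentIdx v u < (N.localInput v).nbrs.card := by
    refine Finset.card_lt_card (Finset.ssubset_iff_of_subset (Finset.filter_subset _ _) |>.2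
      ⟨N.id u, id_mem_nbrs.2 hu, fun h => lt_irrefl _ (Finset.mem_filter.1 h).2.2⟩)
  refine h1.trans_le (le_trans ?_ (SimpleGraph.degree_le_maxDegree _ v))
  have h2 : (N.localInput v).nbrs ⊆ (N.graph.neighborFinset v).image N.id := by
    intro i hi
    obtain ⟨u, hu, rfl⟩ := mem_nbrs.1 hi
    exact Finset.mem_image_of_mem _ ((SimpleGraph.mem_neighborFinset _ _ _).2 hu)
  exact (Finset.card_le_card h2).trans Finset.card_image_le

theorem forestColor_succ_parent {k i : ℕ} {v u : Fin n} (hu : N.graph.Adj v u)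
    (hlt : N.id v < N.id u) (hi : N.parentIdx v u = i) : N.forestColor (k + 1) v i =
      reduceColor (N.forestColor k v i) (N.forestColor k u i) := by
  have h : ∃ u, N.graph.Adj v u ∧ N.id v < N.id u ∧ N.parentIdx v u = i := ⟨u, hu, hlt, hi⟩
  have h' := h.choose_spec
  refine (dif_pos h).trans ?_
  rw [parentIdx_injective h'.1 hu h'.2.1 hlt (h'.2.2.trans hi.symm)]

theorem forestColor_succ_root {k i : ℕ} {v : Fin n}
    (h : ¬ ∃ u, N.graph.Adj v u ∧ N.id v < N.id u ∧ N.parentIdx v u = i) :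
    N.forestColor (k + 1) v i = N.forestColor k v i % 2 := by
  exact dif_neg h

/-- Colour reduction preserves properness along each edge from child to parent; the two cases are
whether or not the parent is itself a root of the forest. -/
theorem forestColor_ne {k i : ℕ} {v u : Fin n} (hu : N.graph.Adj v u)
    (hlt : N.id v < N.id u) (hi : N.parentIdx v u = i) :
    N.forestColor k v i ≠ N.forestColor k u i := by
  induction k generalizing v u with
  | zero => exact hlt.ne
  | succ k ih =>
    rw [forestColor_succ_parent hu hlt hi]
    by_cases h : ∃ w, N.graph.Adj u w ∧ N.id u < N.id w ∧ N.parentIdx u w = i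
    · obtain ⟨w, h1, h2, h3⟩ := h
      rw [forestColor_succ_parent h1 h2 h3]
      exact reduceColor_ne (ih hu hlt hi) (ih h1 h2 h3)
    · rw [forestColor_succ_root h]
      exact reduceColor_ne_mod_two (ih hu hlt hi)

theorem forestColor_lt {κ : ℕ} (hid : N.IdBound κ) (k : ℕ) (v : Fin n) (i : ℕ) :
    N.forestColor k v i < paletteBound (n ^ κ) k := by
  induction k generalizing v with
  | zero => exact hid v
  | succ k ih =>
    have h : ∀ v, N.forestColor k v i < 2 ^ Nat.clog 2 (paletteBound (n ^ κ) k) :=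
      fun v => (ih v).trans_le (Nat.le_pow_clog Nat.one_lt_two _)
    rw [paletteBound]
    by_cases hp : ∃ u, N.graph.Adj v u ∧ N.id v < N.id u ∧ N.parentIdx v u = i
    · obtain ⟨u, h1, h2, h3⟩ := hp
      rw [forestColor_succ_parent h1 h2 h3]
      exact reduceColor_lt (h v) (h u)
    · rw [forestColor_succ_root hp]
      omega

theorem two_mul_add_two_le {q : ℕ} (hq : 3 ≤ q) : 2 * q + 2 ≤ 2 ^ q := by
  induction q, hq using Nat.le_induction with
  | base => norm_num
  | succ q _ ih => rw [pow_succ]; omega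

/-- A bound that holds after every round, for the lengths of messages. The summand `3` ensures `2 *
q + 2 ≤ 2 ^ q`, so the range is preserved by a reduction. -/
theorem forestColor_lt_two_pow {κ : ℕ} (hid : N.IdBound κ) (k : ℕ) (v : Fin n) (i : ℕ) :
    N.forestColor k v i < 2 ^ (κ * (Nat.log 2 n + 1) + 3) := by
  set q := κ * (Nat.log 2 n + 1) + 3 with hq
  induction k generalizing v with
  | zero =>
    exact (hid v).trans_le ((pow_le_two_pow n κ).trans
      (Nat.pow_le_pow_right Nat.two_pos (Nat.le_add_right _ 3)))
  | succ k ih =>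
    have h2 := two_mul_add_two_le (q := q) (by omega)
    by_cases hp : ∃ u, N.graph.Adj v u ∧ N.id v < N.id u ∧ N.parentIdx v u = i
    · obtain ⟨u, h1, h2', h3⟩ := hp
      rw [forestColor_succ_parent h1 h2' h3]
      exact (reduceColor_lt (ih v) (ih u)).trans_le h2
    · rw [forestColor_succ_root hp]
      omega

variable (N) in
/-- The step in which the edge `vu` is considered. -/
def edgeStep (D : ℕ) (v u : Fin n) : ℕ :=
  if N.id v < N.id u then
    N.parentIdx v u * D + N.forestColor (logStar n) u (N.parentIdx v u)
  else N.parentIdx u v * D + N.forestColor (logStar n) v (N.parentIdx u v)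

theorem edgeStep_comm (D : ℕ) {v u : Fin n} (h : v ≠ u) : N.edgeStep D v u = N.edgeStep D u v := by
  rw [edgeStep, edgeStep]
  rcases lt_trichotomy (N.id v) (N.id u) with h' | h' | h'
  · rw [if_pos h', if_neg h'.not_gt]
  · exact absurd (N.id_injective h') h
  · rw [if_pos h', if_neg h'.not_gt]

theorem edgeStep_of_lt (D : ℕ) {v u : Fin n} (h : N.id v < N.id u) : N.edgeStep D v u =
    N.parentIdx v u * D + N.forestColor (logStar n) u (N.parentIdx v u) := if_pos h

end Network

/-! ### The colouring phase of the deterministic algorithm. -/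

section ColorPhase

variable {n : ℕ} (N : Network n) (D : ℕ)

/-- The states of the deterministic algorithm. -/
def starRun (t : ℕ) (v : Fin n) : StarState := (starAlg D).run N t v

variable {N D}

theorem starRun_succ_of_done {t : ℕ} {v : Fin n} (h : (starRun N D t v).Done D) :
    starRun N D (t + 1) v = starRun N D t v :=
  SyncAlg.run_succ_of_done (A := starAlg D) h

theorem starRun_succ {t : ℕ} {v : Fin n} (h : ¬ (starRun N D t v).Done D) :
    starRun N D (t + 1) v = (starRun N D t v).upd D
      (N.pull (fun u => (starRun N D t u).msg D (N.id v)) 0 v) :=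
  SyncAlg.run_succ_of_not_done (A := starAlg D) h

/-- Before the colours are final, `stepOf` is meaningless; but whatever its value, a node with a
neighbour cannot pass the threshold in `Done` this early. -/
theorem StarState.not_done {x : StarState} {v u : Fin n} (hli : x.li = N.localInput v)
    (hu : N.graph.Adj v u) (ht : x.time < logStar n + 4) : ¬ x.Done D := by
  intro h
  have := h (N.id u) (by rw [hli]; exact Network.id_mem_nbrs.2 hu)
  rw [hli] at this
  change logStar n + 2 + _ + 2 ≤ _ at this
  omega

variable (N) in
/-- The indices of the edges from children. -/
def childIdx (v : Fin n) : ℕ → ℕ :=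
  N.pull (fun u => if N.id u < N.id v then N.parentIdx u v else 0) 0 v

variable (N) in
/-- The colours of the parents. -/
def parentColor (v : Fin n) : ℕ → ℕ :=
  N.pull (fun u => if N.id v < N.id u then N.forestColor (logStar n) u (N.parentIdx v u) else 0) 0 v

theorem pull_congr {α : Type*} {f g : Fin n → α} {d : α} {v : Fin n}
    (h : ∀ u, N.graph.Adj v u → f u = g u) : N.pull f d v = N.pull g d v := by
  funext i
  by_cases hi : ∃ u, N.graph.Adj v u ∧ N.id u = i
  · obtain ⟨u, hu, rfl⟩ := hi
    rw [Network.pull_id hu, Network.pull_id hu, h u hu]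
  · rw [Network.pull_of_not hi, Network.pull_of_not hi]

theorem newCol_eq {k : ℕ} {v : Fin n} {x : StarState} {inb : ℕ → ℕ} (hli : x.li = N.localInput v)
    (hcol : x.col = N.forestColor k v) (hinb : ∀ u, N.graph.Adj v u → N.id v < N.id u →
      inb (N.id u) = N.forestColor k u (N.parentIdx v u)) :
    x.newCol inb = N.forestColor (k + 1) v := by
  classical
  funext i
  rw [StarState.newCol, hli, hcol]
  by_cases h : ∃ j ∈ (N.localInput v).nbrs,
      (N.localInput v).id < j ∧ (N.localInput v).ownIdx j = i
  · rw [dif_pos h]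
    obtain ⟨h1, h2, h3⟩ := h.choose_spec
    obtain ⟨u, hu, e⟩ := Network.mem_nbrs.1 h1
    rw [← e] at h2 h3 ⊢
    rw [Network.forestColor_succ_parent hu h2 h3, hinb u hu h2]
    congr 2
  · rw [dif_neg h, Network.forestColor_succ_root]
    rintro ⟨u, h1, h2, h3⟩
    exact h ⟨_, Network.id_mem_nbrs.2 h1, h2, h3⟩

theorem starRun_one {v u : Fin n} (hu : N.graph.Adj v u) : starRun N D 1 v =
    ⟨N.localInput v, 1, childIdx N v, N.forestColor 0 v, fun _ => 0, 0, [], fun _ => 0⟩ := by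
  have h0 : ∀ v, starRun N D 0 v =
    ⟨N.localInput v, 0, fun _ => 0, fun _ => N.id v, fun _ => 0, 0, [], fun _ => 0⟩ := fun _ => rfl
  rw [starRun_succ (StarState.not_done (by rw [h0]) hu (by rw [h0]; simp only; omega)), h0,
    StarState.upd, if_pos rfl]
  have : N.pull (fun u => (starRun N D 0 u).msg D (N.id v)) 0 v = childIdx N v := by
    refine pull_congr fun u hu => ?_
    rw [h0, StarState.msg, if_neg (StarState.not_done rfl hu.symm (by simp only; omega)), if_pos rfl]
    rfl
  rw [this]
  rfl

/-- The first round has told every parent the forest of each edge below it, so a parent sends over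
each edge just the one colour that the child needs. A neighbour is assumed because isolated nodes
are done from the start. -/
theorem starRun_color {k : ℕ} (hk : k ≤ logStar n) {v u : Fin n} (hu : N.graph.Adj v u) :
    starRun N D (k + 1) v = ⟨N.localInput v, k + 1, childIdx N v, N.forestColor k v, fun _ => 0, 0,
      [], fun _ => 0⟩ := by
  induction k generalizing v u with
  | zero => exact starRun_one hu
  | succ k ih =>
    have hnd : ∀ {v u}, N.graph.Adj v u → ¬ (starRun N D (k + 1) v).Done D := fun hu =>
      StarState.not_done (by rw [ih (by omega) hu]) hu (by rw [ih (by omega) hu]; simp only; omega)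
    have hinb : ∀ u, N.graph.Adj v u → N.id v < N.id u →
        N.pull (fun u => (starRun N D (k + 1) u).msg D (N.id v)) 0 v (N.id u) =
          N.forestColor k u (N.parentIdx v u) := by
      intro u hu hlt
      rw [Network.pull_id hu, StarState.msg_color (hnd hu.symm) (by rw [ih (by omega) hu.symm]; simp)
        (by rw [ih (by omega) hu.symm]; show k + 1 < logStar n + 2; omega), ih (by omega) hu.symm]
      refine (if_pos hlt).trans ?_
      show N.forestColor k u (childIdx N u (N.id v)) = _
      rw [childIdx, Network.pull_id hu.symm, if_pos hlt]
    rw [starRun_succ (hnd hu), StarState.upd_color (by rw [ih (by omega) hu]; simp)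
      (by rw [ih (by omega) hu]; show k + 1 < logStar n + 1; omega),
      newCol_eq (by rw [ih (by omega) hu]) (by rw [ih (by omega) hu]) hinb, ih (by omega) hu]

theorem starRun_start {v u : Fin n} (hu : N.graph.Adj v u) :
    starRun N D (logStar n + 2) v = ⟨N.localInput v, logStar n + 2, childIdx N v,
      N.forestColor (logStar n) v, parentColor N v, 0, [], fun _ => 0⟩ := by
  have hc : ∀ {v u}, N.graph.Adj v u → _ := fun hu => starRun_color (N := N) (D := D) le_rfl hu
  have hnd : ∀ {v u}, N.graph.Adj v u → ¬ (starRun N D (logStar n + 1) v).Done D := fun hu =>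
    StarState.not_done (by rw [hc hu]) hu (by rw [hc hu]; simp only; omega)
  have : N.pull (fun u => (starRun N D (logStar n + 1) u).msg D (N.id v)) 0 v =
      parentColor N v := by
    refine pull_congr fun u hu => ?_
    rw [StarState.msg_color (hnd hu.symm) (by rw [hc hu.symm]; simp)
      (by rw [hc hu.symm]; exact Nat.lt_succ_self _), hc hu.symm]
    by_cases hlt : N.id v < N.id u
    · refine (if_pos hlt).trans (Eq.trans ?_ (if_pos hlt).symm)
      show N.forestColor _ u (childIdx N u (N.id v)) = _
      rw [childIdx, Network.pull_id hu.symm, if_pos hlt]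
    · exact (if_neg hlt).trans (if_neg hlt).symm
  rw [show logStar n + 2 = logStar n + 1 + 1 from rfl, starRun_succ (hnd hu),
    StarState.upd_parent (by rw [hc hu]; rfl), this, hc hu]

end ColorPhase

/-- The amounts in a stack add up to at most the weight of its top edge, by `below`. -/
theorem Network.StarStacks.pot_le {n : ℕ} {N : Network n} {W : ℕ} (hW : N.WeightBound W)
    {st : Fin n → List (Fin n)} {R σ : Fin n → Fin n → ℕ} {Y : Fin n → ℕ} {s : ℕ}
    (h : N.StarStacks st R σ Y s) (v : Fin n) : Y v ≤ W := by
  have ht := h.total v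
  rcases hv : st v with _ | ⟨u, b⟩
  · rw [hv, List.map_nil, List.sum_nil] at ht
    omega
  · have hu : u ∈ st v := by rw [hv]; simp
    obtain ⟨a', b', hb⟩ := List.append_of_mem (h.symm hu)
    have h1 := h.below v u [] b a' b' hv hb
    have h2 := (hW s(v, u) (h.adj hu)).2
    rw [hv, List.map_cons, List.sum_cons] at ht
    omega

theorem pushes_congr {α : Type*} {w w' y y' : α → ℕ} {p : ℕ} {l : List α}
    (hw : ∀ a ∈ l, w a = w' a) (hy : ∀ a ∈ l, y a = y' a) : pushes w y p l = pushes w' y' p l := by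
  induction l generalizing p with
  | nil => rfl
  | cons b l ih =>
    have ih' := fun p => @ih p (fun a ha => hw a (List.mem_cons_of_mem _ ha))
      (fun a ha => hy a (List.mem_cons_of_mem _ ha))
    rw [pushes, pushes, ih', ih', hw b List.mem_cons_self, hy b List.mem_cons_self]

/-! ### The steps of the star phase: one for each forest and colour. -/

section StarPhase

variable {n : ℕ} {N : Network n} {D s : ℕ}

/-- What a node knows after the first `logStar n + 2` rounds. -/
structure StarState.Knows (N : Network n) (v : Fin n) (x : StarState) : Prop where
  li : x.li = N.localInput v
  idx : x.idx = childIdx N v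
  col : x.col = N.forestColor (logStar n) v
  pcol : x.pcol = parentColor N v

namespace StarState.Knows

variable {v u : Fin n} {x : StarState}

theorem stepOf (h : x.Knows N v) (hu : N.graph.Adj v u) :
    x.stepOf D (N.id u) = N.edgeStep D v u := by
  rw [StarState.stepOf, h.li, h.idx, h.col, h.pcol]
  change (if N.id u < N.id v then _ else _) = _
  rcases lt_or_ge (N.id u) (N.id v) with hlt | hge
  · rw [if_pos hlt, Network.edgeStep_comm _ hu.ne, Network.edgeStep_of_lt _ hlt, childIdx,
      Network.pull_id hu, if_pos hlt]
  · have hlt : N.id v < N.id u := lt_of_le_of_ne hge fun e => hu.ne (N.id_injective e)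
    rw [if_neg hge.not_gt, Network.edgeStep_of_lt _ hlt, parentColor, Network.pull_id hu,
      if_pos hlt]
    rfl

theorem done_iff (h : x.Knows N v) : x.Done D ↔
    ∀ u, N.graph.Adj v u → logStar n + 2 + 2 * N.edgeStep D v u + 2 ≤ x.time := by
  constructor
  · intro hd u hu
    have := hd (N.id u) (by rw [h.li]; exact Network.id_mem_nbrs.2 hu)
    rwa [h.stepOf hu, h.li] at this
  · intro hd j hj
    rw [h.li] at hj
    obtain ⟨u, hu, rfl⟩ := Network.mem_nbrs.1 hj
    rw [h.stepOf hu, h.li]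
    exact hd u hu

theorem mem_children (h : x.Knows N v) : N.id u ∈ x.children D s ↔
    N.graph.Adj v u ∧ N.id u < N.id v ∧ N.edgeStep D v u = s := by
  rw [StarState.children, Finset.mem_toList, Finset.mem_filter, h.li, Network.id_mem_nbrs]
  refine and_congr_right fun hu => ?_
  rw [h.stepOf hu]
  rfl

theorem mem_parents (h : x.Knows N v) {inb : ℕ → ℕ} : N.id u ∈ x.parents D inb s ↔
    N.graph.Adj v u ∧ N.id v < N.id u ∧ N.edgeStep D v u = s ∧ 0 < inb (N.id u) := by
  rw [StarState.parents, Finset.mem_toList, Finset.mem_filter, h.li, Network.id_mem_nbrs]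
  refine and_congr_right fun hu => ?_
  rw [h.stepOf hu]
  rfl

end StarState.Knows

theorem exists_map_id_eq {l : List ℕ} {v : Fin n} (hl : ∀ j ∈ l, j ∈ (N.localInput v).nbrs)
    (hnd : l.Nodup) : ∃ l' : List (Fin n), l'.map N.id = l ∧ l'.Nodup := by
  have : l ∈ Set.range (List.map N.id) := by
    rw [Set.range_list_map]
    intro j hj
    obtain ⟨u, -, rfl⟩ := Network.mem_nbrs.1 (hl j hj)
    exact ⟨u, rfl⟩
  obtain ⟨l', rfl⟩ := this
  exact ⟨l', rfl, hnd.of_map _⟩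

theorem mem_of_map_id {l : List (Fin n)} {u : Fin n} : u ∈ l ↔ N.id u ∈ l.map N.id :=
  (List.mem_map_of_injective N.id_injective).symm

variable (N D s) in
/-- The states after `s` steps. -/
structure StarInv (x : Fin n → StarState) : Prop where
  li : ∀ v, (x v).li = N.localInput v
  knows : ∀ {v u}, N.graph.Adj v u → (x v).Knows N v
  time_eq : ∀ v, ¬ (x v).Done D → (x v).time = logStar n + 2 + 2 * s
  time_le : ∀ {v u}, N.graph.Adj v u → (x v).time ≤ logStar n + 2 + 2 * s
  valid : ∃ st R σ, N.StarStacks st R σ (fun v => (x v).pot) s ∧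
    ∀ v, (x v).stk = (st v).map N.id
  cover : ∀ v u, N.graph.Adj v u → N.edgeStep D v u < s →
    N.weight s(v, u) ≤ (x v).pot + (x u).pot

theorem StarState.done_of_isolated {x : StarState} {v : Fin n} (hli : x.li = N.localInput v)
    (h : ∀ u, ¬ N.graph.Adj v u) : x.Done D := by
  intro j hj
  rw [hli] at hj
  obtain ⟨u, hu, -⟩ := Network.mem_nbrs.1 hj
  exact absurd hu (h u)

theorem starRun_of_done {t t' : ℕ} {v : Fin n} (h : (starRun N D t v).Done D) (ht : t ≤ t') :
    starRun N D t' v = starRun N D t v := by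
  induction t', ht using Nat.le_induction with
  | base => rfl
  | succ m _ ih => rw [starRun_succ_of_done (by rw [ih]; exact h), ih]

theorem starInv_zero : StarInv N D 0 (starRun N D (logStar n + 2)) := by
  have hiso : ∀ v, (∀ u, ¬ N.graph.Adj v u) → starRun N D (logStar n + 2) v =
      ⟨N.localInput v, 0, fun _ => 0, fun _ => N.id v, fun _ => 0, 0, [], fun _ => 0⟩ := fun v hv =>
    starRun_of_done (t := 0) (StarState.done_of_isolated (N := N) rfl hv) (Nat.zero_le _)
  have hbase : ∀ v, (starRun N D (logStar n + 2) v).li = N.localInput v ∧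
      (starRun N D (logStar n + 2) v).pot = 0 ∧ (starRun N D (logStar n + 2) v).stk = [] := by
    intro v
    by_cases hv : ∃ u, N.graph.Adj v u
    · obtain ⟨u, hu⟩ := hv
      rw [starRun_start hu]
      exact ⟨rfl, rfl, rfl⟩
    · push Not at hv
      rw [hiso v hv]
      exact ⟨rfl, rfl, rfl⟩
  refine ⟨fun v => (hbase v).1, fun hu => ?_, fun v hd => ?_, fun hu => ?_, ?_, fun v u _ h =>
    absurd h (Nat.not_lt_zero _)⟩
  · rw [starRun_start hu]
    exact ⟨rfl, rfl, rfl, rfl⟩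
  · by_cases hv : ∃ u, N.graph.Adj v u
    · obtain ⟨u, hu⟩ := hv
      rw [starRun_start hu]
    · push Not at hv
      exact absurd (StarState.done_of_isolated (hbase v).1 hv) hd
  · rw [starRun_start hu]
  · refine ⟨fun _ => [], fun _ _ => 0, fun _ _ => 0, ?_, fun v => (hbase v).2.2⟩
    rw [show (fun v => (starRun N D (logStar n + 2) v).pot) = fun _ => 0 from
      funext fun v => (hbase v).2.1]
    exact Network.starStacks_empty N

namespace StarInv

variable {x : Fin n → StarState}

theorem not_done (h : StarInv N D s x) {v u : Fin n} (hu : N.graph.Adj v u)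
    (hs : s ≤ N.edgeStep D v u) : ¬ (x v).Done D := by
  intro hd
  have h1 := (h.knows hu).done_iff.1 hd u hu
  have h2 := h.time_le hu
  omega

theorem exists_le_edgeStep (h : StarInv N D s x) {v : Fin n} (hd : ¬ (x v).Done D) :
    ∃ u, N.graph.Adj v u ∧ s ≤ N.edgeStep D v u := by
  by_contra! hcon
  by_cases hv : ∃ u, N.graph.Adj v u
  · obtain ⟨u, hu⟩ := hv
    refine hd ((h.knows hu).done_iff.2 fun w hw => ?_)
    have := hcon w hw
    rw [h.time_eq v hd]
    omega
  · push Not at hv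
    exact hd (StarState.done_of_isolated (h.li v) hv)

/-- The children of all nodes in step `s`. -/
theorem exists_children (h : StarInv N D s x) : ∃ cl : Fin n → List (Fin n),
    ∀ v, (cl v).map N.id = (x v).children D s ∧ (cl v).Nodup ∧
      ∀ u, u ∈ cl v ↔ N.graph.Adj v u ∧ N.id u < N.id v ∧ N.edgeStep D v u = s := by
  have : ∀ v, ∃ l : List (Fin n), l.map N.id = (x v).children D s ∧ l.Nodup := fun v =>
    exists_map_id_eq (v := v) (fun j hj => by
      rw [StarState.children, Finset.mem_toList, Finset.mem_filter, h.li] at hj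
      exact hj.1) (Finset.nodup_toList _)
  choose cl h1 h2 using this
  refine ⟨cl, fun v => ⟨h1 v, h2 v, fun u => ?_⟩⟩
  rw [mem_of_map_id (N := N), h1]
  by_cases hv : ∃ u, N.graph.Adj v u
  · obtain ⟨w, hw⟩ := hv
    exact (h.knows hw).mem_children
  · push Not at hv
    refine ⟨fun hj => ?_, fun hj => absurd hj.1 (hv u)⟩
    rw [StarState.children, Finset.mem_toList, Finset.mem_filter, h.li] at hj
    exact absurd (Network.id_mem_nbrs.1 hj.1) (hv u)

end StarInv

theorem edgeStep_child {v u : Fin n} (hu : N.graph.Adj v u) (hlt : N.id u < N.id v) :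
    N.edgeStep D v u = N.parentIdx u v * D + N.forestColor (logStar n) v (N.parentIdx u v) := by
  rw [Network.edgeStep_comm _ hu.ne, Network.edgeStep_of_lt _ hlt]


/-- A step `s = i * D + c` with `c < D` encodes the forest `i` and the colour `c` of the parent. -/
theorem parentIdx_eq_div (hD : ∀ v i, N.forestColor (logStar n) v i < D) {v u : Fin n}
    (hu : N.graph.Adj v u) (hlt : N.id u < N.id v) (hs : N.edgeStep D v u = s) :
    N.parentIdx u v = s / D ∧ N.forestColor (logStar n) v (s / D) = s % D := by
  have h := hD v (N.parentIdx u v)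
  rw [edgeStep_child hu hlt] at hs
  have h1 : s / D = N.parentIdx u v := by
    rw [← hs, mul_comm, Nat.mul_add_div (by omega), Nat.div_eq_of_lt h, add_zero]
  rw [h1, ← hs, mul_comm, Nat.mul_add_mod, Nat.mod_eq_of_lt h]
  exact ⟨rfl, rfl⟩

/-- A leaf that were also a centre in the same step would have the colour of its own parent in the
same forest. -/
theorem leaf_children_eq_nil (hD : ∀ v i, N.forestColor (logStar n) v i < D)
    {cl : Fin n → List (Fin n)}
    (hcl : ∀ v u, u ∈ cl v ↔ N.graph.Adj v u ∧ N.id u < N.id v ∧ N.edgeStep D v u = s)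
    {v u : Fin n} (hu : u ∈ cl v) : cl u = [] := by
  refine List.eq_nil_iff_forall_not_mem.2 fun w hw => ?_
  obtain ⟨h1, h2, h3⟩ := (hcl v u).1 hu
  obtain ⟨h4, h5, h6⟩ := (hcl u w).1 hw
  obtain ⟨h7, h8⟩ := parentIdx_eq_div hD h1 h2 h3
  obtain ⟨-, h10⟩ := parentIdx_eq_div hD h4 h5 h6
  exact Network.forestColor_ne h1.symm h2 h7 (h10.trans h8.symm)

/-- All edges of a step lie in one forest, where a node has at most one parent. -/
theorem centre_unique (hD : ∀ v i, N.forestColor (logStar n) v i < D)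
    {cl : Fin n → List (Fin n)}
    (hcl : ∀ v u, u ∈ cl v ↔ N.graph.Adj v u ∧ N.id u < N.id v ∧ N.edgeStep D v u = s)
    {v v' u : Fin n} (hu : u ∈ cl v) (hu' : u ∈ cl v') : v = v' := by
  obtain ⟨h1, h2, h3⟩ := (hcl v u).1 hu
  obtain ⟨h4, h5, h6⟩ := (hcl v' u).1 hu'
  exact Network.parentIdx_injective h1.symm h4.symm h2 h5
    ((parentIdx_eq_div hD h1 h2 h3).1.trans (parentIdx_eq_div hD h4 h5 h6).1.symm)


end StarPhase

/-! ### One step of the star phase. -/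

section StarStep

variable {n : ℕ} {N : Network n} {D s : ℕ} {cl : Fin n → List (Fin n)}

theorem Network.starMates_subset {Y : Fin n → ℕ} {v u : Fin n} (h : u ∈ N.starMates Y cl v) :
    u ∈ cl v := pushes_sublist.subset h

/-- Pushed amounts are positive, so a leaf recognizes from the amount alone whether its edge was
pushed. -/
theorem Network.starAmount_pos_iff {Y : Fin n → ℕ} {v u : Fin n} (hnd : (cl v).Nodup) :
    0 < N.starAmount Y cl v u ↔ u ∈ N.starMates Y cl v := by
  constructor
  · intro h
    by_contra hu
    rw [starAmount, lookup_eq_none hu] at h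
    exact absurd h (lt_irrefl 0)
  · intro h
    obtain ⟨⟨a, r⟩, hr, rfl⟩ := List.mem_map.1 h
    rw [starAmount, lookup_of_mem (l := N.starPushes Y cl v) (hnd.sublist pushes_sublist) hr]
    obtain ⟨P, Q, hPQ⟩ := List.append_of_mem hr
    exact (pushes_append hPQ).1

theorem centrePushes_eq {x : StarState} {v : Fin n} {inb : ℕ → ℕ} {Y : Fin n → ℕ}
    (hli : x.li = N.localInput v) (hcl : (cl v).map N.id = x.children D s)
    (hadj : ∀ u ∈ cl v, N.graph.Adj v u) (hpot : x.pot = Y v)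
    (hinb : ∀ u ∈ cl v, inb (N.id u) = Y u) :
    x.centrePushes D inb s = (N.starPushes Y cl v).map (Prod.map N.id id) := by
  rw [StarState.centrePushes, ← hcl, pushes_map, hpot, Network.starPushes, hli]
  congr 1
  exact pushes_congr (fun u hu => Network.localInput_weight (hadj u hu)) hinb

/-- The step `s`, in two rounds. -/
theorem starInv_succ (hD : ∀ v i, N.forestColor (logStar n) v i < D)
    (h : StarInv N D s (starRun N D (logStar n + 2 + 2 * s))) :
    StarInv N D (s + 1) (starRun N D (logStar n + 2 + 2 * (s + 1))) := by
  set t := logStar n + 2 + 2 * s with ht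
  obtain ⟨cl, hcl⟩ := h.exists_children
  have hmem := fun v => (hcl v).2.2
  set Y : Fin n → ℕ := fun v => (starRun N D t v).pot with hY
  set inb : Fin n → ℕ → ℕ := fun v =>
    N.pull (fun u => (starRun N D t u).msg D (N.id v)) 0 v with hinb
  set inb' : Fin n → ℕ → ℕ := fun v =>
    N.pull (fun u => (starRun N D (t + 1) u).msg D (N.id v)) 0 v with hinb'
  -- Clocks of nodes that are done stand still. Both endpoints of an edge of step `s` are still
  -- running, hence synchronous, so the messages they exchange have the intended meaning.
  have hndx : ∀ {v u}, u ∈ cl v → ¬ (starRun N D t v).Done D ∧ ¬ (starRun N D t u).Done D := by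
    intro v u hu
    obtain ⟨h1, -, h2⟩ := (hmem v u).1 hu
    exact ⟨h.not_done h1 h2.ge,
      h.not_done h1.symm (by rw [Network.edgeStep_comm _ h1.ne']; exact h2.ge)⟩
  have hnil : ∀ {v}, (starRun N D t v).Done D → cl v = [] := fun {v} hd =>
    List.eq_nil_iff_forall_not_mem.2 fun u hu => (hndx hu).1 hd
  have hpush : ∀ v, (starRun N D t v).centrePushes D (inb v) s =
      (N.starPushes Y cl v).map (Prod.map N.id id) := by
    refine fun v => centrePushes_eq (h.li v) (hcl v).1 (fun u hu => ((hmem v u).1 hu).1) rfl ?_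
    intro u hu
    rw [hinb]
    refine (Network.pull_id ((hmem v u).1 hu).1).trans ?_
    exact StarState.msg_pot (hndx hu).2 (by rw [h.time_eq u (hndx hu).2, h.li]; rfl)
  have hx' : ∀ v, ¬ (starRun N D t v).Done D →
      starRun N D (t + 1) v = (starRun N D t v).centre D (inb v) s := fun v hd => by
    rw [starRun_succ hd, StarState.upd_centre (s := s) (by rw [h.time_eq v hd, h.li]; rfl)]
  have hli' : ∀ v, (starRun N D (t + 1) v).li = N.localInput v := fun v => by
    by_cases hd : (starRun N D t v).Done D
    · rw [starRun_succ_of_done hd, h.li]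
    · rw [hx' v hd]; exact h.li v
  have hknows' : ∀ {v u}, N.graph.Adj v u → (starRun N D (t + 1) v).Knows N v := by
    intro v u hu
    by_cases hd : (starRun N D t v).Done D
    · rw [starRun_succ_of_done hd]; exact h.knows hu
    · rw [hx' v hd]
      exact ⟨(h.knows hu).li, (h.knows hu).idx, (h.knows hu).col, (h.knows hu).pcol⟩
  have htime' : ∀ v, ¬ (starRun N D t v).Done D → (starRun N D (t + 1) v).time = t + 1 := by
    intro v hd
    rw [hx' v hd]
    exact congrArg (· + 1) (h.time_eq v hd)
  have hnd' : ∀ v, ¬ (starRun N D t v).Done D → ¬ (starRun N D (t + 1) v).Done D := by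
    intro v hd hd'
    obtain ⟨u, hu, hs⟩ := h.exists_le_edgeStep hd
    have := (hknows' hu).done_iff.1 hd' u hu
    rw [htime' v hd] at this
    omega
  have hinb'_eq : ∀ {v u}, v ∈ cl u → inb' v (N.id u) = N.starAmount Y cl u v := by
    intro v u hv
    have hd := (hndx hv).1
    have hvu := ((hmem u v).1 hv).1.symm
    rw [hinb']
    refine (Network.pull_id hvu).trans ?_
    rw [StarState.msg_amt (s := s) (hnd' u hd) (by rw [htime' u hd, hli']; rfl), hx' u hd]
    show (((starRun N D t u).centrePushes D (inb u) s).lookup (N.id v)).getD 0 = _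
    rw [hpush, lookup_map N.id_injective]
    rfl
  have hx'' : ∀ v, ¬ (starRun N D t v).Done D →
      starRun N D (t + 2) v = (starRun N D (t + 1) v).leaf D (inb' v) s := fun v hd => by
    rw [show t + 2 = t + 1 + 1 from rfl, starRun_succ (hnd' v hd),
      StarState.upd_leaf (s := s) (by rw [htime' v hd, hli']; rfl)]
  have hdone : ∀ v, (starRun N D t v).Done D → starRun N D (t + 2) v = starRun N D t v :=
    fun v hd => starRun_of_done hd (by omega)
  have : ∀ v, ∃ l : List (Fin n), l.map N.id = (starRun N D (t + 1) v).parents D (inb' v) s ∧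
      l.Nodup := fun v => exists_map_id_eq (v := v) (fun j hj => by
    rw [StarState.parents, Finset.mem_toList, Finset.mem_filter, hli'] at hj
    exact hj.1) (Finset.nodup_toList _)
  choose par hpar hparnd using this
  have hpar' : ∀ v u, u ∈ par v ↔ v ∈ N.starMates Y cl u := by
    intro v u
    rw [mem_of_map_id (N := N), hpar]
    by_cases hvu : N.graph.Adj v u
    · rw [(hknows' hvu).mem_parents, ← Network.starAmount_pos_iff (hcl u).2.1]
      constructor
      · rintro ⟨h1, h2, h3, h4⟩
        rwa [hinb'_eq ((hmem u v).2 ⟨h1.symm, h2, by rw [Network.edgeStep_comm _ h1.ne']; exact h3⟩)]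
          at h4
      · intro h4
        have hv := Network.starMates_subset ((Network.starAmount_pos_iff (hcl u).2.1).1 h4)
        obtain ⟨h1, h2, h3⟩ := (hmem u v).1 hv
        exact ⟨h1.symm, h2, by rw [Network.edgeStep_comm _ h1.ne']; exact h3,
          by rw [hinb'_eq hv]; exact h4⟩
    · refine ⟨fun hj => ?_, fun hv => ?_⟩
      · rw [StarState.parents, Finset.mem_toList, Finset.mem_filter, hli'] at hj
        exact absurd (Network.id_mem_nbrs.1 hj.1) hvu
      · exact absurd ((hmem u v).1 (Network.starMates_subset hv)).1.symm hvu
  have hparnil : ∀ {v}, (starRun N D t v).Done D → par v = [] := fun {v} hd =>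
    List.eq_nil_iff_forall_not_mem.2 fun u hu =>
      (hndx (Network.starMates_subset ((hpar' v u).1 hu))).2 hd
  have hpot : ∀ v, (starRun N D (t + 2) v).pot = Y v + ((N.starPushes Y cl v).map Prod.snd).sum +
      ((par v).map fun u => N.starAmount Y cl u v).sum := by
    intro v
    by_cases hd : (starRun N D t v).Done D
    · rw [hdone v hd, hparnil hd, Network.starPushes, hnil hd]
      rfl
    · rw [hx'' v hd]
      show (starRun N D (t + 1) v).pot +
        (((starRun N D (t + 1) v).parents D (inb' v) s).map (inb' v)).sum = _
      congr 1
      · rw [hx' v hd]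
        show _ + (((starRun N D t v).centrePushes D (inb v) s).map Prod.snd).sum = _
        rw [hpush, List.map_map]
        rfl
      · rw [← hpar, List.map_map]
        congr 1
        refine List.map_congr_left fun u hu => ?_
        exact hinb'_eq (Network.starMates_subset ((hpar' v u).1 hu))
  have hstk : ∀ v, (starRun N D (t + 2) v).stk =
      (par v ++ (N.starMates Y cl v).reverse).map N.id ++ (starRun N D t v).stk := by
    intro v
    by_cases hd : (starRun N D t v).Done D
    · rw [hdone v hd, hparnil hd, Network.starMates, Network.starPushes, hnil hd]
      rfl
    · rw [hx'' v hd]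
      show (starRun N D (t + 1) v).parents D (inb' v) s ++ (starRun N D (t + 1) v).stk = _
      rw [← hpar, List.map_append, List.append_assoc, hx' v hd]
      congr 1
      show (((starRun N D t v).centrePushes D (inb v) s).map Prod.fst).reverse ++ _ = _
      rw [hpush, List.map_map, List.map_reverse, Network.starMates, List.map_map]
      rfl
  obtain ⟨st, R, σ, hS, hst⟩ := h.valid
  obtain ⟨⟨R', σ', hS'⟩, hcov⟩ := hS.push_stars (cl := cl) (par := par) (fun v => (hcl v).2.1)
    (fun {v u} hu => ((hmem v u).1 hu).1) (leaf_children_eq_nil hD hmem) (centre_unique hD hmem)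
    hpar' hparnd hpot
  -- Potentials never decrease, so edges of earlier steps stay covered.
  have hmono : ∀ v, Y v ≤ (starRun N D (t + 2) v).pot := fun v => by
    rw [hpot, add_assoc]; exact Nat.le_add_right _ _
  show StarInv N D (s + 1) (starRun N D (t + 2))
  refine ⟨fun v => ?_, fun {v u} hu => ?_, fun v hd' => ?_, fun {v u} hu => ?_,
    ⟨_, _, _, hS', fun v => ?_⟩, fun v u hvu hs => ?_⟩
  · by_cases hd : (starRun N D t v).Done D
    · rw [hdone v hd, h.li]
    · rw [hx'' v hd]; exact hli' v
  · by_cases hd : (starRun N D t v).Done D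
    · rw [hdone v hd]; exact h.knows hu
    · rw [hx'' v hd]
      exact ⟨(hknows' hu).li, (hknows' hu).idx, (hknows' hu).col, (hknows' hu).pcol⟩
  · by_cases hd : (starRun N D t v).Done D
    · rw [hdone v hd] at hd'
      exact absurd hd hd'
    · rw [hx'' v hd]
      exact congrArg (· + 1) (htime' v hd)
  · by_cases hd : (starRun N D t v).Done D
    · rw [hdone v hd]
      exact (h.time_le hu).trans (by omega)
    · rw [hx'' v hd]
      exact (congrArg (· + 1) (htime' v hd)).le
  · rw [hstk, hst, ← List.map_append]
  · rcases (Nat.lt_succ_iff.1 hs).lt_or_eq with hs | hs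
    · exact (h.cover v u hvu hs).trans (Nat.add_le_add (hmono v) (hmono u))
    · rcases lt_or_ge (N.id u) (N.id v) with hlt | hge
      · exact hcov v u ((hmem v u).2 ⟨hvu, hlt, hs⟩)
      · have hlt : N.id v < N.id u := lt_of_le_of_ne hge fun e => hvu.ne (N.id_injective e)
        have := hcov u v ((hmem u v).2
          ⟨hvu.symm, hlt, by rw [Network.edgeStep_comm _ hvu.ne']; exact hs⟩)
        rwa [Sym2.eq_swap, add_comm]

theorem starInv (hD : ∀ v i, N.forestColor (logStar n) v i < D) (s : ℕ) :
    StarInv N D s (starRun N D (logStar n + 2 + 2 * s)) := by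
  induction s with
  | zero => exact starInv_zero
  | succ s ih => exact starInv_succ hD ih

end StarStep

theorem lookup_pushes_le {w y : ℕ → ℕ} {p : ℕ} {l : List ℕ} (a : ℕ) :
    ((pushes w y p l).lookup a).getD 0 ≤ w a := by
  rcases h : (pushes w y p l).lookup a with _ | r
  · exact Nat.zero_le _
  · obtain ⟨P, Q, hPQ, -⟩ := List.lookup_eq_some_iff.1 h
    have := (pushes_append hPQ).2
    rw [Option.getD_some]
    omega

theorem one_sub_zero_le_coinProb {n m T : ℕ} {E : Coins n m → Prop} (h : ∀ ω, E ω) :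
    1 - 0 ≤ coinProb n m T E := by
  rw [le_coinProb_iff]
  simp [h]

/-! ### Running time and message lengths of the deterministic algorithm. -/

section

variable {n : ℕ} {N : Network n} {D κ W : ℕ}

theorem Network.edgeStep_lt (hD : ∀ v i, N.forestColor (logStar n) v i < D) {v u : Fin n}
    (hu : N.graph.Adj v u) : N.edgeStep D v u < N.maxDegree * D := by
  have key : ∀ {v u}, N.graph.Adj v u → N.id v < N.id u →
      N.edgeStep D v u < N.maxDegree * D := by
    intro v u hu hlt
    rw [edgeStep_of_lt _ hlt]
    have h1 := Nat.mul_le_mul_right D (parentIdx_lt hu)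
    have h2 := hD u (N.parentIdx v u)
    rw [Nat.succ_mul] at h1
    omega
  rcases lt_or_ge (N.id v) (N.id u) with hlt | hge
  · exact key hu hlt
  · rw [edgeStep_comm _ hu.ne]
    exact key hu.symm (lt_of_le_of_ne hge fun e => hu.ne (N.id_injective e).symm)

theorem starRun_done (hD : ∀ v i, N.forestColor (logStar n) v i < D) (v : Fin n) :
    (starRun N D (logStar n + 2 + 2 * (N.maxDegree * D)) v).Done D := by
  by_contra hd
  obtain ⟨u, hu, hs⟩ := (starInv hD (N.maxDegree * D)).exists_le_edgeStep hd
  exact absurd (Network.edgeStep_lt hD hu) hs.not_gt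

theorem starRun_msg_lt (hD : ∀ v i, N.forestColor (logStar n) v i < D) (hid : N.IdBound κ)
    (hW : N.WeightBound W) (hWn : W ≤ n ^ κ) {v u : Fin n} (hu : N.graph.Adj v u) (t : ℕ) :
    (starRun N D t v).msg D (N.id u) <
      2 ^ (κ * (Nat.log 2 n + 1) + 3 + (Nat.log 2 n + 1)) := by
  set b := κ * (Nat.log 2 n + 1) + 3 + (Nat.log 2 n + 1) with hb
  have hWb : W < 2 ^ b := (hWn.trans (pow_le_two_pow n κ)).trans_lt
    (Nat.pow_lt_pow_right Nat.one_lt_two (by omega))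
  by_cases hd : (starRun N D t v).Done D
  · rw [StarState.msg, if_pos hd]
    positivity
  rcases Nat.lt_or_ge t (logStar n + 2) with ht | ht
  · rcases t with _ | k
    · rw [StarState.msg_zero hd rfl]
      split_ifs
      · refine (Network.parentIdx_lt hu).trans_le (N.maxDegree_le.trans
          ((Nat.lt_pow_succ_log_self Nat.one_lt_two n).le.trans ?_))
        exact Nat.pow_le_pow_right Nat.two_pos (by omega)
      · positivity
    · have hk := starRun_color (D := D) (show k ≤ logStar n by omega) hu
      rw [StarState.msg_color hd (by rw [hk]; simp) (by rw [hk]; exact ht), hk]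
      split_ifs
      · exact (Network.forestColor_lt_two_pow hid k v _).trans_le
          (Nat.pow_le_pow_right Nat.two_pos (by omega))
      · positivity
  · obtain ⟨s, hs | hs⟩ : ∃ s, t = logStar n + 2 + 2 * s ∨ t = logStar n + 2 + 2 * s + 1 :=
      ⟨(t - (logStar n + 2)) / 2, by omega⟩
    · subst hs
      have h := starInv hD s
      rw [StarState.msg_pot (s := s) hd (by rw [h.time_eq v hd, h.li]; rfl)]
      obtain ⟨st, R, σ, hS, -⟩ := h.valid
      exact (hS.pot_le hW v).trans_lt hWb
    · subst hs
      have h := starInv hD s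
      have hd' : ¬ (starRun N D (logStar n + 2 + 2 * s) v).Done D := fun hd' =>
        hd (by rw [starRun_succ_of_done hd']; exact hd')
      have hx := starRun_succ hd'
      rw [StarState.upd_centre (s := s) (by rw [h.time_eq v hd', h.li]; rfl)] at hx
      rw [StarState.msg_amt (s := s) hd (by
        rw [hx]
        show (starRun N D _ v).time + 1 = logStar (starRun N D _ v).li.n + 2 + 2 * s + 1
        rw [h.time_eq v hd', h.li]; rfl), hx]
      refine lt_of_le_of_lt (lookup_pushes_le _) ?_
      rw [h.li]
      exact (Network.localInput_weight_le hW v _).trans_lt hWb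

variable (κ) in
/-- The deterministic 2-approximation. -/
def starMatching : MsgAlg :=
  ((starAlg (2 ^ (κ + 4))).toLogAlg.solve StarState.stk).haltSmall

theorem forestColor_logStar_lt (hn : 1 < n) (hid : N.IdBound κ) (v : Fin n) (i : ℕ) :
    N.forestColor (logStar n) v i < 2 ^ (κ + 4) :=
  (Network.forestColor_lt hid _ v i).trans_le (paletteBound_logStar_le hn κ)

theorem starMatching_messageBound (hid : N.IdBound κ) (hW : N.WeightBound W) (hWn : W ≤ n ^ κ) :
    (starMatching κ).MessageBound N (logBits (κ + 6) n) := by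
  refine MsgAlg.haltSmall_messageBound fun hn => ?_
  have hb : κ * (Nat.log 2 n + 1) + 3 + (Nat.log 2 n + 1) + 2 ≤ logBits (κ + 6) n := by
    rw [logBits, add_mul]
    omega
  intro ω t v u hvu
  refine (LogAlg.solve_messageBound (A := (starAlg (2 ^ (κ + 4))).toLogAlg)
    (b := κ * (Nat.log 2 n + 1) + 3 + (Nat.log 2 n + 1)) ?_ ω t v u hvu).trans hb
  intro ω v u hvu t e he
  obtain ⟨t', rfl⟩ := (SyncAlg.toLogAlg_run _ t v).2.2 e he
  exact length_bits_le
    (starRun_msg_lt (forestColor_logStar_lt hn hid) hid hW hWn hvu t')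

/-- Nodes get done at different times, but the stack of a node is frozen from then on, so it equals
the stack after the last step. -/
theorem exists_final_stacks (hn : 1 < n) (hid : N.IdBound κ) (c : Fin n → ℕ) :
    ∃ st R σ Y, N.StarStacks st R σ Y (N.maxDegree * 2 ^ (κ + 4)) ∧
      (∀ v u, N.graph.Adj v u → N.weight s(v, u) ≤ Y v + Y u) ∧
      ∀ t v, (starAlg (2 ^ (κ + 4))).toLogAlg.done
          ((starAlg (2 ^ (κ + 4))).toLogAlg.run N c t v).1 →
        StarState.stk ((starAlg (2 ^ (κ + 4))).toLogAlg.run N c t v).1 = (st v).map N.id := by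
  have hD := forestColor_logStar_lt hn hid
  have h := starInv hD (N.maxDegree * 2 ^ (κ + 4))
  obtain ⟨st, R, σ, hS, hst⟩ := h.valid
  refine ⟨st, R, σ, _, hS, fun v u hvu => h.cover v u hvu (Network.edgeStep_lt hD hvu), ?_⟩
  intro t v hd
  rw [(SyncAlg.toLogAlg_run c t v).1] at hd ⊢
  change (starRun N (2 ^ (κ + 4)) t v).Done (2 ^ (κ + 4)) at hd
  show (starRun N (2 ^ (κ + 4)) t v).stk = _
  rw [← hst v, ← starRun_of_done hd (le_max_left t _),
    starRun_of_done (starRun_done hD v) (le_max_right t _)]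

theorem starMatching_computes (hid : N.IdBound κ) :
    (starMatching κ).Computes N N.IsTwoApproxMatching
      ((5 * 2 ^ (κ + 4) + 5) * (N.maxDegree + logStar n)) 0 := by
  rcases Nat.lt_or_ge 1 n with hn | hn
  · refine ⟨fun ω t out hout => ?_, one_sub_zero_le_coinProb fun ω => ?_⟩
    · refine LogAlg.solve_sound ((MsgAlg.haltSmall_haltedWith hn).1 hout) fun _ => ?_
      obtain ⟨st, R, σ, Y, h1, h2, h3⟩ := exists_final_stacks hn hid fun v => ω 0 v
      exact ⟨st, R, σ, Y, _, h1, h2, h3⟩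
    · obtain ⟨st, R, σ, Y, h1, h2, h3⟩ := exists_final_stacks hn hid fun v => ω 0 v
      obtain ⟨out, ho⟩ := LogAlg.solve_halts
        (A := (starAlg (2 ^ (κ + 4))).toLogAlg) (ω := ω)
        (t₀ := logStar n + 2 + 2 * (N.maxDegree * 2 ^ (κ + 4))) (fun v => by
          rw [(SyncAlg.toLogAlg_run _ _ v).1]
          exact starRun_done (forestColor_logStar_lt hn hid) v) h1 h3
      refine ⟨out, MsgAlg.HaltedWith.mono ((MsgAlg.haltSmall_haltedWith hn).2 ho) ?_⟩
      -- With `D = 2 ^ (κ + 4)`, building takes `log* n + 2 + 2 * Δ * D` rounds, the implementation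
      -- `2` and unwinding `3 * Δ * D`. The additive `4` is absorbed because `log* n ≥ 1` for `n >
      -- 1`.
      have := logStar_pos hn
      nlinarith [Nat.zero_le (2 ^ (κ + 4) * logStar n)]
  · refine ⟨fun ω t out hout => ?_, one_sub_zero_le_coinProb fun ω =>
      ⟨_, MsgAlg.haltSmall_haltedWith_of_le hn _⟩⟩
    refine Network.isTwoApproxMatching_of_le_one hn (funext fun v => ?_)
    exact Option.some.inj ((hout v).symm.trans (MsgAlg.haltSmall_haltedWith_of_le hn t v))

end

/-- A deterministic 2-approximation. -/
theorem exists_deterministic_twoApprox (κ : ℕ) : ∃ (A : MsgAlg) (B' C : ℕ),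
    (∀ n, A.maxCoin n = 0) ∧ ∀ (n : ℕ) (N : Network n) (W : ℕ),
      N.IdBound κ → N.WeightBound W → W ≤ n ^ κ →
        A.MessageBound N (logBits B' n) ∧
        A.Computes N N.IsTwoApproxMatching (C * (N.maxDegree + logStar n)) 0 :=
  ⟨starMatching κ, κ + 6, 5 * 2 ^ (κ + 4) + 5, fun _ => rfl, fun _ _ _ hid hW hWn =>
    ⟨starMatching_messageBound hid hW hWn, starMatching_computes hid⟩⟩

end

/-! ### Assembly of the three parts. -/

theorem mainTheorem4 :
    -- randomized, with a local aggregation MIS algorithm as black box, executed on the line graph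
    (∃ C : ℕ, ∀ (κ B : ℕ) (mis : AggAlg) (T : ℕ → ℕ → ℕ) (p : ℕ → ℝ),
      (∀ n, Monotone (T n)) → (∀ n, 0 ≤ p n) →
      (∀ (n : ℕ) (H : Network n), H.IdBound κ →
        mis.SizeBound H (logBits B n) ∧ mis.ComputesMIS H (T n H.maxDegree) (p n)) →
      ∃ (A : MsgAlg) (B' : ℕ), ∀ (n : ℕ) (N : Network n) (W : ℕ),
        N.IdBound κ → N.WeightBound W → W ≤ n ^ κ →
          A.MessageBound N (logBits B' n) ∧
          A.Computes N N.IsTwoApproxMatching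
            (C * ((T (n ^ 2) (2 * N.maxDegree - 2) + 1) * (Nat.log 2 W + 1)))
            (p (n ^ 2) * (Nat.log 2 W + 1))) ∧
    -- randomized, with a CONGEST algorithm for an MIS of the line graph as black box
    (∃ C : ℕ, ∀ (κ B : ℕ) (mis : MsgAlg) (T : ℕ → ℕ → ℕ) (p : ℕ → ℝ),
      (∀ n, Monotone (T n)) → (∀ n, 0 ≤ p n) →
      (∀ (n : ℕ) (H : Network n), H.IdBound κ → H.WeightBound 1 →
        mis.MessageBound H (logBits B n) ∧
        mis.Computes H H.IsLineGraphMIS (T n H.maxDegree) (p n)) →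
      ∃ (A : MsgAlg) (B' : ℕ), ∀ (n : ℕ) (N : Network n) (W : ℕ),
        N.IdBound κ → N.WeightBound W → W ≤ n ^ κ →
          A.MessageBound N (logBits B' n) ∧
          A.Computes N N.IsTwoApproxMatching
            (C * ((T n N.maxDegree + 1) * (Nat.log 2 W + 1)))
            (p n * (Nat.log 2 W + 1))) ∧
    -- deterministic
    (∀ κ : ℕ, ∃ (A : MsgAlg) (B' C : ℕ), (∀ n, A.maxCoin n = 0) ∧
      ∀ (n : ℕ) (N : Network n) (W : ℕ),
        N.IdBound κ → N.WeightBound W → W ≤ n ^ κ →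
          A.MessageBound N (logBits B' n) ∧
          A.Computes N N.IsTwoApproxMatching (C * (N.maxDegree + logStar n)) 0) := by
  exact ⟨⟨12, exists_twoApprox_of_aggMIS⟩, ⟨6, exists_twoApprox_of_lineGraphMIS⟩,
    exists_deterministic_twoApprox⟩
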